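/- Let $\Omega=\{n+im:n,m\in\mathbb Z\}$, $T^2=\mathbb C/\Omega$, let $\wp$ be the Weierstrass function of $\Omega$ and $e_1=\wp(\tfrac12)$, a positive real number. Let $M_2$ be the space of holomorphic maps $W:T^2\to S^2=\mathbb C\cup\{\infty\}$ of degree $2$, with the differentiable structure for which the orbit map $PSL(2,\mathbb C)\times T^2\to M_2$, $(M,s)\mapsto M\odot(\wp(\cdot-s)/e_1)$ (with $\odot$ the action by Möbius transformations), is a local diffeomorphism, and with the $L^2$ kinetic-energy metric given in local coordinates $q^1,\dots,q^8$ by $$g_{ij}=\mathrm{Re}\int_{T^2}\frac{1}{(1+|W|^2)^2}\frac{\partial W}{\partial q^i}\frac{\partial\overline W}{\partial q^j}.$$ Let $\hat g$ be the metric on $PSL(2,\mathbb C)$ given by the same formula for the fields $M\odot(\wp/e_1)$. For $\alpha>0$ put $$f(\alpha)=\int_{T^2}\frac{|\wp|^2}{(1+\alpha^2|\wp|^2)^2}.$$ Theorem 2. The Riemannian manifold $(M_2,g)$ is geodesically incomplete. More precisely: (a) The maps $P:M\mapsto\overline M$ and $R:M\mapsto\tau_3M\tau_3$, $\tau_3=\mathrm{diag}(1,-1)$,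 are isometries of $(PSL(2,\mathbb C),\hat g)$, and $\{1,P,R,PR\}$ is a Klein four-group. The connected component of the identity in its fixed-point set is the curve $\hat\Sigma_V=\{\mathrm{diag}((\alpha e_1)^{1/2},(\alpha e_1)^{-1/2}):\alpha>0\}$, and the image of $\hat\Sigma_V$ under $M\mapsto M\odot(\wp/e_1)$ is $\Sigma_V=\{\alpha\wp:\alpha>0\}\subset M_2$. (b) The metric induced by $g$ on $\Sigma_V$ is $f(\alpha)\,d\alpha^2$, and the length $\ell=\int_0^\infty\sqrt{f(\alpha)}\,d\alpha$ of $\Sigma_V$ is finite. Parametrized by arc length $t\in(0,\ell)$, with $\alpha$ increasing in $t$ from $0$ to $\infty$, $\Sigma_V$ is a maximal geodesic of $(M_2,g)$: it is a geodesic and does not extend to a geodesic on any larger open interval. (c) $f(\alpha)\sim\dfrac{\pi^2}{4\alpha}$ as $\alpha\to0^+$, and $f(\alpha)\sim\dfrac{\pi^2}{4e_1^2\alpha^3}$ as $\alpha\to\infty$. -/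

import Mathlib

open Set Filter Topology MeasureTheory

open scoped ContDiff

noncomputable section

namespace LumpTorus

/-! ### The square torus and the Weierstrass function -/

/-- The period pair `(1, i)` of the square torus `T² = ℂ / Ω`. -/
def squarePeriods : PeriodPair where
  ω₁ := 1
  ω₂ := Complex.I
  indep := by
    rw [LinearIndependent.pair_iff]
    intro s t h
    have h1 := congrArg Complex.re h
    have h2 := congrArg Complex.im h
    simp at h1 h2
    exact ⟨h1, h2⟩

/-- The period module `Ω = {n + i m : n, m ∈ ℤ}`. -/
def Ω : Submodule ℤ ℂ := squarePeriods.lattice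

/-- The Weierstrass function of `Ω`. -/
def wp : ℂ → ℂ := squarePeriods.weierstrassP

/-- `e₁ = ℘(1/2)`, which is a (positive) real number. -/
def e₁ : ℝ := (wp (1 / 2)).re

/-- The half-open unit square, a fundamental domain for `Ω`. -/
def unitSquare : Set ℂ := {z | 0 ≤ z.re ∧ z.re < 1 ∧ 0 ≤ z.im ∧ z.im < 1}

open Classical in
/-- The elliptic function `c ℘` as a map to the Riemann sphere, with value `∞` at the poles. -/
def scaledWp (c : ℂ) (z : ℂ) : OnePoint ℂ :=
  if z ∈ Ω then OnePoint.infty else ((c * wp z : ℂ) : OnePoint ℂ)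

/-! ### The moduli space of degree two elliptic functions -/

/-- The inhomogeneous coordinate on the sphere (with an arbitrary value at `∞`). -/
def toC (x : OnePoint ℂ) : ℂ := x.elim 0 id

open Classical in
/-- The local parametrization `u ↦ 1 / u` of the sphere near `∞`. -/
def invCoord (u : ℂ) : OnePoint ℂ := if u = 0 then OnePoint.infty else ((u⁻¹ : ℂ) : OnePoint ℂ)

/-- Holomorphic maps from `ℂ` to the Riemann sphere: near each point, `W` or `1 / W` is an analytic
function. -/
def IsHolomorphicToSphere (W : ℂ → OnePoint ℂ) : Prop :=
  ∀ z₀ : ℂ, ∃ f : ℂ → ℂ, AnalyticAt ℂ f z₀ ∧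
    ((∀ᶠ z in 𝓝 z₀, W z = (f z : OnePoint ℂ)) ∨ (∀ᶠ z in 𝓝 z₀, W z = invCoord (f z)))

/-- The degree of a holomorphic map from the torus to the sphere is `n`: all but finitely many
values are taken at exactly `n` points of the torus. -/
def HasDegree (W : ℂ → OnePoint ℂ) (n : ℕ) : Prop :=
  ∃ B : Set (OnePoint ℂ), B.Finite ∧
    ∀ c ∉ B, {z ∈ unitSquare | W z = c}.Finite ∧ {z ∈ unitSquare | W z = c}.ncard = n

/-- The moduli space `M₂`: the `Ω`-periodic holomorphic maps `ℂ → S²` of degree two. -/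
def M₂ : Set (ℂ → OnePoint ℂ) :=
  {W | (∀ l ∈ Ω, ∀ z, W (z + l) = W z) ∧ IsHolomorphicToSphere W ∧ HasDegree W 2}

/-! ### The action of `PSL(2, ℂ) × T²` -/

/-- The group `SL(2, ℂ)`. -/
abbrev SL2C : Type := Matrix.SpecialLinearGroup (Fin 2) ℂ

/-- The Möbius group `PSL(2, ℂ)`. -/
abbrev PSL2C : Type := Matrix.ProjectiveSpecialLinearGroup (Fin 2) ℂ

/-- The Möbius action of `PSL(2, ℂ)` on the Riemann sphere. -/
def mobius (g : PSL2C) (x : OnePoint ℂ) : OnePoint ℂ :=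
  (OnePoint.equivProjectivization ℂ).symm (g • OnePoint.equivProjectivization ℂ x)

/-- The orbit map `(g, s) ↦ g ⊙ (℘(z - s) / e₁)`, which depends on `s` modulo `Ω` only. -/
def orbitMap (g : PSL2C) (s : ℂ) (z : ℂ) : OnePoint ℂ :=
  mobius g (scaledWp (1 / (e₁ : ℂ)) (z - s))

/-- The entries of a matrix-valued map. -/
def entries {E : Type*} (A : E → SL2C) (q : E) : Fin 2 → Fin 2 → ℂ := fun i j => (A q).1 i j

/-- Local coordinate systems `ψ : U → M₂`, with `U` open in `ℝ⁸`, in the differentiable structure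
transferred to `M₂` along the orbit map, that is: `ψ` is injective and locally of the form
`q ↦ A(q) ⊙ (℘(z - s(q)) / e₁)` for a smooth immersion `(A, s)` into the eight-dimensional
manifold `SL(2, ℂ) × ℂ`, which covers `PSL(2, ℂ) × T²`. -/
structure IsModuliCoords (U : Set (Fin 8 → ℝ)) (ψ : (Fin 8 → ℝ) → ℂ → OnePoint ℂ) : Prop where
  isOpen : IsOpen U
  mapsTo : MapsTo ψ U M₂
  injOn : InjOn ψ U
  lift : ∀ q₀ ∈ U, ∃ V : Set (Fin 8 → ℝ), IsOpen V ∧ q₀ ∈ V ∧ V ⊆ U ∧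
    ∃ (A : (Fin 8 → ℝ) → SL2C) (s : (Fin 8 → ℝ) → ℂ),
      ContDiffOn ℝ ∞ (fun q => (entries A q, s q)) V ∧
      ∀ q ∈ V, Function.Injective (fderiv ℝ (fun q => (entries A q, s q)) q) ∧
        ψ q = orbitMap (A q : PSL2C) (s q)

/-- Local coordinate systems `ψ : U → PSL(2, ℂ)`, with `U` open in `ℝ⁶`: injective maps which lift
locally to smooth immersions into the six-dimensional manifold `SL(2, ℂ)`. -/
structure IsGroupCoords (U : Set (Fin 6 → ℝ)) (ψ : (Fin 6 → ℝ) → PSL2C) : Prop where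
  isOpen : IsOpen U
  injOn : InjOn ψ U
  lift : ∀ q₀ ∈ U, ∃ V : Set (Fin 6 → ℝ), IsOpen V ∧ q₀ ∈ V ∧ V ⊆ U ∧
    ∃ A : (Fin 6 → ℝ) → SL2C,
      ContDiffOn ℝ ∞ (entries A) V ∧
      ∀ q ∈ V, Function.Injective (fderiv ℝ (entries A) q) ∧ ψ q = (A q : PSL2C)

/-! ### The kinetic energy metric -/

/-- The partial derivative `∂F/∂qⁱ`. -/
def pderiv {n : ℕ} {E : Type*} [NormedAddCommGroup E] [NormedSpace ℝ E]
    (i : Fin n) (F : (Fin n → ℝ) → E) (q : Fin n → ℝ) : E :=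
  lineDeriv ℝ F q (Pi.single i 1)

/-- The components
`g_ij(q) = Re ∫_{T²} (1 + |W|²)⁻² (∂W/∂qⁱ) (∂W̄/∂qʲ)` of the kinetic energy metric for a family
`q ↦ W = ψ q` of fields. (The points where `W = ∞` form a null set.) -/
def metricCoeff {n : ℕ} (ψ : (Fin n → ℝ) → ℂ → OnePoint ℂ) (i j : Fin n) (q : Fin n → ℝ) : ℝ :=
  (∫ z in unitSquare,
    pderiv i (fun p => toC (ψ p z)) q * (starRingEnd ℂ) (pderiv j (fun p => toC (ψ p z)) q) /
      (((1 + ‖toC (ψ q z)‖ ^ 2) ^ 2 : ℝ) : ℂ)).re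

/-- The kinetic energy `T = ∫_{T²} |Ẇ|² / (1 + |W|²)² = g(γ', γ')` of a curve of fields. -/
def kineticEnergy (γ : ℝ → ℂ → OnePoint ℂ) (t : ℝ) : ℝ :=
  ∫ z in unitSquare,
    ‖deriv (fun τ => toC (γ τ z)) t‖ ^ 2 / (1 + ‖toC (γ t z)‖ ^ 2) ^ 2

/-- The length of a curve of fields over a parameter interval. -/
def curveLength (γ : ℝ → ℂ → OnePoint ℂ) (I : Set ℝ) : ENNReal :=
  ∫⁻ t in I, ENNReal.ofReal (√(kineticEnergy γ t))

/-! ### Geodesics -/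

/-- The geodesic equation (with lower index, so as Euler-Lagrange equation of the kinetic energy)
`∑ⱼ g_ij q̈ʲ + ∑ⱼₖ (∂ₖ g_ij - ½ ∂ᵢ g_jk) q̇ʲ q̇ᵏ = 0` at the time `t`. -/
def GeodesicEquation (ψ : (Fin 8 → ℝ) → ℂ → OnePoint ℂ) (q : ℝ → Fin 8 → ℝ) (t : ℝ) : Prop :=
  ∀ i, ∑ j, metricCoeff ψ i j (q t) * deriv (deriv q) t j +
    ∑ j, ∑ k, (pderiv k (metricCoeff ψ i j) (q t) - 1 / 2 * pderiv i (metricCoeff ψ j k) (q t)) *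
      deriv q t j * deriv q t k = 0

/-- `γ` restricts to an (affinely parametrized) geodesic of `(M₂, g)` on the open set `I` of times:
near each time it is smooth and satisfies the geodesic equation in a local coordinate system. -/
def IsGeodesicOn (γ : ℝ → ℂ → OnePoint ℂ) (I : Set ℝ) : Prop :=
  ∀ t₀ ∈ I, ∃ U ψ, IsModuliCoords U ψ ∧
    ∃ (J : Set ℝ) (q : ℝ → Fin 8 → ℝ), IsOpen J ∧ t₀ ∈ J ∧ J ⊆ I ∧ ContDiffOn ℝ ∞ q J ∧
      ∀ t ∈ J, q t ∈ U ∧ γ t = ψ (q t) ∧ GeodesicEquation ψ q t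

/-- Geodesic completeness of `(M₂, g)`: every geodesic on an open interval extends to a geodesic on
the whole real line. -/
def GeodesicallyComplete : Prop :=
  ∀ (γ : ℝ → ℂ → OnePoint ℂ) (I : Set ℝ), IsOpen I → I.OrdConnected → I.Nonempty →
    IsGeodesicOn γ I → ∃ γ' : ℝ → ℂ → OnePoint ℂ, IsGeodesicOn γ' univ ∧ EqOn γ γ' I

/-- A geodesic on the open interval `I` is maximal if it extends to no larger open interval. -/
def IsMaximalGeodesicOn (γ : ℝ → ℂ → OnePoint ℂ) (I : Set ℝ) : Prop :=
  IsGeodesicOn γ I ∧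
    ∀ (γ' : ℝ → ℂ → OnePoint ℂ) (J : Set ℝ), IsOpen J → J.OrdConnected → I ⊆ J →
      IsGeodesicOn γ' J → EqOn γ γ' I → J = I

/-! ### Isometries of `PSL(2, ℂ)` and the curve `Σ_V` -/

/-- Isometries of `(PSL(2, ℂ), ĝ)`, where `ĝ` is the kinetic energy metric of the fields
`g ⊙ (℘ / e₁)`: bijections which carry local coordinate systems to local coordinate systems (so
diffeomorphisms) and preserve the components of the metric. -/
def IsGroupIsometry (F : Equiv.Perm PSL2C) : Prop :=
  (∀ U ψ, IsGroupCoords U ψ ↔ IsGroupCoords U (fun q => F (ψ q))) ∧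
    ∀ U ψ, IsGroupCoords U ψ → ∀ q ∈ U, ∀ i j,
      metricCoeff (fun p => orbitMap (F (ψ p)) 0) i j q =
        metricCoeff (fun p => orbitMap (ψ p) 0) i j q

/-- Complex conjugation `M ↦ M̄` of the entries. -/
def conjSL (M : SL2C) : SL2C := Matrix.SpecialLinearGroup.map (starRingEnd ℂ) M

/-- The map `M ↦ τ₃ M τ₃`, where `τ₃ = diag(1, -1)`. -/
def tauConjSL (M : SL2C) : SL2C :=
  ⟨!![1, 0; 0, -1] * M.1 * !![1, 0; 0, -1], by
    rw [Matrix.det_mul, Matrix.det_mul, M.2]; simp⟩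

/-- The curve `{diag((α e₁)^{1/2}, (α e₁)^{-1/2}) : α > 0}` in `PSL(2, ℂ)`. -/
def sigmaHatV : Set PSL2C :=
  {g | ∃ α : ℝ, 0 < α ∧ ∃ M : SL2C,
    M.1 = !![((√(α * e₁) : ℝ) : ℂ), 0; 0, ((1 / √(α * e₁) : ℝ) : ℂ)] ∧ g = (M : PSL2C)}

/-- The curve `Σ_V = {α ℘ : α > 0}`. -/
def sigmaV : Set (ℂ → OnePoint ℂ) := {W | ∃ α : ℝ, 0 < α ∧ W = scaledWp α}

/-- The function `f(α) = ∫_{T²} |℘|² / (1 + α² |℘|²)²`. -/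
def f (α : ℝ) : ℝ :=
  ∫ z in unitSquare, ‖wp z‖ ^ 2 / (1 + α ^ 2 * ‖wp z‖ ^ 2) ^ 2

/-- The integral `∫₀^∞ √(f(α)) dα`. -/
def totalLength : ℝ := ∫ α in Ioi (0 : ℝ), √(f α)

end LumpTorus

end

noncomputable section

namespace LumpTorus

/-! ### The lattice and the symmetries of `℘` -/

/-! The curve `Σ_V` is a geodesic because it is fixed by symmetries. Complex conjugation, `W(z) ↦
W(-z)` and `W(z) ↦ -W(-iz)` preserve the metric, since each combines an isometry of the torus with
one of the target fixing `0` and `∞`. In coordinates around `Σ_V` (`chart`), with arc length as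
coordinate `0`, they act linearly, fix coordinate `0`, and each other coordinate is reversed by at
least one of them (`exists_reflection`). Hence on `Σ_V`, for `i ≠ 0`, `g_i0` is odd and vanishes,
while `g_00` is even in `qⁱ`, so `∂_i g_00 = 0`; and `g_00 = 1` by arc length. These are the only
terms of the geodesic equation left for `q(t) = (t, 0, …, 0)`. No existence, uniqueness or
regularity theory for geodesics is needed.

The length is finite because `√f` is of order `α^(-1/2)` at `0` and `α^(-3/2)` at `∞`. At `0` the
double pole dominates: substituting `z = √α u` turns `α f(α)` into an integral converging to `∫ |u|⁴
/ (1 + |u|⁴)² = π² / 4` (`tendsto_mul_f`). At `∞` the identity `℘(z) ℘(z + ζ) = -e₁²`, with `ζ = (1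
+ i) / 2`, gives a functional equation exchanging the two ends (`f_eq_f_inv`).

The geodesic cannot reach an endpoint: in a chart at that time the field would be a Möbius transform
of a translate of `℘ / e₁`, so at a generic point `z` its values would converge to a finite nonzero
number (`IsGeodesicOn.exists_tendsto`), whereas `α ℘(z)` tends to `0` or to `∞`. Incompleteness
follows.

That the orbit consists of maps of degree two, and that `chart` is injective, rests on the value
distribution of `℘`: it is onto (`exists_wp_eq`) and even, with `℘(u) = ℘(v)` only for `u ≡ ±v`
(`wp_eq_wp_iff`). The fixed-point set in `PSL(2, ℂ)` is computed on matrices up to sign, and a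
continuous function with values in `{0, -1, 1}` on it isolates the identity component. -/

lemma mem_Ω {z : ℂ} : z ∈ Ω ↔ ∃ m n : ℤ, z = m + n * Complex.I := by
  rw [Ω, PeriodPair.mem_lattice]
  simp [squarePeriods, eq_comm]

lemma mem_Ω_iff {z : ℂ} : z ∈ Ω ↔ (∃ m : ℤ, z.re = m) ∧ ∃ n : ℤ, z.im = n := by
  rw [mem_Ω]
  constructor
  · rintro ⟨m, n, rfl⟩
    simp
  · rintro ⟨⟨m, hm⟩, n, hn⟩
    exact ⟨m, n, by apply Complex.ext <;> simp [hm, hn]⟩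

lemma one_mem_Ω : (1 : ℂ) ∈ Ω := mem_Ω.2 ⟨1, 0, by simp⟩

lemma I_mul_mem_Ω {z : ℂ} : Complex.I * z ∈ Ω ↔ z ∈ Ω := by
  simp only [mem_Ω_iff, Complex.mul_re, Complex.mul_im, Complex.I_re, Complex.I_im]
  constructor
  · rintro ⟨⟨m, hm⟩, n, hn⟩
    exact ⟨⟨n, by linarith⟩, -m, by push_cast; linarith⟩
  · rintro ⟨⟨m, hm⟩, n, hn⟩
    exact ⟨⟨-n, by push_cast; linarith⟩, m, by linarith⟩

lemma conj_mem_Ω {z : ℂ} : (starRingEnd ℂ) z ∈ Ω ↔ z ∈ Ω := by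
  simp only [mem_Ω_iff, Complex.conj_re, Complex.conj_im]
  constructor
  · rintro ⟨h, n, hn⟩
    exact ⟨h, -n, by push_cast; linarith⟩
  · rintro ⟨h, n, hn⟩
    exact ⟨h, -n, by push_cast; linarith⟩

lemma isClosed_Ω : IsClosed (Ω : Set ℂ) := squarePeriods.isClosed_lattice

lemma countable_Ω : (Ω : Set ℂ).Countable := by
  have : (Ω : Set ℂ) = range (fun p : ℤ × ℤ => (p.1 : ℂ) + p.2 * Complex.I) := by
    ext z
    simp [mem_Ω, eq_comm]
  rw [this]
  exact countable_range _

lemma isPreconnected_compl_Ω : IsPreconnected (Ω : Set ℂ)ᶜ := by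
  refine (countable_Ω.isConnected_compl_of_one_lt_rank ?_).isPreconnected
  rw [Complex.rank_real_complex]
  exact Cardinal.one_lt_two

lemma wp_add {l : ℂ} (hl : l ∈ Ω) (z : ℂ) : wp (z + l) = wp z :=
  squarePeriods.weierstrassP_add_coe z ⟨l, hl⟩

lemma wp_sub {l : ℂ} (hl : l ∈ Ω) (z : ℂ) : wp (z - l) = wp z :=
  squarePeriods.weierstrassP_sub_coe z ⟨l, hl⟩

lemma wp_neg (z : ℂ) : wp (-z) = wp z := squarePeriods.weierstrassP_neg z

lemma wp_of_mem {l : ℂ} (hl : l ∈ Ω) : wp l = 0 := squarePeriods.weierstrassP_coe ⟨l, hl⟩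

/-- Multiplication by `i` permutes the lattice, and each term of the defining series acquires the
factor `i⁻² = -1`. -/
lemma wp_I_mul (z : ℂ) : wp (Complex.I * z) = -wp z := by
  let e : squarePeriods.lattice ≃ squarePeriods.lattice :=
    { toFun := fun l => ⟨Complex.I * l, I_mul_mem_Ω.2 l.2⟩
      invFun := fun l => ⟨-(Complex.I * l), neg_mem (I_mul_mem_Ω.2 l.2)⟩
      left_inv := fun l => by ext; simp [← mul_assoc]
      right_inv := fun l => by ext; simp [← mul_assoc] }
  rw [wp, PeriodPair.weierstrassP, PeriodPair.weierstrassP, ← tsum_neg, ← e.tsum_eq]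
  refine tsum_congr fun l => ?_
  change 1 / (Complex.I * z - Complex.I * l) ^ 2 - 1 / (Complex.I * l) ^ 2 = _
  rw [← mul_sub, mul_pow, mul_pow, Complex.I_sq, neg_one_mul, neg_one_mul, div_neg, div_neg]
  ring

lemma wp_conj (z : ℂ) : wp ((starRingEnd ℂ) z) = (starRingEnd ℂ) (wp z) := by
  let e : squarePeriods.lattice ≃ squarePeriods.lattice :=
    { toFun := fun l => ⟨(starRingEnd ℂ) l, conj_mem_Ω.2 l.2⟩
      invFun := fun l => ⟨(starRingEnd ℂ) l, conj_mem_Ω.2 l.2⟩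
      left_inv := fun l => by ext; simp
      right_inv := fun l => by ext; simp }
  rw [wp, PeriodPair.weierstrassP, PeriodPair.weierstrassP, Complex.conj_tsum, ← e.tsum_eq]
  refine tsum_congr fun l => ?_
  change 1 / ((starRingEnd ℂ) z - (starRingEnd ℂ) l) ^ 2 - 1 / ((starRingEnd ℂ) l) ^ 2 = _
  simp

lemma wp_half : wp (1 / 2) = (e₁ : ℂ) := by
  have h := wp_conj (1 / 2)
  rw [show (starRingEnd ℂ) (1 / 2 : ℂ) = 1 / 2 by rw [map_div₀, map_one, Complex.conj_ofNat]] at h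
  exact (Complex.conj_eq_iff_re.1 h.symm).symm

lemma analyticAt_wp {z : ℂ} (hz : z ∉ Ω) : AnalyticAt ℂ wp z :=
  squarePeriods.analyticOnNhd_weierstrassP z hz

/-- The zero `(1 + i) / 2` of `℘`. -/
def ζ : ℂ := (1 + Complex.I) / 2

lemma two_ζ_mem_Ω : ζ + ζ ∈ Ω := mem_Ω.2 ⟨1, 1, by simp [ζ]⟩

lemma ζ_notMem_Ω : ζ ∉ Ω := by
  rw [mem_Ω_iff]
  rintro ⟨⟨m, hm⟩, -⟩
  have : (1 : ℝ) = 2 * m := by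
    have : ζ.re = 1 / 2 := by simp [ζ]
    linarith
  have : (1 : ℤ) = 2 * m := by exact_mod_cast this
  omega

lemma wp_I_half : wp (Complex.I / 2) = -(e₁ : ℂ) := by
  rw [show Complex.I / 2 = Complex.I * (1 / 2) by ring, wp_I_mul, wp_half]

/-- Since `iζ = ζ - 1`, the rotation rule and periodicity give `℘(ζ) = -℘(ζ)`. -/
lemma wp_ζ : wp ζ = 0 := by
  have h := wp_I_mul ζ
  rw [show Complex.I * ζ = ζ - 1 by
    rw [ζ]; linear_combination (1 / 2) * Complex.I_mul_I, wp_sub one_mem_Ω] at h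
  linear_combination h / 2

lemma half_notMem_Ω : (1 / 2 : ℂ) ∉ Ω := by
  rw [mem_Ω_iff]
  rintro ⟨⟨m, hm⟩, -⟩
  have : (1 : ℝ) = 2 * m := by
    have : (1 / 2 : ℂ).re = 1 / 2 := by simp
    linarith
  have : (1 : ℤ) = 2 * m := by exact_mod_cast this
  omega

lemma I_half_notMem_Ω : Complex.I / 2 ∉ Ω := by
  rw [show Complex.I / 2 = Complex.I * (1 / 2) by ring, I_mul_mem_Ω]
  exact half_notMem_Ω

/-- `z² ℘(z)` extends analytically to `0`, with the value `1`. -/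
lemma exists_analyticAt_sq_mul_wp :
    ∃ h : ℂ → ℂ, AnalyticAt ℂ h 0 ∧ h 0 = 1 ∧ ∀ z ≠ 0, z ^ 2 * wp z = h z := by
  -- `weierstrassPExcept 0` omits the term `1 / z²` of the series; multiplied by `z²`, that term is
  -- the `1`.
  refine ⟨fun z => z ^ 2 * squarePeriods.weierstrassPExcept 0 z + 1, ?_, by simp, fun z hz => ?_⟩
  · have : AnalyticAt ℂ (squarePeriods.weierstrassPExcept 0) 0 :=
      squarePeriods.analyticAt_weierstrassPExcept 0
    fun_prop
  · have := squarePeriods.ite_eq_one_sub_sq_mul_weierstrassP 0 (zero_mem _) z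
    rw [if_neg hz] at this
    simpa [wp] using this

lemma tendsto_sq_mul_wp : Tendsto (fun z => z ^ 2 * wp z) (𝓝[≠] 0) (𝓝 1) := by
  obtain ⟨h, ha, h0, hz⟩ := exists_analyticAt_sq_mul_wp
  have h1 : Tendsto h (𝓝[≠] 0) (𝓝 1) := h0 ▸ ha.continuousAt.tendsto.mono_left nhdsWithin_le_nhds
  refine h1.congr' ?_
  filter_upwards [self_mem_nhdsWithin] with z hz'
  exact (hz z hz').symm

lemma eventually_wp_ne_zero : ∀ᶠ z in 𝓝[≠] (0 : ℂ), wp z ≠ 0 := by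
  filter_upwards [tendsto_sq_mul_wp.eventually_ne one_ne_zero] with z hz h
  simp [h] at hz

/-! ### The product formula `℘(z) ℘(z + ζ) = -e₁²` -/

/-- `℘(z + ζ)` has a zero of order at least two at `0`. -/
lemma exists_analyticAt_wp_add_ζ :
    ∃ k : ℂ → ℂ, AnalyticAt ℂ k 0 ∧ ∀ᶠ z in 𝓝 0, wp (z + ζ) = z ^ 2 * k z := by
  have hwp : AnalyticAt ℂ (fun z => wp (z + ζ)) 0 := by
    have h : AnalyticAt ℂ wp (0 + ζ) := by simpa using analyticAt_wp ζ_notMem_Ω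
    exact h.fun_comp (f := fun z => z + ζ) (by fun_prop)
  -- As `2ζ` is a period, `℘` is even about `ζ`, so its derivative vanishes there together with its
  -- value.
  have heven : ∀ z, wp (-z + ζ) = wp (z + ζ) := fun z => by
    rw [show -z + ζ = -(z - ζ) by ring, wp_neg, ← wp_add two_ζ_mem_Ω]
    congr 1; ring
  have hd : deriv (fun z => wp (z + ζ)) 0 = 0 := by
    have h1 := deriv_comp_neg (fun z => wp (z + ζ)) 0
    simp only [heven, neg_zero] at h1
    linear_combination h1 / 2
  have horder : ((2 : ℕ) : ℕ∞) ≤ analyticOrderAt (fun z => wp (z + ζ)) 0 := by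
    rw [natCast_le_analyticOrderAt_iff_iteratedDeriv_eq_zero hwp]
    intro k hk
    interval_cases k
    · simp [wp_ζ]
    · simpa using hd
  obtain ⟨k, hk, h⟩ := (natCast_le_analyticOrderAt hwp (n := 2)).1 horder
  exact ⟨k, hk, by simpa using h⟩

/-- The double zero at `ζ` cancels the double pole at `0`, so the product extends to an entire
periodic function, which is constant by Liouville. Its value is read off at `1/2`, where the factors
are `e₁` and `℘(i/2) = -e₁`. -/
lemma wp_mul_wp_add_ζ {z : ℂ} (hz : z ∉ Ω) (hz' : z + ζ ∉ Ω) :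
    wp z * wp (z + ζ) = -(e₁ : ℂ) ^ 2 := by
  obtain ⟨h, ha, h0, hh⟩ := exists_analyticAt_sq_mul_wp
  obtain ⟨k, hk, hkz⟩ := exists_analyticAt_wp_add_ζ
  classical
  -- `k 0` is the limit of the product at `0`. The product is invariant under `z ↦ z + ζ`, so the
  -- same value also fills the gaps at `Ω - ζ`, and only the origin has to be examined.
  let G : ℂ → ℂ := fun z => if z ∈ Ω ∨ z + ζ ∈ Ω then k 0 else wp z * wp (z + ζ)
  have hGper : ∀ l ∈ Ω, ∀ z, G (z + l) = G z := fun l hl z => by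
    have e1 : z + l ∈ Ω ↔ z ∈ Ω := Submodule.add_mem_iff_left _ hl
    have e2 : z + ζ + l ∈ Ω ↔ z + ζ ∈ Ω := Submodule.add_mem_iff_left _ hl
    simp only [G, e1, add_right_comm z l ζ, e2, wp_add hl]
  have hGζ : ∀ z, G (z + ζ) = G z := fun z => by
    have e2 : z + (ζ + ζ) ∈ Ω ↔ z ∈ Ω := Submodule.add_mem_iff_left _ two_ζ_mem_Ω
    simp only [G, add_assoc, e2, or_comm, mul_comm, wp_add two_ζ_mem_Ω]
  have hG0 : AnalyticAt ℂ G 0 := by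
    have : AnalyticAt ℂ (fun z => h z * k z) 0 := ha.mul hk
    refine this.congr ?_
    have n1 : ∀ᶠ z : ℂ in 𝓝 0, z + ζ ∉ Ω := by
      have : ContinuousAt (fun z : ℂ => z + ζ) 0 := by fun_prop
      exact this.eventually_mem (isClosed_Ω.isOpen_compl.mem_nhds (by simpa using ζ_notMem_Ω))
    have n2 : ∀ᶠ z : ℂ in 𝓝 0, z ∈ Ω → z = 0 := by
      filter_upwards [squarePeriods.compl_lattice_sdiff_singleton_mem_nhds 0] with z hz hzΩ
      by_contra hne
      exact hz ⟨hzΩ, hne⟩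
    filter_upwards [n1, n2, hkz] with z h1 h2 h3
    by_cases hz0 : z = 0
    · simp [G, hz0, h0]
    · have h4 : z ∉ Ω := fun hm => hz0 (h2 hm)
      simp only [G, h1, h4, or_self, if_false, h3, ← hh z hz0]
      ring
  have hGΩ : ∀ l ∈ Ω, DifferentiableAt ℂ G l := fun l hl => by
    have h1 : DifferentiableAt ℂ (fun z => G (z - l)) l := by
      have : DifferentiableAt ℂ G (l - l) := by simpa using hG0.differentiableAt
      exact this.comp l (f := fun z => z - l) (by fun_prop)
    convert h1 using 2 with z
    rw [← hGper l hl (z - l), sub_add_cancel]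
  have hG : Differentiable ℂ G := fun z => by
    by_cases c1 : z ∈ Ω
    · exact hGΩ z c1
    by_cases c2 : z + ζ ∈ Ω
    · have h1 : DifferentiableAt ℂ (fun z => G (z + ζ)) z :=
        (hGΩ _ c2).comp z (f := fun z => z + ζ) (by fun_prop)
      simpa only [hGζ] using h1
    · have a1 := (analyticAt_wp c1).differentiableAt
      have a2 : DifferentiableAt ℂ (fun z => wp (z + ζ)) z :=
        (analyticAt_wp c2).differentiableAt.comp z (f := fun z => z + ζ) (by fun_prop)
      refine (a1.mul a2).congr_of_eventuallyEq ?_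
      have n1 : ∀ᶠ z : ℂ in 𝓝 z, z + ζ ∉ Ω := by
        have : ContinuousAt (fun z : ℂ => z + ζ) z := by fun_prop
        exact this.eventually_mem (isClosed_Ω.isOpen_compl.mem_nhds c2)
      filter_upwards [n1, isClosed_Ω.isOpen_compl.mem_nhds c1] with w h1 h2
      have h2 : w ∉ Ω := h2
      simp [G, h1, h2]
  have hconst : ∀ z w, G z = G w := hG.apply_eq_apply_of_bounded
    (IsZLattice.isCompact_range_of_periodic squarePeriods.lattice _ hG.continuous
      fun z w hw => hGper w hw z).isBounded
  have e := hconst z (1 / 2)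
  have hI : (1 / 2 : ℂ) + ζ = Complex.I / 2 + 1 := by rw [ζ]; ring
  have hI' : Complex.I / 2 + 1 ∉ Ω := fun hm =>
    I_half_notMem_Ω ((Submodule.add_mem_iff_left _ one_mem_Ω).1 hm)
  simp only [G, hz, hz', or_self, if_false, half_notMem_Ω, hI, hI', wp_half, wp_add one_mem_Ω,
    wp_I_half] at e
  rw [e]; ring

/-! ### Positivity of `e₁`, zeros and fibres of `℘` -/

lemma eventually_notMem_Ω {z : ℂ} : ∀ᶠ w in 𝓝[≠] z, w ∉ Ω := by
  filter_upwards [self_mem_nhdsWithin, mem_nhdsWithin_of_mem_nhds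
    (squarePeriods.compl_lattice_sdiff_singleton_mem_nhds z)] with w hw hw' hΩ
  exact hw' ⟨hΩ, hw⟩

/-- If `e₁ = 0`, the product formula makes `℘` vanish near `ζ`, hence on the connected complement of
`Ω`, contradicting the pole at `0`. -/
lemma e₁_ne_zero : e₁ ≠ 0 := by
  intro h
  have hz : ∃ᶠ z in 𝓝[≠] ζ, wp z = 0 := by
    have hev : ∀ᶠ z in 𝓝[≠] (0 : ℂ), wp (z + ζ) = 0 := by
      have n1 : ∀ᶠ z : ℂ in 𝓝[≠] 0, z + ζ ∉ Ω := by
        have : ContinuousAt (fun z : ℂ => z + ζ) 0 := by fun_prop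
        exact (this.eventually_mem (isClosed_Ω.isOpen_compl.mem_nhds
          (by simpa using ζ_notMem_Ω))).filter_mono nhdsWithin_le_nhds
      filter_upwards [eventually_wp_ne_zero, eventually_notMem_Ω, n1] with z h1 h2 h3
      have := wp_mul_wp_add_ζ h2 h3
      simpa [h, h1] using this
    have ht : Tendsto (fun z : ℂ => z - ζ) (𝓝[≠] ζ) (𝓝[≠] 0) := by
      refine tendsto_nhdsWithin_iff.2 ⟨?_, ?_⟩
      · have : ContinuousAt (fun z : ℂ => z - ζ) ζ := by fun_prop
        simpa using this.tendsto.mono_left nhdsWithin_le_nhds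
      · filter_upwards [self_mem_nhdsWithin] with z hz
        simpa [sub_eq_zero] using hz
    have := ht.eventually hev
    simp only [sub_add_cancel] at this
    exact this.frequently
  have hzero : EqOn wp 0 (Ω : Set ℂ)ᶜ :=
    AnalyticOnNhd.eqOn_zero_of_preconnected_of_frequently_eq_zero
      (fun z hz => analyticAt_wp hz) isPreconnected_compl_Ω ζ_notMem_Ω hz
  obtain ⟨z, h1, h2⟩ := (eventually_wp_ne_zero.and (eventually_notMem_Ω (z := 0))).exists
  exact h1 (hzero h2)

lemma wp_ne_zero {z : ℂ} (hz : z ∉ Ω) (hz' : z + ζ ∉ Ω) : wp z ≠ 0 := fun h => by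
  have := wp_mul_wp_add_ζ hz hz'
  simp [h, e₁_ne_zero] at this

lemma ofReal_notMem_Ω {x : ℝ} (h0 : 0 < x) (h1 : x ≤ 1 / 2) : (x : ℂ) ∉ Ω := by
  rw [mem_Ω_iff]
  rintro ⟨⟨m, hm⟩, -⟩
  simp only [Complex.ofReal_re] at hm
  have h2 : (0 : ℝ) < m := by linarith
  have h3 : (m : ℝ) < 1 := by linarith
  have h2 : 0 < m := by exact_mod_cast h2
  have h3 : m < 1 := by exact_mod_cast h3
  omega

lemma ofReal_add_ζ_notMem_Ω (x : ℝ) : (x : ℂ) + ζ ∉ Ω := by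
  rw [mem_Ω_iff]
  rintro ⟨-, n, hn⟩
  have h : ((x : ℂ) + ζ).im = 1 / 2 := by simp [ζ]
  have : (1 : ℝ) = 2 * n := by linarith
  have : (1 : ℤ) = 2 * n := by exact_mod_cast this
  omega

lemma wp_ofReal (x : ℝ) : wp x = ((wp x).re : ℂ) := by
  have h := wp_conj x
  rw [Complex.conj_ofReal] at h
  exact (Complex.conj_eq_iff_re.1 h.symm).symm

/-- On `(0, 1/2]` the function `℘` is real, has no zero by the product formula, and is positive near
`0` because `x² ℘(x) → 1`; it cannot change sign. -/
lemma e₁_pos : 0 < e₁ := by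
  have hcont : ContinuousOn (fun x : ℝ => (wp x).re) (Ioc 0 (1 / 2)) := fun x hx => by
    have h1 := (analyticAt_wp (ofReal_notMem_Ω hx.1 hx.2)).continuousAt
    have h2 : ContinuousAt (fun x : ℝ => wp (x : ℂ)) x :=
      ContinuousAt.comp (f := fun x : ℝ => (x : ℂ)) h1 (by fun_prop)
    exact (Complex.continuous_re.continuousAt.comp h2).continuousWithinAt
  have hne : ∀ x ∈ Ioc (0 : ℝ) (1 / 2), (wp x).re ≠ 0 := fun x hx h => by
    refine wp_ne_zero (ofReal_notMem_Ω hx.1 hx.2) (ofReal_add_ζ_notMem_Ω x) ?_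
    rw [wp_ofReal, h, Complex.ofReal_zero]
  obtain ⟨y, hy, hypos⟩ : ∃ y ∈ Ioc (0 : ℝ) (1 / 2), 0 < (wp y).re := by
    have ht : Tendsto (fun x : ℝ => (x : ℂ)) (𝓝[>] 0) (𝓝[≠] 0) := by
      refine tendsto_nhdsWithin_iff.2 ⟨?_, ?_⟩
      · have : ContinuousAt (fun x : ℝ => (x : ℂ)) 0 := by fun_prop
        simpa using this.tendsto.mono_left nhdsWithin_le_nhds
      · filter_upwards [self_mem_nhdsWithin] with x hx
        have hx : 0 < x := hx
        simp [hx.ne']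
    have h1 := (Complex.continuous_re.tendsto 1).comp (tendsto_sq_mul_wp.comp ht)
    have h2 := h1.eventually_const_lt (show (0 : ℝ) < (1 : ℂ).re by simp)
    obtain ⟨y, h3, h4⟩ := (h2.and (Ioc_mem_nhdsGT (show (0 : ℝ) < 1 / 2 by norm_num))).exists
    refine ⟨y, h4, ?_⟩
    simp only [Function.comp_apply] at h3
    rw [← Complex.ofReal_pow, Complex.re_ofReal_mul] at h3
    exact pos_of_mul_pos_right h3 (sq_nonneg y)
  have he : (wp ((1 / 2 : ℝ) : ℂ)).re = e₁ := by rw [e₁]; congr 2; norm_num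
  rw [← he]
  by_contra hneg
  have hmem : (1 / 2 : ℝ) ∈ Ioc (0 : ℝ) (1 / 2) := by norm_num
  have hpre : IsPreconnected (Ioc (0 : ℝ) (1 / 2)) := isPreconnected_Ioc
  obtain ⟨x, hx, h0⟩ := hpre.intermediate_value hmem hy hcont ⟨not_lt.1 hneg, hypos.le⟩
  exact hne x hx h0

/-- `1 / ℘` is, up to a constant, a translate of `℘`. -/
lemma inv_wp {z : ℂ} (hz : z ∉ Ω) (hz' : z + ζ ∉ Ω) :
    (wp z)⁻¹ = -wp (z + ζ) / (e₁ : ℂ) ^ 2 := by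
  have h := wp_mul_wp_add_ζ hz hz'
  have h1 := wp_ne_zero hz hz'
  have h2 : (e₁ : ℂ) ≠ 0 := by exact_mod_cast e₁_ne_zero
  field_simp
  linear_combination h

lemma differentiable_eq_of_periodic {F : ℂ → ℂ} (hF : Differentiable ℂ F)
    (hper : ∀ l ∈ Ω, ∀ z, F (z + l) = F z) (z w : ℂ) : F z = F w :=
  hF.apply_eq_apply_of_bounded
    (IsZLattice.isCompact_range_of_periodic squarePeriods.lattice _ hF.continuous
      fun z w hw => hper w hw z).isBounded z w

lemma analyticAt_wp_add_ζ {z : ℂ} (hz : z ∈ Ω) : AnalyticAt ℂ (fun w => wp (w + ζ)) z := by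
  have h : AnalyticAt ℂ wp (z + ζ) :=
    analyticAt_wp fun h => ζ_notMem_Ω ((Submodule.add_mem_iff_right _ hz).1 h)
  exact h.fun_comp (f := fun z => z + ζ) (by fun_prop)

lemma eventually_add_ζ_notMem {z : ℂ} (hz : z ∈ Ω) : ∀ᶠ w in 𝓝 z, w + ζ ∉ Ω := by
  have : ContinuousAt (fun z : ℂ => z + ζ) z := by fun_prop
  exact this.eventually_mem (isClosed_Ω.isOpen_compl.mem_nhds
    fun h => ζ_notMem_Ω ((Submodule.add_mem_iff_right _ hz).1 h))

lemma wp_add_ζ_of_mem {z : ℂ} (hz : z ∈ Ω) : wp (z + ζ) = 0 := by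
  rw [add_comm, wp_add hz, wp_ζ]

/-- If `c` were omitted, `1 / (℘ - c)`, extended by `0` to the poles, would be entire and periodic,
hence identically `0`. -/
lemma exists_wp_eq (c : ℂ) : ∃ z ∉ Ω, wp z = c := by
  by_contra! hc
  classical
  let F : ℂ → ℂ := fun z => if z ∈ Ω then 0 else (wp z - c)⁻¹
  have hper : ∀ l ∈ Ω, ∀ z, F (z + l) = F z := fun l hl z => by
    have e1 : z + l ∈ Ω ↔ z ∈ Ω := Submodule.add_mem_iff_left _ hl
    simp only [F, e1, wp_add hl]
  have he : (e₁ : ℂ) ≠ 0 := by exact_mod_cast e₁_ne_zero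
  have hF : Differentiable ℂ F := fun z => by
    by_cases hz : z ∈ Ω
    -- Here `v` is the analytic continuation of `1 / ℘` across the pole, and `1 / (℘ - c) = v / (1 -
    -- c v)`.
    · let v : ℂ → ℂ := fun w => -wp (w + ζ) / (e₁ : ℂ) ^ 2
      have hv : DifferentiableAt ℂ v z :=
        ((analyticAt_wp_add_ζ hz).differentiableAt.neg).div_const _
      have hv0 : v z = 0 := by simp [v, wp_add_ζ_of_mem hz]
      have h1 : DifferentiableAt ℂ (fun w => v w / (1 - c * v w)) z :=
        hv.div ((hv.const_mul c).const_sub 1) (by simp [hv0])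
      refine h1.congr_of_eventuallyEq ?_
      filter_upwards [eventually_add_ζ_notMem hz] with w hw
      by_cases hwΩ : w ∈ Ω
      · simp [F, hwΩ, v, wp_add_ζ_of_mem hwΩ]
      · have h2 := inv_wp hwΩ hw
        have h3 := wp_ne_zero hwΩ hw
        have h4 := sub_ne_zero.2 (hc w hwΩ)
        simp only [F, hwΩ, if_false, v, ← h2]
        field_simp
    · refine DifferentiableAt.congr_of_eventuallyEq
        (f := fun w => (wp w - c)⁻¹) ?_ ?_
      · exact ((analyticAt_wp hz).differentiableAt.sub_const c).inv (sub_ne_zero.2 (hc z hz))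
      · filter_upwards [isClosed_Ω.isOpen_compl.mem_nhds hz] with w hw
        exact if_neg hw
  -- Comparing values at `0` and `ζ` yields `(-c)⁻¹ = 0`. With `0⁻¹ = 0` this says `c = 0`, which is
  -- attained at `ζ`.
  have h := differentiable_eq_of_periodic hF hper 0 ζ
  simp [F, ζ_notMem_Ω, wp_ζ] at h
  exact hc ζ ζ_notMem_Ω (by rw [wp_ζ, h])

lemma deriv_wp_neg (z : ℂ) : deriv wp (-z) = -deriv wp z := by
  have := deriv_comp_neg wp z
  simp only [wp_neg] at this
  rw [this, neg_neg]

lemma deriv_wp_sq {z : ℂ} (hz : z ∉ Ω) :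
    deriv wp z ^ 2 = 4 * wp z ^ 3 - squarePeriods.g₂ * wp z - squarePeriods.g₃ := by
  have := squarePeriods.derivWeierstrassP_sq z hz
  rwa [← squarePeriods.deriv_weierstrassP] at this

/-- The second order differential equation of `℘`. -/
lemma deriv_deriv_wp {z : ℂ} (hz : z ∉ Ω) :
    deriv (deriv wp) z = 6 * wp z ^ 2 - squarePeriods.g₂ / 2 := by
  have ha : ∀ w ∈ (Ω : Set ℂ)ᶜ, AnalyticAt ℂ (deriv wp) w := fun w hw => (analyticAt_wp hw).deriv
  have hb : ∀ w ∈ (Ω : Set ℂ)ᶜ,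
      AnalyticAt ℂ (fun w => deriv (deriv wp) w - (6 * wp w ^ 2 - squarePeriods.g₂ / 2)) w :=
    fun w hw => by
      have h1 := (ha w hw).deriv
      have h2 := analyticAt_wp hw
      fun_prop
  have hmul : ∀ w ∈ (Ω : Set ℂ)ᶜ, deriv wp w *
      (deriv (deriv wp) w - (6 * wp w ^ 2 - squarePeriods.g₂ / 2)) = 0 := fun w hw => by
    have h1 := (ha w hw).differentiableAt.hasDerivAt
    have h2 := (analyticAt_wp hw).differentiableAt.hasDerivAt
    have e1 := h1.pow 2
    have e2 := (((h2.pow 3).const_mul 4).sub (h2.const_mul squarePeriods.g₂)).sub_const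
      squarePeriods.g₃
    have e3 := e1.unique (e2.congr_of_eventuallyEq (by
      filter_upwards [isClosed_Ω.isOpen_compl.mem_nhds hw] with x hx
      exact deriv_wp_sq hx))
    push_cast at e3
    linear_combination e3 / 2
  -- Differentiating the first order equation gives the second order one multiplied by `℘'`.
  -- Analytic functions on a connected set have no zero divisors, and `℘' ≡ 0` is excluded by
  -- `℘(1/2) ≠ ℘(ζ)`.
  rcases AnalyticOnNhd.eq_zero_or_eq_zero_of_mul_eq_zero ha hb hmul isPreconnected_compl_Ω
    with h | h
  · exfalso
    have hconst : ∀ w ∈ (Ω : Set ℂ)ᶜ, wp w = wp ζ := fun w hw =>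
      (isClosed_Ω.isOpen_compl).is_const_of_deriv_eq_zero isPreconnected_compl_Ω
        (fun x hx => (analyticAt_wp hx).differentiableAt.differentiableWithinAt) h hw ζ_notMem_Ω
    have h1 := hconst (1 / 2) half_notMem_Ω
    rw [wp_half, wp_ζ] at h1
    exact e₁_ne_zero (by exact_mod_cast h1)
  · exact sub_eq_zero.1 (h z hz)

/-- Otherwise `℘(z + u)` stays bounded at `0`, so `z² ℘(z)` would tend to `0` as well as to `1`. -/
lemma mem_Ω_of_periodic {u : ℂ} (h : ∀ᶠ z in 𝓝[≠] (0 : ℂ), wp (z + u) = wp z) : u ∈ Ω := by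
  by_contra hu
  have h1 : Tendsto (fun z => wp (z + u)) (𝓝[≠] 0) (𝓝 (wp u)) := by
    have h2 : ContinuousAt wp (0 + u) := by simpa using (analyticAt_wp hu).continuousAt
    have h3 : ContinuousAt (fun z => wp (z + u)) 0 :=
      ContinuousAt.comp (f := fun z : ℂ => z + u) h2 (by fun_prop)
    simpa using h3.tendsto.mono_left nhdsWithin_le_nhds
  have h2 : Tendsto (fun z : ℂ => z ^ 2) (𝓝[≠] 0) (𝓝 0) := by
    have : ContinuousAt (fun z : ℂ => z ^ 2) 0 := by fun_prop
    simpa using this.tendsto.mono_left nhdsWithin_le_nhds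
  have h3 : Tendsto (fun z => z ^ 2 * wp z) (𝓝[≠] 0) (𝓝 0) := by
    have := (h2.mul h1)
    rw [zero_mul] at this
    refine this.congr' ?_
    filter_upwards [h] with z hz
    rw [hz]
  exact zero_ne_one (tendsto_nhds_unique h3 tendsto_sq_mul_wp)

/-- Points with the same value and the same derivative of `℘` are congruent. -/
lemma sub_mem_Ω_of_wp_eq_of_deriv_eq {u v : ℂ} (hu : u ∉ Ω) (hv : v ∉ Ω) (h : wp u = wp v)
    (h' : deriv wp u = deriv wp v) : u - v ∈ Ω := by
  have key : ∀ {x : ℂ}, x ∉ Ω → AnalyticAt ℂ (fun z => wp (z + x)) 0 ∧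
      ∀ᶠ z in 𝓝 0, deriv (deriv (fun z => wp (z + x))) z =
        6 * wp (z + x) ^ 2 - squarePeriods.g₂ / 2 := fun {x} hx => by
    have h0 : AnalyticAt ℂ wp (0 + x) := by simpa using analyticAt_wp hx
    refine ⟨h0.fun_comp (f := fun z => z + x) (by fun_prop), ?_⟩
    have : ContinuousAt (fun z : ℂ => z + x) 0 := by fun_prop
    filter_upwards [this.eventually_mem (isClosed_Ω.isOpen_compl.mem_nhds (by simpa using hx))]
      with z hz
    have e : deriv (fun z => wp (z + x)) = fun z => deriv wp (z + x) := by
      ext z; exact deriv_comp_add_const _ _ _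
    rw [e, deriv_comp_add_const]
    exact deriv_deriv_wp hz
  obtain ⟨au, eu⟩ := key hu
  obtain ⟨av, ev⟩ := key hv
  let d : ℂ → ℂ := fun z => wp (z + u) - wp (z + v)
  have hd : AnalyticAt ℂ d 0 := au.sub av
  -- The second order equation is autonomous, so the difference of two translates of `℘` solves a
  -- linear equation `d'' = Q d`.
  have hdd : deriv (deriv d) =ᶠ[𝓝 0] fun z => (6 * (wp (z + u) + wp (z + v))) * d z := by
    have h1 : deriv d =ᶠ[𝓝 0] fun z =>
        deriv (fun z => wp (z + u)) z - deriv (fun z => wp (z + v)) z := by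
      filter_upwards [au.eventually_analyticAt, av.eventually_analyticAt] with z h1 h2
      exact deriv_sub h1.differentiableAt h2.differentiableAt
    filter_upwards [h1.eventuallyEq_nhds, au.deriv.eventually_analyticAt,
      av.deriv.eventually_analyticAt, eu, ev] with z h1 h2 h3 h4 h5
    rw [h1.deriv_eq, deriv_fun_sub h2.differentiableAt h3.differentiableAt, h4, h5]
    ring
  have hd0 : d 0 = 0 := by simp [d, h]
  have hd1 : deriv d 0 = 0 := by
    have := deriv_fun_sub au.differentiableAt av.differentiableAt
    rw [deriv_comp_add_const, deriv_comp_add_const] at this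
    simpa [d, h'] using this
  -- Uniqueness for `d'' = Q d` with `d(0) = d'(0) = 0`: two differentiations lower a finite order
  -- of vanishing by two, while multiplication by the analytic `Q` cannot lower it.
  have htop : analyticOrderAt d 0 = ⊤ := by
    by_contra hne
    obtain ⟨n, hn⟩ := ENat.ne_top_iff_exists.1 hne
    have hle : analyticOrderAt d 0 ≤ analyticOrderAt (deriv (deriv d)) 0 := by
      rw [analyticOrderAt_congr hdd]
      have := analyticOrderAt_mul (f := fun z => (6 * (wp (z + u) + wp (z + v)))) (by fun_prop) hd
      exact (le_add_left le_rfl).trans_eq this.symm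
    rw [← hn, analyticOrderAt_deriv_ge_iff hd.deriv hd1] at hle
    have h2 : ((n + 1 : ℕ) : ℕ∞) ≤ analyticOrderAt (deriv d) 0 := by exact_mod_cast hle
    rw [analyticOrderAt_deriv_ge_iff hd hd0, ← hn] at h2
    have : n + 1 + 1 ≤ n := by exact_mod_cast h2
    omega
  have hev : ∀ᶠ z in 𝓝 (0 : ℂ), wp (z + u) = wp (z + v) := by
    filter_upwards [analyticOrderAt_eq_top.1 htop] with z hz
    exact sub_eq_zero.1 hz
  have hev' : (fun w => wp (w + (u - v))) =ᶠ[𝓝 v] wp := by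
    have : ContinuousAt (fun z : ℂ => z - v) v := by fun_prop
    have := this.tendsto.eventually (by simpa using hev)
    filter_upwards [this] with w hw
    convert hw using 2 <;> ring
  -- The poles of either translate form a countable set, so its complement in the plane is connected
  -- and the local equality propagates.
  let T : Set ℂ := (Ω : Set ℂ) ∪ (fun w => w + (u - v)) ⁻¹' Ω
  have hTc : T.Countable := countable_Ω.union
    (countable_Ω.preimage_of_injOn (add_left_injective _).injOn)
  have hTconn : IsPreconnected Tᶜ := by
    refine (hTc.isConnected_compl_of_one_lt_rank ?_).isPreconnected
    rw [Complex.rank_real_complex]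
    exact Cardinal.one_lt_two
  have hvT : v ∈ Tᶜ := by
    simp only [T, compl_union, mem_inter_iff, mem_compl_iff, mem_preimage, SetLike.mem_coe]
    exact ⟨hv, by simpa using hu⟩
  have heq : EqOn (fun w => wp (w + (u - v))) wp Tᶜ := by
    refine AnalyticOnNhd.eqOn_of_preconnected_of_eventuallyEq (𝕜 := ℂ) ?_ ?_ hTconn hvT hev'
    · intro w hw
      have : AnalyticAt ℂ wp (w + (u - v)) := analyticAt_wp fun hm => hw (Or.inr hm)
      exact this.fun_comp (f := fun w => w + (u - v)) (by fun_prop)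
    · exact fun w hw => analyticAt_wp fun hm => hw (Or.inl hm)
  have hTcl : IsClosed ((fun w => w + (u - v)) ⁻¹' (Ω : Set ℂ)) :=
    isClosed_Ω.preimage (by fun_prop)
  by_contra hcon
  refine hcon (mem_Ω_of_periodic ?_)
  have h0 : ∀ᶠ z in 𝓝[≠] (0 : ℂ), z ∉ (fun w => w + (u - v)) ⁻¹' (Ω : Set ℂ) :=
    (hTcl.isOpen_compl.mem_nhds (by simpa using hcon)) |> mem_nhdsWithin_of_mem_nhds
  filter_upwards [h0, eventually_notMem_Ω] with z h1 h2
  exact heq fun hm => hm.elim h2 h1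

/-- The fibres of `℘`. -/
lemma wp_eq_wp_iff {u v : ℂ} (hu : u ∉ Ω) (hv : v ∉ Ω) :
    wp u = wp v ↔ u - v ∈ Ω ∨ u + v ∈ Ω := by
  constructor
  · intro h
    -- `℘'²` is a polynomial in `℘`, so `℘'(u) = ±℘'(v)`. The minus sign is the case of `-v`, as
    -- `℘'` is odd.
    have h1 : deriv wp u ^ 2 = deriv wp v ^ 2 := by rw [deriv_wp_sq hu, deriv_wp_sq hv, h]
    rcases sq_eq_sq_iff_eq_or_eq_neg.1 h1 with h2 | h2
    · exact Or.inl (sub_mem_Ω_of_wp_eq_of_deriv_eq hu hv h h2)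
    · right
      have := sub_mem_Ω_of_wp_eq_of_deriv_eq (v := -v) hu (by simpa using hv)
        (by rw [wp_neg, h]) (by rw [deriv_wp_neg, h2])
      simpa using this
  · rintro (h | h)
    · rw [← wp_add h v]; congr 1; ring
    · rw [← wp_neg v, ← wp_add h (-v)]; congr 1; ring

lemma countable_wp_fibre (c : ℂ) : {z | z ∉ Ω ∧ wp z = c}.Countable := by
  obtain ⟨w, hw, rfl⟩ := exists_wp_eq c
  refine ((countable_Ω.preimage_of_injOn (f := fun z => z - w) (sub_left_injective).injOn).union
    (countable_Ω.preimage_of_injOn (f := fun z => z + w) (add_left_injective _).injOn)).mono ?_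
  rintro z ⟨hz, h⟩
  exact (wp_eq_wp_iff hz hw).1 h

/-! ### Integrals of periodic functions over the unit square -/

lemma measurableSet_unitSquare : MeasurableSet unitSquare := by
  have h1 := measurableSet_Ico (a := (0 : ℝ)) (b := 1)
  have : unitSquare = Complex.re ⁻¹' Ico 0 1 ∩ Complex.im ⁻¹' Ico 0 1 := by
    ext z
    simp [unitSquare, and_assoc]
  rw [this]
  exact (Complex.measurable_re h1).inter (Complex.measurable_im h1)

lemma isBounded_unitSquare : Bornology.IsBounded unitSquare := by
  refine isBounded_iff_forall_norm_le.2 ⟨2, fun z hz => ?_⟩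
  refine (Complex.norm_le_abs_re_add_abs_im z).trans ?_
  rw [abs_of_nonneg hz.1, abs_of_nonneg hz.2.2.1]
  linarith [hz.2.1, hz.2.2.2]

lemma volume_unitSquare_lt_top : volume unitSquare < ⊤ := isBounded_unitSquare.measure_lt_top

instance : IsFiniteMeasure (volume.restrict unitSquare) :=
  ⟨by simpa using volume_unitSquare_lt_top⟩

lemma existsUnique_add_mem_unitSquare (z : ℂ) : ∃! l : ℂ, l ∈ Ω ∧ l + z ∈ unitSquare := by
  refine ⟨-⌊z.re⌋ - ⌊z.im⌋ * Complex.I, ⟨mem_Ω.2 ⟨-⌊z.re⌋, -⌊z.im⌋, by push_cast; ring⟩, ?_⟩, ?_⟩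
  · simp only [unitSquare, mem_ofPred_eq]
    have h1 := Int.floor_le z.re
    have h2 := Int.lt_floor_add_one z.re
    have h3 := Int.floor_le z.im
    have h4 := Int.lt_floor_add_one z.im
    refine ⟨?_, ?_, ?_, ?_⟩ <;> simp <;> linarith
  · rintro l ⟨hl, h1, h2, h3, h4⟩
    obtain ⟨m, n, rfl⟩ := mem_Ω.1 hl
    simp at h1 h2 h3 h4
    have e1 : ⌊z.re⌋ = -m := Int.floor_eq_iff.2 ⟨by push_cast; linarith, by push_cast; linarith⟩
    have e2 : ⌊z.im⌋ = -n := Int.floor_eq_iff.2 ⟨by push_cast; linarith, by push_cast; linarith⟩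
    rw [e1, e2]
    push_cast
    ring

instance : Countable Ω.toAddSubgroup := countable_Ω.to_subtype

lemma isAddFundamentalDomain_unitSquare :
    IsAddFundamentalDomain Ω.toAddSubgroup unitSquare (volume : Measure ℂ) := by
  refine IsAddFundamentalDomain.mk' measurableSet_unitSquare.nullMeasurableSet fun z => ?_
  obtain ⟨l, ⟨hl, hz⟩, hu⟩ := existsUnique_add_mem_unitSquare z
  exact ⟨⟨l, hl⟩, hz, fun g hg => Subtype.ext (hu g ⟨g.2, hg⟩)⟩

section

variable {E : Type*} [NormedAddCommGroup E] [NormedSpace ℝ E]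

/-- The preimage of the unit square under `T` is again a fundamental domain, and the integral of a
periodic function does not depend on that choice. The permutation `σ` records how `T` intertwines
lattice translations. -/
lemma setIntegral_unitSquare_comp {H : ℂ → E} (hH : ∀ l ∈ Ω, ∀ z, H (z + l) = H z)
    {T : ℂ ≃ᵐ ℂ} (hT : MeasurePreserving T) (σ : Ω.toAddSubgroup ≃ Ω.toAddSubgroup)
    (hσ : ∀ (l : Ω.toAddSubgroup) z, T (σ l + z) = l + T z) :
    ∫ z in unitSquare, H (T z) = ∫ z in unitSquare, H z := by
  have hD : IsAddFundamentalDomain Ω.toAddSubgroup (T ⁻¹' unitSquare) (volume : Measure ℂ) :=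
    isAddFundamentalDomain_unitSquare.preimage_of_equiv hT.quasiMeasurePreserving
      (e := σ) σ.bijective fun l z => hσ l z
  rw [← hT.setIntegral_preimage_emb T.measurableEmbedding H unitSquare]
  refine isAddFundamentalDomain_unitSquare.setIntegral_eq hD fun l z => ?_
  change H (T (l + z)) = H (T z)
  obtain ⟨l', rfl⟩ := σ.surjective l
  rw [hσ, add_comm, hH _ l'.2]

lemma setIntegral_unitSquare_add {H : ℂ → E} (hH : ∀ l ∈ Ω, ∀ z, H (z + l) = H z) (c : ℂ) :
    ∫ z in unitSquare, H (z + c) = ∫ z in unitSquare, H z :=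
  setIntegral_unitSquare_comp hH (T := MeasurableEquiv.addRight c)
    (measurePreserving_add_right _ c) (Equiv.refl _) fun l z => by simp [add_assoc]

lemma setIntegral_unitSquare_isometry {H : ℂ → E} (hH : ∀ l ∈ Ω, ∀ z, H (z + l) = H z)
    (L : ℂ ≃ₗᵢ[ℝ] ℂ) (hL : ∀ z, L z ∈ Ω ↔ z ∈ Ω) :
    ∫ z in unitSquare, H (L z) = ∫ z in unitSquare, H z := by
  let σ : Ω.toAddSubgroup ≃ Ω.toAddSubgroup :=
    { toFun := fun l => ⟨L.symm l, (hL _).1 (by simp)⟩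
      invFun := fun l => ⟨L l, (hL _).2 l.2⟩
      left_inv := fun l => by ext; simp
      right_inv := fun l => by ext; simp }
  exact setIntegral_unitSquare_comp hH (T := L.toMeasurableEquiv) L.measurePreserving σ
    fun l z => by simp [σ]

end

/-- Multiplication by `i` as an isometry of `ℂ`. -/
def mulI : ℂ ≃ₗᵢ[ℝ] ℂ := rotation ⟨Complex.I, by simp [Submonoid.unitSphere]⟩

@[simp] lemma mulI_apply (z : ℂ) : mulI z = Complex.I * z := rfl

/-! ### The function `f`: integrability, smoothness, positivity, functional equation -/

lemma measurable_wp : Measurable wp := by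
  classical
  have h : wp = (Ω : Set ℂ).piecewise (fun _ => 0) wp := by
    ext z
    by_cases hz : z ∈ (Ω : Set ℂ)
    · rw [piecewise_eq_of_mem _ _ _ hz, wp_of_mem hz]
    · rw [piecewise_eq_of_notMem _ _ _ hz]
  rw [h]
  exact ContinuousOn.measurable_piecewise continuousOn_const
    (fun z hz => (analyticAt_wp hz).continuousAt.continuousWithinAt) isClosed_Ω.measurableSet

lemma ae_notMem_Ω : ∀ᵐ z : ℂ, z ∉ Ω :=
  measure_eq_zero_iff_ae_notMem.1 (countable_Ω.measure_zero volume)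

lemma ae_add_ζ_notMem_Ω : ∀ᵐ z : ℂ, z + ζ ∉ Ω :=
  measure_eq_zero_iff_ae_notMem.1
    ((countable_Ω.preimage_of_injOn (f := fun z => z + ζ)
      (add_left_injective _).injOn).measure_zero volume)

/-- Equivalent to `(1 - c x)² ≥ 0`. It bounds the integrand of `f` uniformly, however large `℘` is
near its poles. -/
lemma div_one_add_sq_le {x c : ℝ} (hx : 0 ≤ x) (hc : 0 < c) :
    x / (1 + c * x) ^ 2 ≤ 1 / (4 * c) := by
  rw [div_le_div_iff₀ (by positivity) (by positivity)]
  nlinarith [sq_nonneg (1 - c * x)]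

lemma integrableOn_f {α : ℝ} (hα : 0 < α) :
    IntegrableOn (fun z => ‖wp z‖ ^ 2 / (1 + α ^ 2 * ‖wp z‖ ^ 2) ^ 2) unitSquare := by
  have hm := measurable_wp
  refine Integrable.of_bound (C := 1 / (4 * α ^ 2)) ?_ (Eventually.of_forall fun z => ?_)
  · exact Measurable.aestronglyMeasurable (by fun_prop)
  · rw [Real.norm_of_nonneg (by positivity)]
    exact div_one_add_sq_le (by positivity) (by positivity)

/-- The holomorphic extension of `f`. -/
def fComplex (α : ℂ) : ℂ :=
  ∫ z in unitSquare, ((‖wp z‖ ^ 2 : ℝ) : ℂ) / (1 + α ^ 2 * ((‖wp z‖ ^ 2 : ℝ) : ℂ)) ^ 2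

lemma one_add_mul_le_norm {b : ℂ} {ε x : ℝ} (hx : 0 ≤ x) (hb : ε ≤ b.re) :
    1 + ε * x ≤ ‖1 + b * (x : ℂ)‖ := by
  refine le_trans ?_ (Complex.re_le_norm _)
  simp
  gcongr

/-- When `Re α² ≥ ε > 0`, `|1 + α² x| ≥ 1 + ε x` for `x ≥ 0`, so the `α`-derivative of the integrand
is bounded uniformly in `z`. Differentiating once under the integral over `ℂ` then gives all
derivatives of `f`. -/
lemma differentiableAt_fComplex {α₀ : ℂ} (hα₀ : 0 < (α₀ ^ 2).re) :
    DifferentiableAt ℂ fComplex α₀ := by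
  have hm := measurable_wp
  set ε : ℝ := (α₀ ^ 2).re / 2
  have hε : 0 < ε := half_pos hα₀
  set R : ℝ := ‖α₀‖ + 1
  have hR : 0 ≤ R := by positivity
  let s : Set ℂ := {α | ε < (α ^ 2).re} ∩ {α | ‖α‖ < R}
  have hs : s ∈ 𝓝 α₀ := by
    refine IsOpen.mem_nhds ?_ ⟨half_lt_self hα₀, show ‖α₀‖ < ‖α₀‖ + 1 from lt_add_one _⟩
    exact (isOpen_lt continuous_const (by fun_prop)).inter (isOpen_lt (by fun_prop) (by fun_prop))
  have hα₀s : α₀ ∈ s := mem_of_mem_nhds hs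
  have hne : ∀ α ∈ s, ∀ x : ℝ, 0 ≤ x → 1 + α ^ 2 * (x : ℂ) ≠ 0 := fun α hα x hx h => by
    have := one_add_mul_le_norm hx hα.1.le
    rw [h, norm_zero] at this
    nlinarith
  refine (hasDerivAt_integral_of_dominated_loc_of_deriv_le (μ := volume.restrict unitSquare)
    (F := fun α z => ((‖wp z‖ ^ 2 : ℝ) : ℂ) / (1 + α ^ 2 * ((‖wp z‖ ^ 2 : ℝ) : ℂ)) ^ 2)
    (F' := fun α z => -4 * α * ((‖wp z‖ ^ 2 : ℝ) : ℂ) ^ 2 /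
      (1 + α ^ 2 * ((‖wp z‖ ^ 2 : ℝ) : ℂ)) ^ 3)
    (bound := fun _ => 4 * R / ε ^ 2) hs ?_ ?_ ?_ ?_ ?_ ?_).2.differentiableAt
  · exact Eventually.of_forall fun α => Measurable.aestronglyMeasurable (by fun_prop)
  · refine Integrable.of_bound (C := 1 / (4 * ε)) (Measurable.aestronglyMeasurable (by fun_prop))
      (Eventually.of_forall fun z => ?_)
    have hx : 0 ≤ ‖wp z‖ ^ 2 := by positivity
    have h1 := one_add_mul_le_norm hx hα₀s.1.le
    rw [norm_div, norm_pow, Complex.norm_real, Real.norm_of_nonneg hx]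
    exact (div_le_div_of_nonneg_left hx (by positivity) (by gcongr)).trans
      (div_one_add_sq_le hx hε)
  · exact Measurable.aestronglyMeasurable (by fun_prop)
  · refine Eventually.of_forall fun z α hα => ?_
    have hx : 0 ≤ ‖wp z‖ ^ 2 := by positivity
    generalize ‖wp z‖ ^ 2 = x at hx
    have h1 := one_add_mul_le_norm hx hα.1.le
    have h2 : ‖α‖ ≤ R := (show ‖α‖ < R from hα.2).le
    rw [norm_div, norm_pow, norm_mul, norm_mul, norm_pow, norm_neg, Complex.norm_real,
      Real.norm_of_nonneg hx, Complex.norm_ofNat]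
    calc 4 * ‖α‖ * x ^ 2 / ‖1 + α ^ 2 * (x : ℂ)‖ ^ 3 ≤ 4 * R * x ^ 2 / (1 + ε * x) ^ 3 := by gcongr
      _ ≤ 4 * R / ε ^ 2 := by
        rw [div_le_div_iff₀ (by positivity) (by positivity)]
        have h3 : (ε * x) ^ 2 ≤ (1 + ε * x) ^ 3 := by
          have : 0 ≤ ε * x := by positivity
          nlinarith [pow_nonneg this 3, pow_nonneg this 2]
        calc 4 * R * x ^ 2 * ε ^ 2 = 4 * R * (ε * x) ^ 2 := by ring
          _ ≤ _ := by gcongr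
  · exact integrable_const _
  · refine Eventually.of_forall fun z α hα => ?_
    have hx : 0 ≤ ‖wp z‖ ^ 2 := by positivity
    generalize ‖wp z‖ ^ 2 = x at hx
    have h0 := hne α hα x hx
    have h1 : HasDerivAt (fun α : ℂ => (1 + α ^ 2 * (x : ℂ)) ^ 2)
        (2 * (1 + α ^ 2 * (x : ℂ)) * (2 * α * x)) α := by
      have := (((hasDerivAt_pow 2 α).mul_const (x : ℂ)).const_add 1).fun_pow 2
      simpa using this
    refine ((hasDerivAt_const α (x : ℂ)).fun_div h1 (pow_ne_zero 2 h0)).congr_deriv ?_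
    field_simp
    ring

lemma f_eq_re (α : ℝ) : f α = (fComplex α).re := by
  have : fComplex α = ((f α : ℝ) : ℂ) := by
    rw [fComplex, f, ← integral_complex_ofReal]
    push_cast
    rfl
  rw [this, Complex.ofReal_re]

lemma contDiffAt_f {α : ℝ} (hα : 0 < α) : ContDiffAt ℝ ∞ f α := by
  have hopen : IsOpen {α : ℂ | 0 < (α ^ 2).re} := isOpen_lt continuous_const (by fun_prop)
  have hmem : (α : ℂ) ∈ {α : ℂ | 0 < (α ^ 2).re} := by
    simp only [mem_ofPred_eq]
    rw [← Complex.ofReal_pow, Complex.ofReal_re]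
    positivity
  have hd : DifferentiableOn ℂ fComplex {α : ℂ | 0 < (α ^ 2).re} := fun z hz =>
    (differentiableAt_fComplex hz).differentiableWithinAt
  have h1 : ContDiffAt ℝ ∞ fComplex (α : ℂ) :=
    ((hd.analyticAt (hopen.mem_nhds hmem)).contDiffAt (n := ∞)).restrict_scalars ℝ
  have h2 : ContDiffAt ℝ ∞ (fun α : ℝ => (fComplex α).re) α :=
    Complex.reCLM.contDiff.contDiffAt.comp α
      (h1.comp α (f := fun x : ℝ => (x : ℂ)) Complex.ofRealCLM.contDiff.contDiffAt)
  exact h2.congr_of_eventuallyEq (Eventually.of_forall f_eq_re)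

lemma f_pos {α : ℝ} (hα : 0 < α) : 0 < f α := by
  have hnn : ∀ z, 0 ≤ ‖wp z‖ ^ 2 / (1 + α ^ 2 * ‖wp z‖ ^ 2) ^ 2 := fun z => by positivity
  refine lt_of_le_of_ne (integral_nonneg hnn) fun h => ?_
  have h0 := (integral_eq_zero_iff_of_nonneg hnn (integrableOn_f hα)).1 h.symm
  have h1 : ∀ᵐ z ∂(volume.restrict unitSquare), False := by
    filter_upwards [h0, ae_restrict_of_ae ae_notMem_Ω, ae_restrict_of_ae ae_add_ζ_notMem_Ω]
      with z hz h1 h2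
    have h3 : 0 < ‖wp z‖ := norm_pos_iff.2 (wp_ne_zero h1 h2)
    have h4 : 0 < ‖wp z‖ ^ 2 / (1 + α ^ 2 * ‖wp z‖ ^ 2) ^ 2 := by positivity
    exact h4.ne' hz
  have h2 := isAddFundamentalDomain_unitSquare.measure_ne_zero
    (NeZero.ne (volume : Measure ℂ))
  rw [eventually_false_iff_eq_bot, ae_eq_bot, Measure.restrict_eq_zero] at h1
  exact h2 h1

/-- Translating the domain by `ζ` replaces `|℘|` by `e₁² / |℘|`. -/
lemma f_eq_f_inv {α : ℝ} (hα : 0 < α) : f α = f (1 / (α * e₁ ^ 2)) / (α * e₁) ^ 4 := by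
  have he := e₁_pos
  have hper : ∀ l ∈ Ω, ∀ z, ‖wp (z + l)‖ ^ 2 / (1 + α ^ 2 * ‖wp (z + l)‖ ^ 2) ^ 2 =
      ‖wp z‖ ^ 2 / (1 + α ^ 2 * ‖wp z‖ ^ 2) ^ 2 := fun l hl z => by rw [wp_add hl]
  rw [f, ← setIntegral_unitSquare_add hper ζ, f, div_eq_mul_inv, ← integral_mul_const]
  refine integral_congr_ae ?_
  filter_upwards [ae_restrict_of_ae ae_notMem_Ω, ae_restrict_of_ae ae_add_ζ_notMem_Ω] with z h1 h2
  have h3 := congrArg norm (wp_mul_wp_add_ζ h1 h2)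
  have h4 : 0 < ‖wp z‖ := norm_pos_iff.2 (wp_ne_zero h1 h2)
  rw [norm_mul, norm_neg, norm_pow, Complex.norm_real, Real.norm_of_nonneg he.le] at h3
  have h5 : ‖wp (z + ζ)‖ = e₁ ^ 2 / ‖wp z‖ := by rw [← h3]; field_simp
  simp only [h5]
  field_simp
  ring

/-! ### The asymptotics of `f` -/

lemma integral_norm_pow_div :
    ∫ u : ℂ, ‖u‖ ^ 4 / (1 + ‖u‖ ^ 4) ^ 2 = Real.pi ^ 2 / 4 := by
  have h1 : ∫ y in Ioi (0 : ℝ), y ^ 5 / (1 + y ^ 4) ^ 2 = Real.pi / 8 := by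
    -- With `s = y²` the integrand becomes `½ s² / (1 + s²)² ds`, whose antiderivative is `¼ (arctan
    -- s - s / (1 + s²))`.
    have hd : ∀ y ∈ Ici (0 : ℝ), HasDerivAt
        (fun y : ℝ => Real.arctan (y ^ 2) / 4 - y ^ 2 / (4 * (1 + y ^ 4)))
        (y ^ 5 / (1 + y ^ 4) ^ 2) y := fun y _ => by
      have e1 := ((hasDerivAt_pow 2 y).arctan).div_const 4
      have e2 := (((hasDerivAt_pow 4 y).const_add 1).const_mul 4)
      have hne : 4 * (1 + y ^ 4) ≠ 0 := by positivity
      refine (e1.fun_sub ((hasDerivAt_pow 2 y).fun_div e2 hne)).congr_deriv ?_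
      have hne' : 1 + y ^ 4 ≠ 0 := by positivity
      have hne'' : 1 + (y ^ 2) ^ 2 ≠ 0 := by positivity
      push_cast
      field_simp
      ring
    have hlim : Tendsto (fun y : ℝ => Real.arctan (y ^ 2) / 4 - y ^ 2 / (4 * (1 + y ^ 4)))
        atTop (𝓝 (Real.pi / 8)) := by
      have t1 : Tendsto (fun y : ℝ => Real.arctan (y ^ 2) / 4) atTop (𝓝 (Real.pi / 2 / 4)) :=
        ((Real.tendsto_arctan_atTop.mono_right nhdsWithin_le_nhds).comp
          (tendsto_pow_atTop two_ne_zero)).div_const 4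
      have t2 : Tendsto (fun y : ℝ => y ^ 2 / (4 * (1 + y ^ 4))) atTop (𝓝 0) := by
        refine squeeze_zero' (g := fun y : ℝ => (y ^ 2)⁻¹) ?_ ?_ ?_
        · exact Eventually.of_forall fun y => by positivity
        · filter_upwards [eventually_gt_atTop 0] with y hy
          rw [inv_eq_one_div, div_le_div_iff₀ (by positivity) (by positivity)]
          nlinarith [sq_nonneg (y ^ 2)]
        · exact tendsto_inv_atTop_zero.comp (tendsto_pow_atTop two_ne_zero)
      have := t1.sub t2
      convert this using 2
      ring
    rw [integral_Ioi_of_hasDerivAt_of_nonneg' hd (fun y hy => ?_) hlim]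
    · simp
    · have hy : 0 < y := hy
      positivity
  have h2 := integral_fun_norm_addHaar (volume : Measure ℂ)
    (fun y : ℝ => y ^ 4 / (1 + y ^ 4) ^ 2)
  rw [h2, Complex.finrank_real_complex]
  have h3 : (volume : Measure ℂ).real (Metric.ball 0 1) = Real.pi := by
    simp [measureReal_def, Complex.volume_ball]
  have h4 : ∫ y in Ioi (0 : ℝ), y ^ (2 - 1) • (y ^ 4 / (1 + y ^ 4) ^ 2) =
      ∫ y in Ioi (0 : ℝ), y ^ 5 / (1 + y ^ 4) ^ 2 := by
    congr 1
    ext y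
    simp only [smul_eq_mul]
    ring
  rw [h3, h4, h1]
  simp
  ring

/-- The fundamental domain centred at the origin. -/
def centredSquare : Set ℂ := (fun z => z + ζ) ⁻¹' unitSquare

lemma measurableSet_centredSquare : MeasurableSet centredSquare :=
  (measurable_add_const ζ) measurableSet_unitSquare

lemma mem_centredSquare {z : ℂ} :
    z ∈ centredSquare ↔ -(1 / 2) ≤ z.re ∧ z.re < 1 / 2 ∧ -(1 / 2) ≤ z.im ∧ z.im < 1 / 2 := by
  have h1 : (z + ζ).re = z.re + 1 / 2 := by simp [ζ]
  have h2 : (z + ζ).im = z.im + 1 / 2 := by simp [ζ]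
  simp only [centredSquare, mem_preimage, unitSquare, mem_ofPred_eq, h1, h2]
  constructor
  · rintro ⟨a, b, c, d⟩
    exact ⟨by linarith, by linarith, by linarith, by linarith⟩
  · rintro ⟨a, b, c, d⟩
    exact ⟨by linarith, by linarith, by linarith, by linarith⟩

lemma centredSquare_mem_nhds : centredSquare ∈ 𝓝 (0 : ℂ) := by
  filter_upwards [Metric.ball_mem_nhds (0 : ℂ) (show (0 : ℝ) < 1 / 2 by norm_num)] with z hz
  rw [mem_ball_zero_iff] at hz
  have h1 := abs_lt.1 ((Complex.abs_re_le_norm z).trans_lt hz)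
  have h2 := abs_lt.1 ((Complex.abs_im_le_norm z).trans_lt hz)
  exact mem_centredSquare.2 ⟨h1.1.le, h1.2, h2.1.le, h2.2⟩

lemma eq_zero_of_mem_Ω_of_abs_lt {z : ℂ} (hz : z ∈ Ω) (h1 : |z.re| < 1) (h2 : |z.im| < 1) :
    z = 0 := by
  obtain ⟨⟨m, hm⟩, n, hn⟩ := mem_Ω_iff.1 hz
  rw [hm] at h1
  rw [hn] at h2
  have h1 : m = 0 := Int.abs_lt_one_iff.1 (by exact_mod_cast h1)
  have h2 : n = 0 := Int.abs_lt_one_iff.1 (by exact_mod_cast h2)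
  apply Complex.ext <;> simp [hm, hn, h1, h2]

/-- The origin is the only lattice point in the closed centred square, so `z² ℘(z)` extends
continuously to this compact set. -/
lemma exists_norm_sq_mul_wp_le : ∃ C, ∀ z ∈ centredSquare, ‖z ^ 2 * wp z‖ ≤ C := by
  obtain ⟨h, ha, h0, hh⟩ := exists_analyticAt_sq_mul_wp
  let K : Set ℂ := Icc (-(1 / 2)) (1 / 2) ×ℂ Icc (-(1 / 2)) (1 / 2)
  have hK : IsCompact K := isCompact_Icc.reProdIm isCompact_Icc
  have hcont : ContinuousOn h K := fun z hz => by
    by_cases hz0 : z = 0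
    · rw [hz0]
      exact ha.continuousAt.continuousWithinAt
    · have hzΩ : z ∉ Ω := fun hm => hz0 (eq_zero_of_mem_Ω_of_abs_lt hm
        (abs_lt.2 ⟨by linarith [hz.1.1], by linarith [hz.1.2]⟩)
        (abs_lt.2 ⟨by linarith [hz.2.1], by linarith [hz.2.2]⟩))
      have h1 : ContinuousAt (fun z => z ^ 2 * wp z) z :=
        (continuousAt_id.pow 2).mul (analyticAt_wp hzΩ).continuousAt
      refine (h1.congr ?_).continuousWithinAt
      filter_upwards [isOpen_ne.mem_nhds hz0] with w hw
      exact hh w hw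
  obtain ⟨C, hC⟩ := hK.exists_bound_of_continuousOn hcont
  refine ⟨C, fun z hz => ?_⟩
  have hzK : z ∈ K := by
    obtain ⟨a, b, c, d⟩ := mem_centredSquare.1 hz
    exact ⟨⟨a, b.le⟩, c, d.le⟩
  by_cases hz0 : z = 0
  · rw [hz0]
    simpa using (norm_nonneg _).trans (hC z hzK)
  · rw [hh z hz0]
    exact hC z hzK

lemma f_eq_integral_indicator (α : ℝ) :
    f α = ∫ z, centredSquare.indicator
      (fun z => ‖wp z‖ ^ 2 / (1 + α ^ 2 * ‖wp z‖ ^ 2) ^ 2) z := by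
  have hper : ∀ l ∈ Ω, ∀ z, ‖wp (z + l)‖ ^ 2 / (1 + α ^ 2 * ‖wp (z + l)‖ ^ 2) ^ 2 =
      ‖wp z‖ ^ 2 / (1 + α ^ 2 * ‖wp z‖ ^ 2) ^ 2 := fun l hl z => by rw [wp_add hl]
  rw [integral_indicator measurableSet_centredSquare, f, ← setIntegral_unitSquare_add hper (-ζ),
    ← (measurePreserving_add_right volume ζ).setIntegral_preimage_emb
      (MeasurableEquiv.addRight ζ).measurableEmbedding]
  simp [centredSquare]

/-- The substitution `z = √α u`, with Jacobian `α`; the scale is the one at which `α ℘(z)` is of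
order one near the pole. -/
lemma mul_f_eq {α : ℝ} (hα : 0 < α) :
    α * f α = ∫ u : ℂ, centredSquare.indicator
      (fun z => α ^ 2 * (‖wp z‖ ^ 2 / (1 + α ^ 2 * ‖wp z‖ ^ 2) ^ 2)) (√α • u) := by
  rw [Measure.integral_comp_smul volume, Complex.finrank_real_complex, Real.sq_sqrt hα.le,
    abs_of_pos (by positivity), f_eq_integral_indicator, ← integral_const_mul, ← integral_smul]
  congr 1
  ext z
  by_cases hz : z ∈ centredSquare
  · simp only [indicator_of_mem hz, smul_eq_mul]
    field_simp
  · simp [indicator_of_notMem hz]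

lemma sq_div_one_add_sq_le {X : ℝ} : X ^ 2 / (1 + X ^ 2) ^ 2 ≤ 1 ∧
    X ^ 2 / (1 + X ^ 2) ^ 2 ≤ X ^ 2 := by
  constructor
  · rw [div_le_one (by positivity)]
    nlinarith [sq_nonneg X, sq_nonneg (X ^ 2)]
  · refine div_le_self (sq_nonneg X) (one_le_pow₀ ?_)
    nlinarith [sq_nonneg X]

/-- In the rescaled variable `α |℘(√α u)| = |z² ℘(z)| / |u|²` at `z = √α u`. This tends to `1 /
|u|²`, and boundedness of `z² ℘` on the centred square provides the dominating function. -/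
lemma tendsto_mul_f : Tendsto (fun α => α * f α) (𝓝[>] 0) (𝓝 (Real.pi ^ 2 / 4)) := by
  obtain ⟨C, hC⟩ := exists_norm_sq_mul_wp_le
  have hm := measurable_wp
  rw [← integral_norm_pow_div]
  have hcongr : (fun α => ∫ u : ℂ, centredSquare.indicator
      (fun z => α ^ 2 * (‖wp z‖ ^ 2 / (1 + α ^ 2 * ‖wp z‖ ^ 2) ^ 2)) (√α • u)) =ᶠ[𝓝[>] 0]
      fun α => α * f α := by
    filter_upwards [self_mem_nhdsWithin] with α hα
    exact (mul_f_eq hα).symm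
  refine Tendsto.congr' hcongr ?_
  have hkey : ∀ {α : ℝ}, 0 < α → ∀ {u : ℂ}, u ≠ 0 →
      α * ‖wp (√α • u)‖ = ‖(√α • u) ^ 2 * wp (√α • u)‖ / ‖u‖ ^ 2 := fun {α} hα {u} hu => by
    have : ‖u‖ ≠ 0 := norm_ne_zero_iff.2 hu
    rw [norm_mul, norm_pow, norm_smul, Real.norm_of_nonneg (Real.sqrt_nonneg α), mul_pow,
      Real.sq_sqrt hα.le]
    field_simp
  refine tendsto_integral_filter_of_dominated_convergence
    -- With `X = α |℘(√α u)|`, the integrand is at most `1` and at most `X² ≤ C² / |u|⁴`; the first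
    -- is used for `|u| ≤ 1`, the second for `|u| > 1`. In both cases `(1 + |u|)⁴ ≤ 16 max(1,
    -- |u|)⁴`.
    (fun u => 16 * (1 + C ^ 2) * (1 + ‖u‖) ^ (-4 : ℝ)) ?_ ?_ ?_ ?_
  · refine Eventually.of_forall fun α => Measurable.aestronglyMeasurable ?_
    have : Measurable (centredSquare.indicator
      (fun z => α ^ 2 * (‖wp z‖ ^ 2 / (1 + α ^ 2 * ‖wp z‖ ^ 2) ^ 2))) :=
      Measurable.indicator (by fun_prop) measurableSet_centredSquare
    exact this.comp (measurable_const_smul _)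
  · filter_upwards [self_mem_nhdsWithin] with α hα
    have hα : 0 < α := hα
    refine Eventually.of_forall fun u => ?_
    have hrpow : (1 + ‖u‖) ^ (-4 : ℝ) = ((1 + ‖u‖) ^ 4)⁻¹ := by
      rw [Real.rpow_neg (by positivity)]
      norm_cast
    rw [hrpow]
    by_cases hz : √α • u ∈ centredSquare
    swap
    · rw [indicator_of_notMem hz, norm_zero]
      positivity
    rw [indicator_of_mem hz]
    have hX : α ^ 2 * (‖wp (√α • u)‖ ^ 2 / (1 + α ^ 2 * ‖wp (√α • u)‖ ^ 2) ^ 2) =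
        (α * ‖wp (√α • u)‖) ^ 2 / (1 + (α * ‖wp (√α • u)‖) ^ 2) ^ 2 := by
      rw [mul_pow]; ring
    rw [hX, Real.norm_of_nonneg (by positivity), ← div_eq_mul_inv, le_div_iff₀ (by positivity)]
    set X := α * ‖wp (√α • u)‖ with hXdef
    obtain ⟨b1, b2⟩ := sq_div_one_add_sq_le (X := X)
    rcases le_or_gt ‖u‖ 1 with hu | hu
    · calc X ^ 2 / (1 + X ^ 2) ^ 2 * (1 + ‖u‖) ^ 4 ≤ 1 * (1 + 1) ^ 4 := by gcongr
        _ ≤ 16 * (1 + C ^ 2) := by nlinarith [sq_nonneg C]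
    · have hu0 : u ≠ 0 := norm_pos_iff.1 (one_pos.trans hu)
      have hXle : X ≤ C / ‖u‖ ^ 2 := by
        rw [hXdef, hkey hα hu0]
        gcongr
        exact hC _ hz
      have hX0 : 0 ≤ X := by positivity
      calc X ^ 2 / (1 + X ^ 2) ^ 2 * (1 + ‖u‖) ^ 4 ≤ (C / ‖u‖ ^ 2) ^ 2 * (‖u‖ + ‖u‖) ^ 4 := by
            gcongr
            exact b2.trans (by gcongr)
        _ = 16 * C ^ 2 := by
            have : ‖u‖ ≠ 0 := norm_ne_zero_iff.2 hu0
            field_simp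
            ring
        _ ≤ _ := by nlinarith
  · refine (integrable_one_add_norm ?_).const_mul _
    rw [Complex.finrank_real_complex]
    norm_num
  · have hne : ∀ᵐ u : ℂ, u ≠ 0 := by simp [ae_iff]
    filter_upwards [hne] with u hu
    have hun : ‖u‖ ≠ 0 := norm_ne_zero_iff.2 hu
    have ht : Tendsto (fun α : ℝ => √α • u) (𝓝[>] 0) (𝓝[≠] 0) := by
      refine tendsto_nhdsWithin_iff.2 ⟨?_, ?_⟩
      · have : ContinuousAt (fun α : ℝ => √α • u) 0 := by fun_prop
        simpa using this.tendsto.mono_left nhdsWithin_le_nhds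
      · filter_upwards [self_mem_nhdsWithin] with α hα
        have hα : 0 < α := hα
        simp [(Real.sqrt_pos.2 hα).ne', hu]
    have h1 : Tendsto (fun α : ℝ => α * ‖wp (√α • u)‖) (𝓝[>] 0) (𝓝 (1 / ‖u‖ ^ 2)) := by
      have h2 := ((tendsto_sq_mul_wp.comp ht).norm).div_const (‖u‖ ^ 2)
      rw [norm_one] at h2
      refine h2.congr' ?_
      filter_upwards [self_mem_nhdsWithin] with α hα
      exact (hkey hα hu).symm
    have h2 := (h1.pow 2).div (((h1.pow 2).const_add 1).pow 2) (by positivity)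
    have e : (1 / ‖u‖ ^ 2) ^ 2 / (1 + (1 / ‖u‖ ^ 2) ^ 2) ^ 2 = ‖u‖ ^ 4 / (1 + ‖u‖ ^ 4) ^ 2 := by
      field_simp
      ring
    rw [e] at h2
    refine h2.congr' ?_
    filter_upwards [(ht.mono_right nhdsWithin_le_nhds).eventually centredSquare_mem_nhds]
      with α hα
    have hα : √α • u ∈ centredSquare := hα
    rw [indicator_of_mem hα, Pi.div_apply]
    ring

lemma f_isEquivalent_zero :
    Asymptotics.IsEquivalent (𝓝[>] 0) f (fun α => Real.pi ^ 2 / (4 * α)) := by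
  refine Asymptotics.isEquivalent_of_tendsto_one ?_
  have h := tendsto_mul_f.div_const (Real.pi ^ 2 / 4)
  rw [div_self (by positivity)] at h
  refine h.congr' ?_
  filter_upwards [self_mem_nhdsWithin] with α hα
  have hα : 0 < α := hα
  simp only [Pi.div_apply]
  field_simp

/-- With `β = 1 / (α e₁²)`, the functional equation reads `α³ f(α) = β f(β) / e₁²`, and `β → 0⁺`. -/
lemma tendsto_pow_mul_f :
    Tendsto (fun α => α ^ 3 * f α) atTop (𝓝 (Real.pi ^ 2 / (4 * e₁ ^ 2))) := by
  have he := e₁_pos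
  have ht : Tendsto (fun α : ℝ => 1 / (α * e₁ ^ 2)) atTop (𝓝[>] 0) := by
    have := tendsto_inv_atTop_nhdsGT_zero.comp
      (tendsto_id.atTop_mul_const (show 0 < e₁ ^ 2 by positivity))
    refine this.congr fun α => ?_
    simp
  have h := (tendsto_mul_f.comp ht).div_const (e₁ ^ 2)
  rw [div_div] at h
  refine h.congr' ?_
  filter_upwards [eventually_gt_atTop 0] with α hα
  rw [f_eq_f_inv hα]
  simp only [Function.comp_apply]
  field_simp

lemma f_isEquivalent_atTop :
    Asymptotics.IsEquivalent atTop f (fun α => Real.pi ^ 2 / (4 * e₁ ^ 2 * α ^ 3)) := by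
  have he := e₁_pos
  refine Asymptotics.isEquivalent_of_tendsto_one ?_
  have h := tendsto_pow_mul_f.div_const (Real.pi ^ 2 / (4 * e₁ ^ 2))
  rw [div_self (by positivity)] at h
  refine h.congr' ?_
  filter_upwards [eventually_gt_atTop 0] with α hα
  simp only [Pi.div_apply]
  field_simp

lemma continuousOn_sqrt_f : ContinuousOn (fun α => √(f α)) (Ioi 0) := fun _ hα =>
  (contDiffAt_f hα).continuousAt.sqrt.continuousWithinAt

lemma integrableOn_sqrt_f : IntegrableOn (fun α => √(f α)) (Ioi 0) := by
  -- Convergence of the Mellin transform at `s = 1`, which lies strictly between the decay exponents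
  -- `1/2` at `0` and `3/2` at `∞`.
  have h := mellin_convergent_of_isBigO_scalar (a := 3 / 2) (b := 1 / 2) (s := 1)
    (continuousOn_sqrt_f.locallyIntegrableOn measurableSet_Ioi) ?_ (by norm_num) ?_ (by norm_num)
  · simpa using h
  · set D := Real.pi ^ 2 / (4 * e₁ ^ 2) + 1
    refine Asymptotics.IsBigO.of_bound (√D) ?_
    filter_upwards [tendsto_pow_mul_f.eventually_lt_const (lt_add_one _), eventually_gt_atTop 0]
      with α h1 hα
    rw [Real.norm_of_nonneg (by positivity), Real.norm_of_nonneg (by positivity),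
      Real.rpow_neg hα.le, ← div_eq_mul_inv, le_div_iff₀ (by positivity)]
    have e : α ^ (3 / 2 : ℝ) = √(α ^ 3) := by
      rw [Real.sqrt_eq_rpow, ← Real.rpow_natCast, ← Real.rpow_mul hα.le]
      norm_num
    rw [e, ← Real.sqrt_mul' _ (by positivity)]
    exact Real.sqrt_le_sqrt (by linarith)
  · set D := Real.pi ^ 2 / 4 + 1
    refine Asymptotics.IsBigO.of_bound (√D) ?_
    filter_upwards [tendsto_mul_f.eventually_lt_const (lt_add_one _), self_mem_nhdsWithin]
      with α h1 hα
    have hα : 0 < α := hα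
    rw [Real.norm_of_nonneg (by positivity), Real.norm_of_nonneg (by positivity),
      Real.rpow_neg hα.le, ← div_eq_mul_inv, le_div_iff₀ (by positivity), ← Real.sqrt_eq_rpow,
      ← Real.sqrt_mul' _ (by positivity)]
    exact Real.sqrt_le_sqrt (by rw [mul_comm]; exact h1.le)

/-! ### Arc length along `Σ_V` -/

/-- Valid at the poles too, because there both sides take the default value `0`. -/
lemma toC_scaledWp (c z : ℂ) : toC (scaledWp c z) = c * wp z := by
  by_cases hz : z ∈ Ω
  · rw [scaledWp, if_pos hz, wp_of_mem hz, mul_zero]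
    rfl
  · rw [scaledWp, if_neg hz]
    rfl

lemma kineticEnergy_scaledWp {a : ℝ → ℝ} {a' t : ℝ} (h : HasDerivAt a a' t) :
    kineticEnergy (fun τ => scaledWp (a τ : ℂ)) t = a' ^ 2 * f (a t) := by
  rw [kineticEnergy, f, ← integral_const_mul]
  congr 1
  ext z
  have hd : deriv (fun τ => (a τ : ℂ) * wp z) t = a' * wp z :=
    (h.ofReal_comp.mul_const (wp z)).deriv
  simp only [toC_scaledWp, hd, norm_mul, Complex.norm_real, mul_pow, Real.norm_eq_abs, sq_abs]
  ring

lemma kineticEnergy_scaledWp_id (α : ℝ) :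
    kineticEnergy (fun β : ℝ => scaledWp (β : ℂ)) α = f α := by
  simpa using kineticEnergy_scaledWp (hasDerivAt_id α)

lemma curveLength_sigmaV :
    curveLength (fun α : ℝ => scaledWp (α : ℂ)) (Ioi 0) = ENNReal.ofReal totalLength := by
  simp only [curveLength, kineticEnergy_scaledWp_id]
  rw [totalLength, ofReal_integral_eq_lintegral_ofReal integrableOn_sqrt_f
    (ae_of_all _ fun α => Real.sqrt_nonneg _)]

/-- The arc length of `Σ_V` between the parameters `0` and `α`. -/
def arcLength (α : ℝ) : ℝ := ∫ x in (0 : ℝ)..α, (Ioi (0 : ℝ)).indicator (fun x => √(f x)) x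

lemma integrable_indicator_sqrt_f :
    Integrable ((Ioi (0 : ℝ)).indicator (fun x => √(f x))) :=
  (integrable_indicator_iff measurableSet_Ioi).2 integrableOn_sqrt_f

lemma continuous_arcLength : Continuous arcLength :=
  intervalIntegral.continuous_primitive
    (fun _ _ => integrable_indicator_sqrt_f.intervalIntegrable) 0

lemma arcLength_zero : arcLength 0 = 0 := intervalIntegral.integral_same

lemma hasDerivAt_arcLength {α : ℝ} (hα : 0 < α) : HasDerivAt arcLength (√(f α)) α := by
  have hc : ContinuousAt ((Ioi (0 : ℝ)).indicator (fun x => √(f x))) α := by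
    have : ContinuousAt (fun x => √(f x)) α := (contDiffAt_f hα).continuousAt.sqrt
    refine this.congr ?_
    filter_upwards [Ioi_mem_nhds hα] with x hx
    rw [indicator_of_mem hx]
  have h := intervalIntegral.integral_hasDerivAt_right
    (integrable_indicator_sqrt_f.intervalIntegrable (a := 0) (b := α))
    (integrable_indicator_sqrt_f.aestronglyMeasurable.stronglyMeasurableAtFilter) hc
  rwa [indicator_of_mem (show α ∈ Ioi 0 from hα)] at h

lemma strictMonoOn_arcLength : StrictMonoOn arcLength (Ici 0) := by
  refine strictMonoOn_of_deriv_pos (convex_Ici 0) continuous_arcLength.continuousOn fun x hx => ?_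
  rw [interior_Ici] at hx
  rw [(hasDerivAt_arcLength hx).deriv]
  exact Real.sqrt_pos.2 (f_pos hx)

lemma tendsto_arcLength : Tendsto arcLength atTop (𝓝 totalLength) := by
  have h := intervalIntegral_tendsto_integral_Ioi (0 : ℝ)
    integrable_indicator_sqrt_f.integrableOn tendsto_id
  have e : ∫ x in Ioi (0 : ℝ), (Ioi (0 : ℝ)).indicator (fun x => √(f x)) x = totalLength :=
    setIntegral_congr_fun measurableSet_Ioi fun x hx => indicator_of_mem hx _
  rwa [e] at h

lemma arcLength_mem {α : ℝ} (hα : 0 < α) : arcLength α ∈ Ioo 0 totalLength := by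
  constructor
  · rw [← arcLength_zero]
    exact strictMonoOn_arcLength self_mem_Ici hα.le hα
  · refine (strictMonoOn_arcLength hα.le (by positivity : (0 : ℝ) ≤ α + 1)
      (lt_add_one α)).trans_le ?_
    refine ge_of_tendsto tendsto_arcLength ?_
    filter_upwards [eventually_ge_atTop (α + 1)] with x hx
    exact strictMonoOn_arcLength.monotoneOn (by positivity : (0 : ℝ) ≤ α + 1)
      (by linarith : (0 : ℝ) ≤ x) hx

lemma exists_arcLength_eq {t : ℝ} (ht : t ∈ Ioo 0 totalLength) : ∃ α > 0, arcLength α = t := by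
  obtain ⟨R, hR, hR0⟩ :=
    ((tendsto_arcLength.eventually_const_lt ht.2).and (eventually_ge_atTop 0)).exists
  obtain ⟨α, hα, h⟩ := intermediate_value_Icc hR0 continuous_arcLength.continuousOn
    (show t ∈ Icc (arcLength 0) (arcLength R) from ⟨by rw [arcLength_zero]; exact ht.1.le, hR.le⟩)
  refine ⟨α, lt_of_le_of_ne hα.1 fun h0 => ?_, h⟩
  rw [← h0, arcLength_zero] at h
  exact ht.1.ne h

/-- The parameter `α` of the point of `Σ_V` at arc length `t`. -/
def arcParam : ℝ → ℝ := Function.invFunOn arcLength (Ioi 0)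

lemma arcParam_spec {t : ℝ} (ht : t ∈ Ioo 0 totalLength) :
    0 < arcParam t ∧ arcLength (arcParam t) = t := by
  obtain ⟨α, hα, h⟩ := exists_arcLength_eq ht
  exact Function.invFunOn_pos (s := Ioi 0) ⟨α, hα, h⟩

lemma arcParam_arcLength {α : ℝ} (hα : 0 < α) : arcParam (arcLength α) = α := by
  obtain ⟨h1, h2⟩ := arcParam_spec (arcLength_mem hα)
  exact strictMonoOn_arcLength.injOn h1.le hα.le h2

lemma strictMonoOn_arcParam : StrictMonoOn arcParam (Ioo 0 totalLength) := fun s hs t ht h => by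
  obtain ⟨h1, h2⟩ := arcParam_spec hs
  obtain ⟨h3, h4⟩ := arcParam_spec ht
  rw [← h2, ← h4] at h
  exact (strictMonoOn_arcLength.lt_iff_lt h1.le h3.le).1 h

lemma image_arcParam : arcParam '' Ioo 0 totalLength = Ioi 0 := by
  ext α
  constructor
  · rintro ⟨t, ht, rfl⟩
    exact (arcParam_spec ht).1
  · exact fun hα => ⟨arcLength α, arcLength_mem hα, arcParam_arcLength hα⟩

lemma hasDerivAt_arcParam {t : ℝ} (ht : t ∈ Ioo 0 totalLength) :
    HasDerivAt arcParam (√(f (arcParam t)))⁻¹ t := by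
  have hpos := (arcParam_spec ht).1
  have hn := isOpen_Ioo.mem_nhds ht
  have hc : ContinuousAt arcParam t := strictMonoOn_arcParam.continuousAt_of_image_mem_nhds hn
    (by rw [image_arcParam]; exact Ioi_mem_nhds hpos)
  refine HasDerivAt.of_local_left_inverse hc (hasDerivAt_arcLength hpos)
    (Real.sqrt_pos.2 (f_pos hpos)).ne' ?_
  filter_upwards [hn] with s hs
  exact (arcParam_spec hs).2

/-- Bootstrapping: `a' = 1 / √(f(a))` with `f` smooth and positive, so each degree of smoothness of
`a` gives one more. -/
lemma contDiffOn_arcParam : ContDiffOn ℝ ∞ arcParam (Ioo 0 totalLength) := by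
  refine contDiffOn_infty.2 fun n => ?_
  induction n with
  | zero => exact contDiffOn_zero.2 fun t ht =>
      (hasDerivAt_arcParam ht).continuousAt.continuousWithinAt
  | succ n ih =>
    push_cast
    refine (contDiffOn_succ_iff_deriv_of_isOpen isOpen_Ioo).2
      ⟨fun t ht => (hasDerivAt_arcParam ht).differentiableAt.differentiableWithinAt,
        by simp, ?_⟩
    have h : ContDiffOn ℝ n (fun t => (√(f (arcParam t)))⁻¹) (Ioo 0 totalLength) := fun t ht => by
      have hpos := (arcParam_spec ht).1
      have hf : ContDiffAt ℝ n f (arcParam t) := (contDiffAt_f hpos).of_le (by exact_mod_cast le_top)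
      exact (((hf.comp_contDiffWithinAt t (ih t ht)).sqrt (f_pos hpos).ne')).inv
        (Real.sqrt_pos.2 (f_pos hpos)).ne'
    exact h.congr fun t ht => (hasDerivAt_arcParam ht).deriv

lemma kineticEnergy_arcParam {t : ℝ} (ht : t ∈ Ioo 0 totalLength) :
    kineticEnergy (fun t => scaledWp (arcParam t : ℂ)) t = 1 := by
  have hpos := f_pos (arcParam_spec ht).1
  rw [kineticEnergy_scaledWp (hasDerivAt_arcParam ht), inv_pow, Real.sq_sqrt hpos.le]
  exact inv_mul_cancel₀ hpos.ne'

lemma totalLength_pos : 0 < totalLength :=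
  (arcLength_mem one_pos).1.trans (arcLength_mem one_pos).2

lemma tendsto_arcParam_zero : Tendsto arcParam (𝓝[>] 0) (𝓝 0) := by
  refine tendsto_order.2 ⟨fun b hb => ?_, fun b hb => ?_⟩
  · filter_upwards [Ioo_mem_nhdsGT totalLength_pos] with t ht
    exact hb.trans (arcParam_spec ht).1
  · have h := arcLength_mem hb
    filter_upwards [Ioo_mem_nhdsGT h.1] with t ht
    have := strictMonoOn_arcParam ⟨ht.1, ht.2.trans h.2⟩ h ht.2
    rwa [arcParam_arcLength hb] at this

lemma tendsto_arcParam_totalLength : Tendsto arcParam (𝓝[<] totalLength) atTop := by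
  refine tendsto_atTop.2 fun b => ?_
  have hb : 0 < max b 1 := lt_max_of_lt_right one_pos
  have h := arcLength_mem hb
  filter_upwards [Ioo_mem_nhdsLT h.2] with t ht
  have := strictMonoOn_arcParam h ⟨h.1.trans ht.1, ht.2⟩ ht.1
  rw [arcParam_arcLength hb] at this
  exact (le_max_left _ _).trans this.le

/-! ### The Möbius action in homogeneous coordinates -/

/-- The point of the sphere with homogeneous coordinates `[u : v]`. -/
def homog (u v : ℂ) : OnePoint ℂ := if v = 0 then OnePoint.infty else ((u / v : ℂ) : OnePoint ℂ)

lemma homog_one (u : ℂ) : homog u 1 = (u : OnePoint ℂ) := by simp [homog]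

lemma homog_zero (u : ℂ) : homog u 0 = OnePoint.infty := by simp [homog]

lemma homog_one_left (v : ℂ) : homog 1 v = invCoord v := by simp [homog, invCoord]

lemma homog_mul {c : ℂ} (hc : c ≠ 0) (u v : ℂ) : homog (c * u) (c * v) = homog u v := by
  simp [homog, hc, mul_div_mul_left]

lemma equivProjectivization_homog {u v : ℂ} (h : ![u, v] ≠ 0) :
    OnePoint.equivProjectivization ℂ (homog u v) = Projectivization.mk ℂ ![u, v] h := by
  rw [← Equiv.eq_symm_apply, OnePoint.equivProjectivization_symm_apply_mk]
  simp [homog, div_eq_inv_mul]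

lemma vec_ne_zero {u v : ℂ} (h : u ≠ 0 ∨ v ≠ 0) : ![u, v] ≠ 0 := by
  intro h0
  have h1 := congrFun h0 0
  have h2 := congrFun h0 1
  simp at h1 h2
  simp [h1, h2] at h

lemma det_SL (M : SL2C) : M.1 0 0 * M.1 1 1 - M.1 0 1 * M.1 1 0 = 1 := by
  rw [← Matrix.det_fin_two]
  exact M.2

lemma homog_coords_ne_zero (M : SL2C) {u v : ℂ} (h : u ≠ 0 ∨ v ≠ 0) :
    M.1 0 0 * u + M.1 0 1 * v ≠ 0 ∨ M.1 1 0 * u + M.1 1 1 * v ≠ 0 := by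
  by_contra! hc
  have hd := det_SL M
  have h1 : u = 0 := by linear_combination M.1 1 1 * hc.1 - M.1 0 1 * hc.2 - u * hd
  have h2 : v = 0 := by linear_combination M.1 0 0 * hc.2 - M.1 1 0 * hc.1 - v * hd
  simp [h1, h2] at h

lemma mobius_homog (M : SL2C) {u v : ℂ} (h : u ≠ 0 ∨ v ≠ 0) :
    mobius (M : PSL2C) (homog u v) =
      homog (M.1 0 0 * u + M.1 0 1 * v) (M.1 1 0 * u + M.1 1 1 * v) := by
  rw [mobius, equivProjectivization_homog (vec_ne_zero h), Equiv.symm_apply_eq,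
    equivProjectivization_homog (vec_ne_zero (homog_coords_ne_zero M h)),
    Matrix.ProjectiveSpecialLinearGroup.smul_proj_mk, Projectivization.smul_mk]
  congr 1
  ext i
  fin_cases i <;> simp [Matrix.SpecialLinearGroup.smul_def, Matrix.mulVec_fin_two]

lemma mobius_coe (M : SL2C) (w : ℂ) :
    mobius (M : PSL2C) w = homog (M.1 0 0 * w + M.1 0 1) (M.1 1 0 * w + M.1 1 1) := by
  rw [← homog_one, mobius_homog M (Or.inr one_ne_zero)]
  simp

lemma mobius_infty (M : SL2C) :
    mobius (M : PSL2C) OnePoint.infty = homog (M.1 0 0) (M.1 1 0) := by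
  rw [← homog_zero 1, mobius_homog M (Or.inl one_ne_zero)]
  simp

lemma mobius_one (x : OnePoint ℂ) : mobius 1 x = x := by
  simp [mobius]

lemma mobius_mul (g h : PSL2C) (x : OnePoint ℂ) : mobius (g * h) x = mobius g (mobius h x) := by
  simp [mobius, mul_smul]

/-! ### Symmetries of the fields -/

@[simp] lemma toC_infty : toC OnePoint.infty = 0 := rfl

@[simp] lemma toC_coe (w : ℂ) : toC (w : OnePoint ℂ) = w := rfl

/-- The condition `κ 0 = 0` is forced by the default value of `toC` at `∞`. -/
lemma toC_map {κ : ℂ → ℂ} (h : κ 0 = 0) (x : OnePoint ℂ) : toC (x.map κ) = κ (toC x) := by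
  cases x with
  | infty => simp [h]
  | coe w => simp

lemma map_conj_homog (u v : ℂ) : (homog u v).map (starRingEnd ℂ) =
    homog ((starRingEnd ℂ) u) ((starRingEnd ℂ) v) := by
  by_cases hv : v = 0 <;> simp [homog, hv]

lemma map_neg_homog (u v : ℂ) : (homog u v).map (fun w => -w) = homog (-u) v := by
  by_cases hv : v = 0 <;> simp [homog, hv, neg_div]

lemma conjSL_apply (M : SL2C) (i j : Fin 2) : (conjSL M).1 i j = (starRingEnd ℂ) (M.1 i j) := rfl

lemma tauConjSL_val (M : SL2C) : (tauConjSL M).1 = !![M.1 0 0, -M.1 0 1; -M.1 1 0, M.1 1 1] := by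
  change !![1, 0; 0, -1] * M.1 * !![1, 0; 0, -1] = _
  conv_lhs => rw [Matrix.eta_fin_two M.1]
  simp

lemma mobius_conjSL (M : SL2C) (x : OnePoint ℂ) :
    mobius (conjSL M : PSL2C) (x.map (starRingEnd ℂ)) =
      (mobius (M : PSL2C) x).map (starRingEnd ℂ) := by
  cases x with
  | infty => simp [mobius_infty, map_conj_homog, conjSL_apply]
  | coe w => simp [mobius_coe, map_conj_homog, conjSL_apply]

lemma mobius_tauConjSL (M : SL2C) (x : OnePoint ℂ) :
    mobius (tauConjSL M : PSL2C) (x.map fun w => -w) =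
      (mobius (M : PSL2C) x).map fun w => -w := by
  cases x with
  | infty =>
    rw [OnePoint.map_infty, mobius_infty, mobius_infty, map_neg_homog, tauConjSL_val]
    simp [homog, div_neg, neg_div]
  | coe w =>
    rw [OnePoint.map_some, mobius_coe, mobius_coe, map_neg_homog, tauConjSL_val]
    simp
    congr 1
    ring

lemma scaledWp_add {l : ℂ} (hl : l ∈ Ω) (c z : ℂ) : scaledWp c (z + l) = scaledWp c z := by
  have h : z + l ∈ Ω ↔ z ∈ Ω := Submodule.add_mem_iff_left _ hl
  by_cases hz : z ∈ Ω <;> simp [scaledWp, h, hz, wp_add hl]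

lemma scaledWp_neg (c z : ℂ) : scaledWp c (-z) = scaledWp c z := by
  have h : -z ∈ Ω ↔ z ∈ Ω := neg_mem_iff
  by_cases hz : z ∈ Ω <;> simp [scaledWp, h, hz, wp_neg]

lemma scaledWp_I_mul (c z : ℂ) :
    scaledWp c (Complex.I * z) = (scaledWp c z).map fun w => -w := by
  by_cases hz : z ∈ Ω
  · simp [scaledWp, I_mul_mem_Ω, hz]
  · simp [scaledWp, I_mul_mem_Ω, hz, wp_I_mul]

lemma scaledWp_conj (c : ℝ) (z : ℂ) :
    scaledWp c ((starRingEnd ℂ) z) = (scaledWp c z).map (starRingEnd ℂ) := by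
  by_cases hz : z ∈ Ω
  · simp [scaledWp, conj_mem_Ω, hz]
  · simp [scaledWp, conj_mem_Ω, hz, wp_conj]

lemma orbitMap_add {l : ℂ} (hl : l ∈ Ω) (g : PSL2C) (s z : ℂ) :
    orbitMap g s (z + l) = orbitMap g s z := by
  rw [orbitMap, orbitMap, add_sub_right_comm, scaledWp_add hl]

lemma orbitMap_neg (g : PSL2C) (s z : ℂ) : orbitMap g (-s) (-z) = orbitMap g s z := by
  rw [orbitMap, orbitMap, ← scaledWp_neg]
  congr 2
  ring

lemma orbitMap_conj (M : SL2C) (s z : ℂ) :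
    orbitMap (conjSL M : PSL2C) ((starRingEnd ℂ) s) ((starRingEnd ℂ) z) =
      (orbitMap (M : PSL2C) s z).map (starRingEnd ℂ) := by
  have : (1 / (e₁ : ℂ)) = ((1 / e₁ : ℝ) : ℂ) := by push_cast; rfl
  rw [orbitMap, orbitMap, ← mobius_conjSL, ← map_sub, this, scaledWp_conj]

lemma orbitMap_I_mul (M : SL2C) (s z : ℂ) :
    orbitMap (tauConjSL M : PSL2C) (Complex.I * s) (Complex.I * z) =
      (orbitMap (M : PSL2C) s z).map fun w => -w := by
  rw [orbitMap, orbitMap, ← mobius_tauConjSL, ← mul_sub, scaledWp_I_mul]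

/-! ### Behaviour of the metric under symmetries -/

/-- Invertibility of `κ` makes this hold without differentiability, so the symmetries of the metric
components need no regularity of the family of fields. -/
lemma deriv_linearIsometryEquiv_comp (κ : ℂ ≃ₗᵢ[ℝ] ℂ) (F : ℝ → ℂ) (t : ℝ) :
    deriv (fun τ => κ (F τ)) t = κ (deriv F t) := by
  have h := κ.toContinuousLinearEquiv.comp_fderiv (f := F) (x := t)
  have h' := congrArg (fun L => L 1) h
  simpa [Function.comp_def] using h'

lemma pderiv_symm {n : ℕ} {F G : (Fin n → ℝ) → ℂ} (σ : (Fin n → ℝ) →ₗ[ℝ] (Fin n → ℝ))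
    (κ : ℂ ≃ₗᵢ[ℝ] ℂ) (h : ∀ p, G (σ p) = κ (F p)) {i : Fin n} {ε : ℝ} (hε : ε * ε = 1)
    (hi : σ (Pi.single i 1) = ε • Pi.single i 1) (q : Fin n → ℝ) :
    pderiv i G (σ q) = ε • κ (pderiv i F q) := by
  have e : ∀ t : ℝ, σ q + t • (Pi.single i 1 : Fin n → ℝ) =
      σ (q + t • (ε • (Pi.single i 1 : Fin n → ℝ))) := fun t => by
    rw [map_add, map_smul, map_smul, hi, smul_smul ε ε, hε, one_smul]
  rw [pderiv, pderiv, lineDeriv]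
  simp only [e, h]
  rw [deriv_linearIsometryEquiv_comp κ, ← map_smul κ, ← lineDeriv_smul]
  rfl

/-- A symmetry `W(z) ↦ κ(W(L⁻¹ z))` of the target and the domain, which acts linearly on the
coordinates by `σ`, changes the components of the metric by the signs of `σ`. -/
lemma metricCoeff_symm {n : ℕ} {ψ ψ' : (Fin n → ℝ) → ℂ → OnePoint ℂ}
    (hper : ∀ l ∈ Ω, ∀ p z, ψ' p (z + l) = ψ' p z)
    (σ : (Fin n → ℝ) →ₗ[ℝ] (Fin n → ℝ)) (L : ℂ ≃ₗᵢ[ℝ] ℂ) (hL : ∀ z, L z ∈ Ω ↔ z ∈ Ω)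
    (κ c : ℂ ≃ₗᵢ[ℝ] ℂ) (hκ : ∀ x y, κ x * (starRingEnd ℂ) (κ y) = c (x * (starRingEnd ℂ) y))
    (hc : ∀ x, (c x).re = x.re)
    (h : ∀ p z, toC (ψ' (σ p) (L z)) = κ (toC (ψ p z)))
    {i j : Fin n} {ε δ : ℝ} (hε : ε * ε = 1) (hδ : δ * δ = 1)
    (hi : σ (Pi.single i 1) = ε • Pi.single i 1) (hj : σ (Pi.single j 1) = δ • Pi.single j 1)
    (q : Fin n → ℝ) :
    metricCoeff ψ' i j (σ q) = ε * δ * metricCoeff ψ i j q := by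
  rw [metricCoeff, metricCoeff, ← setIntegral_unitSquare_isometry (fun l hl z => ?_) L hL]
  swap
  · simp only [hper l hl]
  have e : ∀ z, pderiv i (fun p => toC (ψ' p (L z))) (σ q) *
      (starRingEnd ℂ) (pderiv j (fun p => toC (ψ' p (L z))) (σ q)) /
        (((1 + ‖toC (ψ' (σ q) (L z))‖ ^ 2) ^ 2 : ℝ) : ℂ) =
      (ε * δ) • c (pderiv i (fun p => toC (ψ p z)) q *
      (starRingEnd ℂ) (pderiv j (fun p => toC (ψ p z)) q) /
        (((1 + ‖toC (ψ q z)‖ ^ 2) ^ 2 : ℝ) : ℂ)) := fun z => by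
    rw [pderiv_symm σ κ (fun p => h p z) hε hi, pderiv_symm σ κ (fun p => h p z) hδ hj, h,
      κ.norm_map]
    generalize pderiv i (fun p => toC (ψ p z)) q = x
    generalize pderiv j (fun p => toC (ψ p z)) q = y
    generalize (1 + ‖toC (ψ q z)‖ ^ 2) ^ 2 = d
    have hd : ∀ w : ℂ, w / (d : ℂ) = d⁻¹ • w := fun w => by
      rw [Complex.real_smul, Complex.ofReal_inv, div_eq_inv_mul]
    rw [hd, hd, map_smul c, ← hκ]
    simp only [Complex.real_smul, map_mul, Complex.conj_ofReal]
    push_cast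
    ring
  simp only [e]
  rw [integral_smul, Complex.smul_re, smul_eq_mul]
  congr 1
  -- An invertible linear map commutes with the integral even when the integrand is not integrable.
  have := c.toContinuousLinearEquiv.integral_comp_comm (μ := volume.restrict unitSquare)
    (fun z => pderiv i (fun p => toC (ψ p z)) q *
      (starRingEnd ℂ) (pderiv j (fun p => toC (ψ p z)) q) /
        (((1 + ‖toC (ψ q z)‖ ^ 2) ^ 2 : ℝ) : ℂ))
  simp only [LinearIsometryEquiv.coe_toContinuousLinearEquiv] at this
  rw [this, hc]

/-! ### The isometries `P` and `R` of `PSL(2, ℂ)` -/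

/-- The centre of `SL(2, ℂ)` consists of the scalars `r` with `r² = 1`. -/
lemma psl_eq_iff {M N : SL2C} : (M : PSL2C) = (N : PSL2C) ↔ N.1 = M.1 ∨ N.1 = -M.1 := by
  rw [QuotientGroup.eq, Matrix.SpecialLinearGroup.mem_center_iff]
  have hval : ∀ r : ℂ, Matrix.scalar (Fin 2) r = (M⁻¹ * N).1 ↔ N.1 = r • M.1 := fun r => by
    have h1 : M.1 * (M⁻¹ * N).1 = N.1 := by
      rw [← Matrix.SpecialLinearGroup.coe_mul, mul_inv_cancel_left]
    have h2 : M.1 * Matrix.scalar (Fin 2) r = r • M.1 := by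
      rw [Matrix.scalar_apply, ← Matrix.smul_one_eq_diagonal, Matrix.mul_smul, mul_one]
    constructor
    · intro h
      rw [← h1, ← h, h2]
    · intro h
      have h3 : M⁻¹.1 * M.1 = 1 := by
        rw [← Matrix.SpecialLinearGroup.coe_mul, inv_mul_cancel]
        rfl
      rw [Matrix.SpecialLinearGroup.coe_mul, h, ← h2, ← mul_assoc, h3, one_mul]
  constructor
  · rintro ⟨r, hr, h⟩
    rw [hval] at h
    rw [Fintype.card_fin] at hr
    rcases eq_or_eq_neg_of_sq_eq_sq r 1 (by rw [hr, one_pow]) with rfl | rfl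
    · exact Or.inl (by rw [h, one_smul])
    · exact Or.inr (by rw [h, neg_one_smul])
  · rintro (h | h)
    · exact ⟨1, one_pow _, (hval 1).2 (by rw [h, one_smul])⟩
    · exact ⟨-1, by simp, (hval (-1)).2 (by rw [h, neg_one_smul])⟩

lemma conjSL_conjSL (M : SL2C) : conjSL (conjSL M) = M := by
  ext i j
  exact Complex.conj_conj _

lemma tauConjSL_tauConjSL (M : SL2C) : tauConjSL (tauConjSL M) = M := by
  apply Subtype.ext
  rw [tauConjSL_val, tauConjSL_val]
  ext i j
  fin_cases i <;> fin_cases j <;> simp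

lemma tauConjSL_conjSL (M : SL2C) : tauConjSL (conjSL M) = conjSL (tauConjSL M) := by
  apply Subtype.ext
  rw [tauConjSL_val]
  ext i j
  rw [conjSL_apply (tauConjSL M), tauConjSL_val]
  fin_cases i <;> fin_cases j <;> simp [conjSL_apply]

lemma conjSL_mk_eq {M N : SL2C} (h : (M : PSL2C) = N) : (conjSL M : PSL2C) = conjSL N := by
  rw [psl_eq_iff] at h ⊢
  rcases h with h | h
  · left
    ext i j
    rw [conjSL_apply, conjSL_apply, h]
  · right
    ext i j
    rw [Matrix.neg_apply, conjSL_apply, conjSL_apply, h, Matrix.neg_apply, map_neg]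

lemma tauConjSL_mk_eq {M N : SL2C} (h : (M : PSL2C) = N) :
    (tauConjSL M : PSL2C) = tauConjSL N := by
  rw [psl_eq_iff] at h ⊢
  rcases h with h | h
  · left
    rw [tauConjSL_val, tauConjSL_val, h]
  · right
    rw [tauConjSL_val, tauConjSL_val, h]
    ext i j
    fin_cases i <;> fin_cases j <;> simp

/-- The involution of `PSL(2, ℂ)` induced by an involution of `SL(2, ℂ)`. -/
def pslInvolution (Φ : SL2C → SL2C) (h : ∀ M N : SL2C, (M : PSL2C) = N → (Φ M : PSL2C) = Φ N)
    (hΦ : ∀ M, Φ (Φ M) = M) : Equiv.Perm PSL2C :=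
  Function.Involutive.toPerm
    (Quotient.lift (fun M : SL2C => (Φ M : PSL2C)) fun M N hMN => h M N (Quotient.sound hMN))
    fun g => by
      induction g using QuotientGroup.induction_on with
      | H M => exact congrArg _ (hΦ M)

/-- The isometry `M ↦ M̄`. -/
def conjPerm : Equiv.Perm PSL2C := pslInvolution conjSL (fun _ _ => conjSL_mk_eq) conjSL_conjSL

/-- The isometry `M ↦ τ₃ M τ₃`. -/
def tauPerm : Equiv.Perm PSL2C :=
  pslInvolution tauConjSL (fun _ _ => tauConjSL_mk_eq) tauConjSL_tauConjSL

lemma conjPerm_mk (M : SL2C) : conjPerm (M : PSL2C) = (conjSL M : PSL2C) := rfl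

lemma tauPerm_mk (M : SL2C) : tauPerm (M : PSL2C) = (tauConjSL M : PSL2C) := rfl

lemma conjPerm_conjPerm (g : PSL2C) : conjPerm (conjPerm g) = g := conjPerm.left_inv g

lemma tauPerm_tauPerm (g : PSL2C) : tauPerm (tauPerm g) = g := tauPerm.left_inv g

lemma conjPerm_mul_self : conjPerm * conjPerm = 1 := Equiv.ext conjPerm_conjPerm

lemma tauPerm_mul_self : tauPerm * tauPerm = 1 := Equiv.ext tauPerm_tauPerm

lemma tauPerm_mul_conjPerm : tauPerm * conjPerm = conjPerm * tauPerm := by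
  ext g
  induction g using QuotientGroup.induction_on with
  | H M => exact congrArg _ (tauConjSL_conjSL M)

/-- The upper triangular unipotent matrices. -/
def upperSL (b : ℂ) : SL2C := ⟨!![1, b; 0, 1], by simp⟩

/-- The unipotents serve as test elements: `P` sends `b` to its conjugate and `R` sends it to `-b`,
so `b = i` and `b = 1` suffice to distinguish `1`, `P`, `R` and `P R`. -/
lemma upperSL_mk_injective {b c : ℂ} (h : (upperSL b : PSL2C) = upperSL c) : b = c := by
  rcases psl_eq_iff.1 h with h | h
  · simpa [upperSL] using (congrFun (congrFun h 0) 1).symm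
  · have := congrFun (congrFun h 0) 0
    simp [upperSL] at this
    norm_num [eq_neg_iff_add_eq_zero] at this

lemma conjSL_upperSL (b : ℂ) : conjSL (upperSL b) = upperSL ((starRingEnd ℂ) b) := by
  apply Subtype.ext
  ext i j
  rw [conjSL_apply]
  fin_cases i <;> fin_cases j <;> simp [upperSL]

lemma tauConjSL_upperSL (b : ℂ) : tauConjSL (upperSL b) = upperSL (-b) := by
  apply Subtype.ext
  rw [tauConjSL_val]
  ext i j
  fin_cases i <;> fin_cases j <;> simp [upperSL]

lemma conjPerm_ne_one : conjPerm ≠ 1 := fun h => by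
  have := congrArg (fun F : Equiv.Perm PSL2C => F (upperSL Complex.I)) h
  simp only [conjPerm_mk, conjSL_upperSL, Equiv.Perm.coe_one, id_eq] at this
  have := congrArg Complex.im (upperSL_mk_injective this)
  norm_num at this

lemma tauPerm_upperSL_one_ne : tauPerm (upperSL 1) ≠ (upperSL 1 : PSL2C) := fun h => by
  rw [tauPerm_mk, tauConjSL_upperSL] at h
  have := congrArg Complex.re (upperSL_mk_injective h)
  norm_num at this

lemma conjPerm_upperSL_one : conjPerm (upperSL 1) = (upperSL 1 : PSL2C) := by
  rw [conjPerm_mk, conjSL_upperSL, map_one]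

lemma tauPerm_ne_one : tauPerm ≠ 1 := fun h => tauPerm_upperSL_one_ne (by rw [h]; rfl)

lemma conjPerm_ne_tauPerm : conjPerm ≠ tauPerm := fun h =>
  tauPerm_upperSL_one_ne (by rw [← h]; exact conjPerm_upperSL_one)

lemma conjPerm_mul_tauPerm_ne_one : conjPerm * tauPerm ≠ 1 := fun h =>
  conjPerm_ne_tauPerm (by
    rw [← mul_left_inj tauPerm, h, tauPerm_mul_self])

/-- The four-group `{1, P, R, P R}`. -/
def kleinGroup : Subgroup (Equiv.Perm PSL2C) where
  carrier := {1, conjPerm, tauPerm, conjPerm * tauPerm}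
  one_mem' := by simp
  mul_mem' := by
    have h1 := conjPerm_mul_self
    have h2 := tauPerm_mul_self
    have h3 := tauPerm_mul_conjPerm
    rintro a b (rfl | rfl | rfl | rfl) (rfl | rfl | rfl | rfl)
    · simp
    · simp
    · simp
    · simp
    · simp
    · simp [h1]
    · simp
    · simp [← mul_assoc, h1]
    · simp
    · simp [h3]
    · simp [h2]
    · simp [← mul_assoc, h3, mul_assoc conjPerm, h2]
    · simp
    · simp [mul_assoc, h3, ← mul_assoc conjPerm, h1]
    · simp [mul_assoc, h2]
    · rw [← mul_assoc, mul_assoc conjPerm tauPerm conjPerm, h3, ← mul_assoc, h1, one_mul, h2]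
      simp
  inv_mem' := by
    have h1 : conjPerm⁻¹ = conjPerm := inv_eq_of_mul_eq_one_left conjPerm_mul_self
    have h2 : tauPerm⁻¹ = tauPerm := inv_eq_of_mul_eq_one_left tauPerm_mul_self
    rintro a (rfl | rfl | rfl | rfl)
    · simp
    · simp [h1]
    · simp [h2]
    · simp [h1, h2, tauPerm_mul_conjPerm]

lemma coe_kleinGroup : (kleinGroup : Set (Equiv.Perm PSL2C)) =
    {1, conjPerm, tauPerm, conjPerm * tauPerm} := rfl

lemma mem_kleinGroup {F : Equiv.Perm PSL2C} : F ∈ kleinGroup ↔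
    F = 1 ∨ F = conjPerm ∨ F = tauPerm ∨ F = conjPerm * tauPerm := Iff.rfl

lemma mul_self_of_mem_kleinGroup {F : Equiv.Perm PSL2C} (hF : F ∈ kleinGroup) : F * F = 1 := by
  rcases mem_kleinGroup.1 hF with rfl | rfl | rfl | rfl
  · simp
  · exact conjPerm_mul_self
  · exact tauPerm_mul_self
  · rw [← mul_assoc, mul_assoc conjPerm tauPerm conjPerm, tauPerm_mul_conjPerm, ← mul_assoc,
      conjPerm_mul_self, one_mul, tauPerm_mul_self]

lemma isKleinFour_kleinGroup : IsKleinFour kleinGroup := by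
  have hcard : Nat.card kleinGroup = 4 := by
    change Nat.card (kleinGroup : Set (Equiv.Perm PSL2C)) = 4
    rw [Nat.card_coe_set_eq, coe_kleinGroup, ncard_insert_of_notMem, ncard_insert_of_notMem,
      ncard_pair]
    · exact fun h => conjPerm_ne_one (mul_eq_right.1 h.symm)
    · rintro (h | h)
      · exact conjPerm_ne_tauPerm h
      · exact tauPerm_ne_one (mul_eq_left.1 (mem_singleton_iff.1 h).symm)
    · rintro (h | h | h)
      · exact conjPerm_ne_one h.symm
      · exact tauPerm_ne_one h.symm
      · exact conjPerm_mul_tauPerm_ne_one (mem_singleton_iff.1 h).symm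
  refine ⟨hcard, ?_⟩
  have hdvd : Monoid.exponent kleinGroup ∣ 2 :=
    Monoid.exponent_dvd_of_forall_pow_eq_one fun F => by
      rw [sq]
      exact Subtype.ext (mul_self_of_mem_kleinGroup F.2)
  rcases (Nat.dvd_prime Nat.prime_two).1 hdvd with h | h
  · rw [Monoid.exp_eq_one_iff] at h
    rw [Nat.card_of_subsingleton (1 : kleinGroup)] at hcard
    norm_num at hcard
  · exact h

/-! ### `P` and `R` are isometries -/

lemma isGroupCoords_comp {F : PSL2C → PSL2C} {Φ : SL2C → SL2C}
    (hF : Function.Injective F) (hΦ : ∀ M : SL2C, F (M : PSL2C) = (Φ M : PSL2C))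
    (Λ : (Fin 2 → Fin 2 → ℂ) ≃L[ℝ] (Fin 2 → Fin 2 → ℂ))
    (hΛ : ∀ A : (Fin 6 → ℝ) → SL2C, entries (fun q => Φ (A q)) = Λ ∘ entries A)
    {U : Set (Fin 6 → ℝ)} {ψ : (Fin 6 → ℝ) → PSL2C} (h : IsGroupCoords U ψ) :
    IsGroupCoords U (fun q => F (ψ q)) where
  isOpen := h.isOpen
  injOn := fun p hp q hq e => h.injOn hp hq (hF e)
  lift := fun q₀ hq₀ => by
    obtain ⟨V, hV, hq₀V, hVU, A, hA, hA'⟩ := h.lift q₀ hq₀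
    refine ⟨V, hV, hq₀V, hVU, fun q => Φ (A q), ?_, fun q hq => ⟨?_, ?_⟩⟩
    · rw [hΛ]
      exact Λ.contDiff.comp_contDiffOn hA
    · rw [hΛ, Λ.comp_fderiv]
      exact Λ.injective.comp (hA' q hq).1
    · rw [(hA' q hq).2, hΦ]

/-- A linear automorphism `Λ` of the entries carries coordinates to coordinates, and the involution
property gives the converse. The metric is preserved because applying `F` amounts to moving the
domain by `L` and the target by `κ`. -/
lemma isGroupIsometry_of_involution {F : Equiv.Perm PSL2C} {Φ : SL2C → SL2C}
    (hF : ∀ g, F (F g) = g) (hΦ : ∀ M : SL2C, F (M : PSL2C) = (Φ M : PSL2C))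
    (Λ : (Fin 2 → Fin 2 → ℂ) ≃L[ℝ] (Fin 2 → Fin 2 → ℂ))
    (hΛ : ∀ A : (Fin 6 → ℝ) → SL2C, entries (fun q => Φ (A q)) = Λ ∘ entries A)
    (L : ℂ ≃ₗᵢ[ℝ] ℂ) (hL : ∀ z, L z ∈ Ω ↔ z ∈ Ω)
    (κ c : ℂ ≃ₗᵢ[ℝ] ℂ) (hκ : ∀ x y, κ x * (starRingEnd ℂ) (κ y) = c (x * (starRingEnd ℂ) y))
    (hc : ∀ x, (c x).re = x.re)
    (h : ∀ (M : SL2C) z, toC (orbitMap (Φ M : PSL2C) 0 (L z)) =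
      κ (toC (orbitMap (M : PSL2C) 0 z))) :
    IsGroupIsometry F := by
  refine ⟨fun U ψ => ⟨isGroupCoords_comp F.injective hΦ Λ hΛ, fun hψ => ?_⟩,
    fun U ψ hψ q hq i j => ?_⟩
  · have := isGroupCoords_comp F.injective hΦ Λ hΛ hψ
    simpa only [hF] using this
  · have hg : ∀ (g : PSL2C) z, toC (orbitMap (F g) 0 (L z)) = κ (toC (orbitMap g 0 z)) :=
      fun g z => by
        induction g using QuotientGroup.induction_on with
        | H M => exact (congrArg (fun g => toC (orbitMap g 0 (L z))) (hΦ M)).trans (h M z)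
    have := metricCoeff_symm (ψ := fun p => orbitMap (ψ p) 0)
      (ψ' := fun p => orbitMap (F (ψ p)) 0)
      (fun l hl p z => orbitMap_add hl _ _ _) LinearMap.id L hL κ c hκ hc
      (fun p z => hg (ψ p) z) (i := i) (j := j) (ε := 1) (δ := 1) (by norm_num) (by norm_num)
      (by simp) (by simp) q
    simpa using this

lemma isGroupIsometry_conjPerm : IsGroupIsometry conjPerm := by
  refine isGroupIsometry_of_involution conjPerm_conjPerm conjPerm_mk
    (ContinuousLinearEquiv.piCongrRight fun _ => ContinuousLinearEquiv.piCongrRight fun _ =>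
      Complex.conjCLE) (fun A => rfl) Complex.conjLIE (fun z => conj_mem_Ω) Complex.conjLIE
    Complex.conjLIE (fun x y => by simp) (fun x => by simp) fun M z => ?_
  have h := orbitMap_conj M 0 z
  rw [map_zero] at h
  rw [Complex.conjLIE_apply, h, toC_map (map_zero _), Complex.conjLIE_apply]

lemma isGroupIsometry_tauPerm : IsGroupIsometry tauPerm := by
  refine isGroupIsometry_of_involution tauPerm_tauPerm tauPerm_mk
    (ContinuousLinearEquiv.piCongrRight fun i => ContinuousLinearEquiv.piCongrRight fun j =>
      if i = j then ContinuousLinearEquiv.refl ℝ ℂ else ContinuousLinearEquiv.neg ℝ)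
    (fun A => ?_) mulI (fun z => I_mul_mem_Ω) (LinearIsometryEquiv.neg ℝ)
    (LinearIsometryEquiv.refl ℝ ℂ) (fun x y => by simp) (fun x => by simp) fun M z => ?_
  · ext q i j
    simp only [entries, tauConjSL_val]
    fin_cases i <;> fin_cases j <;> simp [entries]
  · have h := orbitMap_I_mul M 0 z
    rw [mul_zero] at h
    rw [mulI_apply, h, toC_map neg_zero]
    rfl

lemma isGroupIsometry_one : IsGroupIsometry 1 :=
  ⟨fun _ _ => Iff.rfl, fun _ _ _ _ _ _ _ => rfl⟩

lemma IsGroupIsometry.mul {F G : Equiv.Perm PSL2C} (hF : IsGroupIsometry F)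
    (hG : IsGroupIsometry G) : IsGroupIsometry (F * G) :=
  ⟨fun U ψ => (hG.1 U ψ).trans (hF.1 U _), fun U ψ hψ q hq i j =>
    (hF.2 U _ ((hG.1 U ψ).1 hψ) q hq i j).trans (hG.2 U ψ hψ q hq i j)⟩

lemma isGroupIsometry_of_mem_kleinGroup {F : Equiv.Perm PSL2C} (hF : F ∈ kleinGroup) :
    IsGroupIsometry F := by
  rcases mem_kleinGroup.1 hF with rfl | rfl | rfl | rfl
  · exact isGroupIsometry_one
  · exact isGroupIsometry_conjPerm
  · exact isGroupIsometry_tauPerm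
  · exact isGroupIsometry_conjPerm.mul isGroupIsometry_tauPerm

/-! ### The fixed point set -/

lemma forall_mem_kleinGroup_iff {g : PSL2C} :
    (∀ F ∈ kleinGroup, F g = g) ↔ conjPerm g = g ∧ tauPerm g = g := by
  constructor
  · exact fun h => ⟨h _ (mem_kleinGroup.2 (by simp)), h _ (mem_kleinGroup.2 (by simp))⟩
  · rintro ⟨h1, h2⟩ F hF
    rcases mem_kleinGroup.1 hF with rfl | rfl | rfl | rfl
    · rfl
    · exact h1
    · exact h2
    · rw [Equiv.Perm.mul_apply, h2, h1]

/-- A continuous function on `PSL(2, ℂ)` which separates the components of the fixed point set. -/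
def separator : PSL2C → ℝ :=
  Quotient.lift (fun M : SL2C => (M.1 0 0 ^ 2).re / (‖M.1 0 0‖ ^ 2 + ‖M.1 0 1‖ ^ 2))
    fun M N hMN => by
      rcases psl_eq_iff.1 (Quotient.sound hMN : (M : PSL2C) = N) with h | h <;> simp [h]

lemma separator_mk (M : SL2C) :
    separator (M : PSL2C) = (M.1 0 0 ^ 2).re / (‖M.1 0 0‖ ^ 2 + ‖M.1 0 1‖ ^ 2) := rfl

lemma continuous_separator : Continuous separator := by
  refine Continuous.quotient_lift ?_ _
  have h : ∀ i j, Continuous fun M : SL2C => M.1 i j := fun i j =>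
    (continuous_subtype_val (p := fun A : Matrix (Fin 2) (Fin 2) ℂ => A.det = 1)).matrix_elem i j
  have h0 := h 0 0
  have h1 := h 0 1
  refine Continuous.div (by fun_prop) (by fun_prop) fun M hM => ?_
  have e0 : ‖M.1 0 0‖ = 0 := by nlinarith [sq_nonneg ‖M.1 0 0‖, sq_nonneg ‖M.1 0 1‖]
  have e1 : ‖M.1 0 1‖ = 0 := by nlinarith [sq_nonneg ‖M.1 0 0‖, sq_nonneg ‖M.1 0 1‖]
  have hd := det_SL M
  rw [norm_eq_zero.1 e0, norm_eq_zero.1 e1] at hd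
  simp at hd

/-- Being fixed in `PSL(2, ℂ)` means being fixed up to sign. The sign for `R` makes the matrix
diagonal or antidiagonal (value `0`); in the diagonal case the sign for `P` makes the entries real
(value `1`) or imaginary (value `-1`). -/
lemma fixed_cases {M : SL2C} (h1 : conjPerm (M : PSL2C) = M) (h2 : tauPerm (M : PSL2C) = M) :
    separator M = 0 ∨ separator M = -1 ∨
      (separator M = 1 ∧ ∃ r : ℝ, M.1 = !![(r : ℂ), 0; 0, 1 / (r : ℂ)]) := by
  rw [conjPerm_mk, eq_comm, psl_eq_iff] at h1
  rw [tauPerm_mk, eq_comm, psl_eq_iff, tauConjSL_val] at h2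
  have hd := det_SL M
  rw [separator_mk]
  rcases h2 with h2 | h2
  · have e01 := congrFun (congrFun h2 0) 1
    have e10 := congrFun (congrFun h2 1) 0
    simp [neg_eq_self] at e01 e10
    rw [e01, e10, mul_zero, sub_zero] at hd
    have hne : M.1 0 0 ≠ 0 := left_ne_zero_of_mul_eq_one hd
    rw [e01, norm_zero]
    rcases h1 with h1 | h1
    · have e00 : (starRingEnd ℂ) (M.1 0 0) = M.1 0 0 := congrFun (congrFun h1 0) 0
      have hr := (Complex.conj_eq_iff_re.1 e00).symm
      refine Or.inr (Or.inr ⟨?_, (M.1 0 0).re, ?_⟩)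
      · have him := Complex.conj_eq_iff_im.1 e00
        have hre : (M.1 0 0).re ≠ 0 := fun h => hne (Complex.ext h him)
        rw [Complex.sq_norm, Complex.normSq_apply, sq, Complex.mul_re, him]
        field_simp
        ring
      · rw [← hr]
        ext i j
        fin_cases i <;> fin_cases j
        · rfl
        · exact e01
        · exact e10
        · exact eq_one_div_of_mul_eq_one_right hd
    · have e00 : (starRingEnd ℂ) (M.1 0 0) = -M.1 0 0 := congrFun (congrFun h1 0) 0
      have hr : (M.1 0 0).re = 0 := by
        have := congrArg Complex.re e00
        simp at this
        linarith
      refine Or.inr (Or.inl ?_)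
      have him : (M.1 0 0).im ≠ 0 := fun h => hne (Complex.ext hr h)
      rw [Complex.sq_norm, Complex.normSq_apply, sq, Complex.mul_re, hr]
      field_simp
      ring
  · left
    have e00 := congrFun (congrFun h2 0) 0
    simp [self_eq_neg] at e00
    simp [e00]

/-- The curve `diag(eˢ, e⁻ˢ)`. -/
def diagExp (s : ℝ) : SL2C :=
  ⟨!![((Real.exp s : ℝ) : ℂ), 0; 0, ((Real.exp (-s) : ℝ) : ℂ)], by
    rw [Matrix.det_fin_two_of, ← Complex.ofReal_mul, ← Real.exp_add]
    simp⟩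

lemma continuous_diagExp : Continuous diagExp := by
  refine Continuous.subtype_mk (continuous_matrix fun i j => ?_) _
  fin_cases i <;> fin_cases j <;> simp <;> fun_prop

lemma sigmaHatV_eq_range : sigmaHatV = range fun s => (diagExp s : PSL2C) := by
  have he := e₁_pos
  ext g
  constructor
  · rintro ⟨α, hα, M, hM, rfl⟩
    refine ⟨Real.log √(α * e₁), ?_⟩
    have hpos : 0 < √(α * e₁) := Real.sqrt_pos.2 (by positivity)
    refine congrArg (fun M : SL2C => (M : PSL2C)) (Subtype.ext ?_)
    rw [hM]
    simp [diagExp, Real.exp_neg, Real.exp_log hpos]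
  · rintro ⟨s, rfl⟩
    refine ⟨Real.exp s ^ 2 / e₁, by positivity, diagExp s, ?_, rfl⟩
    have : √(Real.exp s ^ 2 / e₁ * e₁) = Real.exp s := by
      rw [div_mul_cancel₀ _ he.ne', Real.sqrt_sq (Real.exp_pos s).le]
    rw [this]
    simp [diagExp, Real.exp_neg]

lemma conjSL_diagExp (s : ℝ) : conjSL (diagExp s) = diagExp s := by
  apply Subtype.ext
  ext i j
  rw [conjSL_apply]
  fin_cases i <;> fin_cases j <;> simp [diagExp, -Complex.ofReal_exp]

lemma tauConjSL_diagExp (s : ℝ) : tauConjSL (diagExp s) = diagExp s := by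
  apply Subtype.ext
  rw [tauConjSL_val]
  ext i j
  fin_cases i <;> fin_cases j <;> simp [diagExp]

lemma diagExp_zero : diagExp 0 = 1 := by
  apply Subtype.ext
  ext i j
  fin_cases i <;> fin_cases j <;> simp [diagExp]

lemma mem_sigmaHatV_of_diag {M : SL2C} {r : ℝ} (h : M.1 = !![(r : ℂ), 0; 0, 1 / (r : ℂ)]) :
    (M : PSL2C) ∈ sigmaHatV := by
  have hd := det_SL M
  have hr : r ≠ 0 := by
    rintro rfl
    simp [h] at hd
  rw [sigmaHatV_eq_range]
  refine ⟨Real.log |r|, psl_eq_iff.2 ?_⟩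
  have habs : 0 < |r| := abs_pos.2 hr
  -- A negative `r` gives the same class as `|r|`, through the sign ambiguity.
  rcases abs_choice r with h' | h'
  · left
    rw [h]
    simp only [diagExp, Real.exp_neg, Real.exp_log habs]
    rw [h']
    simp
  · right
    rw [h]
    simp only [diagExp, Real.exp_neg, Real.exp_log habs]
    rw [h']
    simp

/-- `separator` is continuous with finitely many values on the fixed set, hence constant on the
component, where it equals its value `1` at the identity. The points with this value form the
connected curve. -/
lemma connectedComponentIn_fixed :
    connectedComponentIn {g : PSL2C | ∀ F ∈ kleinGroup, F g = g} 1 = sigmaHatV := by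
  have h1fix : (1 : PSL2C) ∈ {g : PSL2C | ∀ F ∈ kleinGroup, F g = g} := by
    refine forall_mem_kleinGroup_iff.2 ?_
    have : (1 : PSL2C) = (diagExp 0 : PSL2C) := by rw [diagExp_zero]; rfl
    rw [this, conjPerm_mk, tauPerm_mk, conjSL_diagExp, tauConjSL_diagExp]
    exact ⟨rfl, rfl⟩
  refine Subset.antisymm (fun g hg => ?_) ?_
  · have hconst := (isPreconnected_connectedComponentIn (x := (1 : PSL2C))
      (F := {g : PSL2C | ∀ F ∈ kleinGroup, F g = g})).constant_of_mapsTo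
      (T := ({0, -1, 1} : Set ℝ)) (Set.toFinite _).isDiscrete continuous_separator.continuousOn (fun g hg => by
        have hfix := forall_mem_kleinGroup_iff.1 (connectedComponentIn_subset _ _ hg)
        induction g using QuotientGroup.induction_on with
        | H M =>
          rcases fixed_cases hfix.1 hfix.2 with h | h | ⟨h, -⟩
          · exact Or.inl h
          · exact Or.inr (Or.inl h)
          · exact Or.inr (Or.inr h)) hg (mem_connectedComponentIn h1fix)
    have hone : separator (1 : PSL2C) = 1 := by
      have := separator_mk 1
      simpa using this
    rw [hone] at hconst
    have hfix := forall_mem_kleinGroup_iff.1 (connectedComponentIn_subset _ _ hg)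
    induction g using QuotientGroup.induction_on with
    | H M =>
      rcases fixed_cases hfix.1 hfix.2 with h | h | ⟨h, r, hr⟩
      · rw [h] at hconst; norm_num at hconst
      · rw [h] at hconst; norm_num at hconst
      · exact mem_sigmaHatV_of_diag hr
  · refine IsPreconnected.subset_connectedComponentIn ?_ ?_ ?_
    · rw [sigmaHatV_eq_range]
      exact isPreconnected_range (QuotientGroup.continuous_mk.comp continuous_diagExp)
    · rw [sigmaHatV_eq_range]
      exact ⟨0, by simp only [diagExp_zero]; rfl⟩
    · rw [sigmaHatV_eq_range]
      rintro _ ⟨s, rfl⟩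
      refine forall_mem_kleinGroup_iff.2 ?_
      rw [conjPerm_mk, tauPerm_mk, conjSL_diagExp, tauConjSL_diagExp]
      exact ⟨rfl, rfl⟩

/-! ### The image of the lift of `Σ_V` -/

lemma mobius_diag {M : SL2C} {r : ℝ} (hr : r ≠ 0)
    (h : M.1 = !![(r : ℂ), 0; 0, ((1 / r : ℝ) : ℂ)]) (c z : ℂ) :
    mobius (M : PSL2C) (scaledWp c z) = scaledWp (r ^ 2 * c) z := by
  have hr' : (r : ℂ) ≠ 0 := by exact_mod_cast hr
  by_cases hz : z ∈ Ω
  · simp [scaledWp, hz, mobius_infty, h, homog]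
  · simp only [scaledWp, hz, if_false, mobius_coe, h, homog]
    simp only [Matrix.of_apply, Matrix.cons_val', Matrix.cons_val_zero, Matrix.cons_val_one,
      Matrix.cons_val_fin_one, zero_mul, zero_add, add_zero, Complex.ofReal_eq_zero, one_div,
      inv_eq_zero, hr, if_false, Complex.ofReal_inv, div_inv_eq_mul]
    congr 1
    ring

lemma orbitMap_diag {M : SL2C} {α : ℝ} (hα : 0 < α)
    (hM : M.1 = !![((√(α * e₁) : ℝ) : ℂ), 0; 0, ((1 / √(α * e₁) : ℝ) : ℂ)]) :
    orbitMap (M : PSL2C) 0 = scaledWp α := by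
  have he := e₁_pos
  ext1 z
  rw [orbitMap, sub_zero, mobius_diag (Real.sqrt_pos.2 (by positivity)).ne' hM]
  congr 1
  rw [← Complex.ofReal_pow, Real.sq_sqrt (by positivity)]
  have : (e₁ : ℂ) ≠ 0 := by exact_mod_cast he.ne'
  push_cast
  field_simp

lemma image_sigmaHatV : (fun g => orbitMap g 0) '' sigmaHatV = sigmaV := by
  have he := e₁_pos
  ext W
  constructor
  · rintro ⟨g, ⟨α, hα, M, hM, rfl⟩, rfl⟩
    exact ⟨α, hα, orbitMap_diag hα hM⟩
  · rintro ⟨α, hα, rfl⟩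
    have hpos : 0 < √(α * e₁) := Real.sqrt_pos.2 (by positivity)
    let M : SL2C := ⟨!![((√(α * e₁) : ℝ) : ℂ), 0; 0, ((1 / √(α * e₁) : ℝ) : ℂ)], by
      rw [Matrix.det_fin_two_of, ← Complex.ofReal_mul, mul_one_div_cancel hpos.ne']
      simp⟩
    exact ⟨M, ⟨α, hα, M, rfl, rfl⟩, orbitMap_diag hα rfl⟩

/-! ### The orbit of `℘ / e₁` consists of holomorphic maps of degree two -/

lemma scaledWp_eq_homog {z : ℂ} (hz : z ∉ Ω) :
    scaledWp (1 / (e₁ : ℂ)) z = homog (1 / (e₁ : ℂ) * wp z) 1 := by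
  rw [scaledWp, if_neg hz, homog_one]

/-- The second homogeneous coordinate is `e₁ / ℘`, rewritten by the product formula so that it is
analytic at the poles. -/
lemma scaledWp_eq_homog' {z : ℂ} (hz : z + ζ ∉ Ω) :
    scaledWp (1 / (e₁ : ℂ)) z = homog 1 (-wp (z + ζ) / e₁) := by
  have he : (e₁ : ℂ) ≠ 0 := by exact_mod_cast e₁_ne_zero
  by_cases h : z ∈ Ω
  · rw [scaledWp, if_pos h, wp_add_ζ_of_mem h, neg_zero, zero_div, homog_zero]
  · have h1 := inv_wp h hz
    have h2 := wp_ne_zero h hz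
    rw [scaledWp_eq_homog h, ← homog_mul (c := e₁ * (wp z)⁻¹) (mul_ne_zero he (inv_ne_zero h2)),
      h1]
    congr 1
    · rw [← h1]
      field_simp
    · field_simp

lemma exists_analyticAt_of_homog {W : ℂ → OnePoint ℂ} {u v : ℂ → ℂ} {z₀ : ℂ}
    (hu : AnalyticAt ℂ u z₀) (hv : AnalyticAt ℂ v z₀) (h0 : u z₀ ≠ 0 ∨ v z₀ ≠ 0)
    (hW : ∀ᶠ z in 𝓝 z₀, W z = homog (u z) (v z)) :
    ∃ f : ℂ → ℂ, AnalyticAt ℂ f z₀ ∧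
      ((∀ᶠ z in 𝓝 z₀, W z = (f z : OnePoint ℂ)) ∨ (∀ᶠ z in 𝓝 z₀, W z = invCoord (f z))) := by
  by_cases h : v z₀ = 0
  · have h1 : u z₀ ≠ 0 := h0.resolve_right (not_not.2 h)
    refine ⟨fun z => v z / u z, hv.div hu h1, Or.inr ?_⟩
    filter_upwards [hW, hu.continuousAt.eventually_ne h1] with z hz hne
    rw [hz, ← homog_one_left, ← homog_mul hne 1 (v z / u z), mul_one, mul_div_cancel₀ _ hne]
  · refine ⟨fun z => u z / v z, hu.div hv h, Or.inl ?_⟩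
    filter_upwards [hW, hv.continuousAt.eventually_ne h] with z hz hne
    rw [hz, homog, if_neg hne]

lemma isHolomorphicToSphere_orbitMap (M : SL2C) (s : ℂ) :
    IsHolomorphicToSphere (orbitMap (M : PSL2C) s) := fun z₀ => by
  have hsub : ContinuousAt (fun z : ℂ => z - s) z₀ := by fun_prop
  by_cases h : z₀ - s ∈ Ω
  · have ha : AnalyticAt ℂ (fun z => -wp (z - s + ζ) / e₁) z₀ :=
      ((analyticAt_wp_add_ζ h).fun_comp (f := fun z => z - s) (by fun_prop)).neg.div_const
    refine exists_analyticAt_of_homog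
      (u := fun z => M.1 0 0 * 1 + M.1 0 1 * (-wp (z - s + ζ) / e₁))
      (v := fun z => M.1 1 0 * 1 + M.1 1 1 * (-wp (z - s + ζ) / e₁))
      (by fun_prop) (by fun_prop) (homog_coords_ne_zero M (Or.inl one_ne_zero)) ?_
    filter_upwards [hsub.eventually (eventually_add_ζ_notMem h)] with z hz
    rw [orbitMap, scaledWp_eq_homog' hz, mobius_homog M (Or.inl one_ne_zero)]
  · have ha : AnalyticAt ℂ (fun z => 1 / (e₁ : ℂ) * wp (z - s)) z₀ :=
      analyticAt_const.mul ((analyticAt_wp h).fun_comp (f := fun z => z - s) (by fun_prop))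
    refine exists_analyticAt_of_homog
      (u := fun z => M.1 0 0 * (1 / (e₁ : ℂ) * wp (z - s)) + M.1 0 1 * 1)
      (v := fun z => M.1 1 0 * (1 / (e₁ : ℂ) * wp (z - s)) + M.1 1 1 * 1)
      (by fun_prop) (by fun_prop) (homog_coords_ne_zero M (Or.inr one_ne_zero)) ?_
    filter_upwards [hsub.eventually (isClosed_Ω.isOpen_compl.mem_nhds h)] with z hz
    rw [orbitMap, scaledWp_eq_homog hz, mobius_homog M (Or.inr one_ne_zero)]

/-- The parities of the coordinates of `2u` identify `u` modulo `Ω` with one of the three nonzero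
half-periods, the finite ramification points. -/
lemma wp_of_two_mul_mem {u : ℂ} (hu : u ∉ Ω) (h : u + u ∈ Ω) :
    wp u = e₁ ∨ wp u = -e₁ ∨ wp u = 0 := by
  obtain ⟨m, n, hmn⟩ := mem_Ω.1 h
  have key : ∀ w : ℂ, (∃ k l : ℤ, u = (k + l * Complex.I) + w) → wp u = wp w := by
    rintro w ⟨k, l, hkl⟩
    rw [hkl, add_comm, wp_add (mem_Ω.2 ⟨k, l, rfl⟩)]
  rcases Int.even_or_odd' m with ⟨k, rfl | rfl⟩ <;> rcases Int.even_or_odd' n with ⟨l, rfl | rfl⟩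
  · refine absurd (mem_Ω.2 ⟨k, l, ?_⟩) hu
    push_cast at hmn
    linear_combination hmn / 2
  · refine Or.inr (Or.inl ?_)
    rw [← wp_I_half]
    refine key _ ⟨k, l, ?_⟩
    push_cast at hmn
    linear_combination hmn / 2
  · left
    rw [← wp_half]
    refine key _ ⟨k, l, ?_⟩
    push_cast at hmn
    linear_combination hmn / 2
  · refine Or.inr (Or.inr ?_)
    rw [← wp_ζ]
    refine key _ ⟨k, l, ?_⟩
    push_cast at hmn
    rw [ζ]
    linear_combination hmn / 2

lemma mobius_injective (g : PSL2C) : Function.Injective (mobius g) := fun x y h => by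
  have := congrArg (mobius g⁻¹) h
  rwa [← mobius_mul, ← mobius_mul, inv_mul_cancel, mobius_one, mobius_one] at this

lemma scaledWp_eq_coe_iff {u z w : ℂ} (hu : u ∉ Ω) (hw : wp u = e₁ * w) :
    scaledWp (1 / (e₁ : ℂ)) z = (w : OnePoint ℂ) ↔ z - u ∈ Ω ∨ z + u ∈ Ω := by
  have he : (e₁ : ℂ) ≠ 0 := by exact_mod_cast e₁_ne_zero
  by_cases hz : z ∈ Ω
  · have h1 : z - u ∉ Ω := fun h => hu (by simpa using Submodule.sub_mem _ hz h)
    have h2 : z + u ∉ Ω := fun h => hu ((Submodule.add_mem_iff_right _ hz).1 h)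
    simp [scaledWp, hz, h1, h2]
  · rw [scaledWp, if_neg hz, OnePoint.coe_eq_coe, ← wp_eq_wp_iff hz hu, hw]
    constructor
    · rintro rfl
      field_simp
    · intro h
      rw [h]
      field_simp

/-- The excluded values are the images of the four branch values of `℘ / e₁`. Over any other value
the fibre is `s ± u` modulo `Ω`, and these two points are distinct because `2u` is not a period. -/
lemma hasDegree_orbitMap (g : PSL2C) (s : ℂ) : HasDegree (orbitMap g s) 2 := by
  have he : (e₁ : ℂ) ≠ 0 := by exact_mod_cast e₁_ne_zero
  refine ⟨mobius g '' {OnePoint.infty, ((1 : ℂ) : OnePoint ℂ), ((-1 : ℂ) : OnePoint ℂ),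
    ((0 : ℂ) : OnePoint ℂ)}, (Set.toFinite _).image _, fun c hc => ?_⟩
  obtain ⟨x, rfl⟩ : ∃ x, mobius g x = c :=
    ⟨mobius g⁻¹ c, by rw [← mobius_mul, mul_inv_cancel, mobius_one]⟩
  rw [(mobius_injective g).mem_set_image] at hc
  cases x with
  | infty => simp at hc
  | coe w =>
    obtain ⟨u, hu, hw⟩ := exists_wp_eq (e₁ * w)
    have huu : u + u ∉ Ω := fun h => by
      apply hc
      rcases wp_of_two_mul_mem hu h with h' | h' | h'
      · have : w = 1 := mul_left_cancel₀ he (by rw [← hw, h', mul_one])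
        simp [this]
      · have : w = -1 := mul_left_cancel₀ he (by rw [← hw, h', mul_neg_one])
        simp [this]
      · have : w = 0 := mul_left_cancel₀ he (by rw [← hw, h', mul_zero])
        simp [this]
    obtain ⟨l₁, ⟨hl₁, hs₁⟩, hu₁⟩ := existsUnique_add_mem_unitSquare (s + u)
    obtain ⟨l₂, ⟨hl₂, hs₂⟩, hu₂⟩ := existsUnique_add_mem_unitSquare (s - u)
    have hset : {z ∈ unitSquare | orbitMap g s z = mobius g w} =
        {l₁ + (s + u), l₂ + (s - u)} := by
      ext z
      simp only [mem_ofPred_eq, mem_insert_iff, mem_singleton_iff, orbitMap,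
        (mobius_injective g).eq_iff, scaledWp_eq_coe_iff hu hw]
      constructor
      · rintro ⟨hz, h | h⟩
        · left
          rw [← hu₁ _ ⟨h, by simpa using hz⟩]
          ring
        · right
          rw [← hu₂ (z - s + u) ⟨h, by simpa using hz⟩]
          ring
      · rintro (rfl | rfl)
        · exact ⟨hs₁, Or.inl (by convert hl₁ using 1; ring)⟩
        · exact ⟨hs₂, Or.inr (by convert hl₂ using 1; ring)⟩
    rw [hset]
    refine ⟨Set.toFinite _, ncard_pair fun h => huu ?_⟩
    have : u + u = l₂ - l₁ := by linear_combination h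
    rw [this]
    exact Submodule.sub_mem _ hl₂ hl₁

lemma orbitMap_mem_M₂ (M : SL2C) (s : ℂ) : orbitMap (M : PSL2C) s ∈ M₂ :=
  ⟨fun _ hl z => orbitMap_add hl _ s z, isHolomorphicToSphere_orbitMap M s,
    hasDegree_orbitMap _ s⟩

/-! ### Injectivity of the orbit map -/

lemma exists_scaledWp_eq (x : OnePoint ℂ) : ∃ z, scaledWp (1 / (e₁ : ℂ)) z = x := by
  have he : (e₁ : ℂ) ≠ 0 := by exact_mod_cast e₁_ne_zero
  cases x with
  | infty => exact ⟨0, by simp [scaledWp]⟩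
  | coe w =>
    obtain ⟨z, hz, h⟩ := exists_wp_eq (e₁ * w)
    refine ⟨z, ?_⟩
    rw [scaledWp, if_neg hz, h]
    field_simp

/-- A field is symmetric about its centre `s`, so the common field is symmetric about both `s` and
`s'` and takes equal values at `s` and `2s' - s`; hence `2(s' - s)` is a pole. The factor `2` is
unavoidable: translation by `ζ`, for example, acts on `℘` as a Möbius map. -/
lemma two_mul_sub_mem_of_orbitMap_eq {g g' : PSL2C} {s s' : ℂ}
    (h : orbitMap g s = orbitMap g' s') : 2 * (s' - s) ∈ Ω := by
  have key : ∀ (g : PSL2C) (s z : ℂ), orbitMap g s (2 * s - z) = orbitMap g s z :=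
    fun g s z => by
      rw [orbitMap, orbitMap, ← scaledWp_neg]
      congr 2
      ring
  have h1 : orbitMap g s (2 * s' - s) = orbitMap g s s := by
    rw [h, key, ← h]
  have h2 := mobius_injective g h1
  rw [sub_self, show scaledWp (1 / (e₁ : ℂ)) 0 = OnePoint.infty by simp [scaledWp]] at h2
  by_contra hn
  rw [show 2 * s' - s - s = 2 * (s' - s) by ring, scaledWp, if_neg hn] at h2
  exact OnePoint.coe_ne_infty _ h2

/-- `℘ / e₁` is onto the sphere and `PSL(2, ℂ)` acts faithfully on it. -/
lemma eq_of_orbitMap_eq {g g' : PSL2C} {s : ℂ} (h : orbitMap g s = orbitMap g' s) : g = g' := by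
  refine eq_of_smul_eq_smul (α := Projectivization ℂ (Fin 2 → ℂ)) fun p => ?_
  obtain ⟨x, rfl⟩ := (OnePoint.equivProjectivization ℂ).surjective p
  obtain ⟨z, rfl⟩ := exists_scaledWp_eq x
  have h1 := congrFun h (z + s)
  rw [orbitMap, orbitMap, add_sub_cancel_right] at h1
  exact (OnePoint.equivProjectivization ℂ).symm.injective h1

/-! ### A coordinate system around `Σ_V` adapted to the symmetries -/

/-- The scale `√(α e₁)` at arc length `t`. -/
def scale (t : ℝ) : ℝ := √(arcParam t * e₁)

lemma scale_pos {t : ℝ} (ht : t ∈ Ioo 0 totalLength) : 0 < scale t :=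
  Real.sqrt_pos.2 (mul_pos (arcParam_spec ht).1 e₁_pos)

lemma injOn_scale : InjOn scale (Ioo 0 totalLength) := fun s hs t ht h => by
  have h1 := (arcParam_spec hs).1
  have h2 := (arcParam_spec ht).1
  have h3 := (Real.sqrt_inj (mul_pos h1 e₁_pos).le (mul_pos h2 e₁_pos).le).1 h
  exact strictMonoOn_arcParam.injOn hs ht (mul_right_cancel₀ e₁_ne_zero h3)

lemma contDiffOn_scale : ContDiffOn ℝ ∞ scale (Ioo 0 totalLength) :=
  (contDiffOn_arcParam.mul contDiffOn_const).sqrt fun _ ht =>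
    (mul_pos (arcParam_spec ht).1 e₁_pos).ne'

lemma exists_hasDerivAt_scale {t : ℝ} (ht : t ∈ Ioo 0 totalLength) :
    ∃ c ≠ 0, HasDerivAt scale c t := by
  have hpos := (arcParam_spec ht).1
  have hf := f_pos hpos
  have he := e₁_pos
  refine ⟨_, ?_, ((hasDerivAt_arcParam ht).mul_const e₁).sqrt (mul_pos hpos he).ne'⟩
  positivity

/-- The upper left entry of the matrix with given coordinates. -/
def chartEntry (q : Fin 8 → ℝ) : ℂ := (scale (q 0) : ℂ) + q 1 * Complex.I

open Classical in
/-- The matrix with given coordinates. -/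
def chartMatrix (q : Fin 8 → ℝ) : SL2C :=
  -- The lower right entry is solved from the determinant. The default `1` is fixed by both
  -- involutions, so the symmetry relations hold for every `q`, not only on the domain.
  if h : chartEntry q = 0 then 1 else
    ⟨!![chartEntry q, q 2 + q 3 * Complex.I; q 4 + q 5 * Complex.I,
      (1 + (q 2 + q 3 * Complex.I) * (q 4 + q 5 * Complex.I)) / chartEntry q], by
      rw [Matrix.det_fin_two_of, mul_div_cancel₀ _ h]
      ring⟩

/-- The translation with given coordinates. -/
def chartShift (q : Fin 8 → ℝ) : ℂ := q 6 + q 7 * Complex.I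

/-- The adapted coordinates. -/
def chart (q : Fin 8 → ℝ) : ℂ → OnePoint ℂ := orbitMap (chartMatrix q : PSL2C) (chartShift q)

/-- The domain of the adapted coordinates. -/
def chartDomain : Set (Fin 8 → ℝ) :=
  {q | q 0 ∈ Ioo 0 totalLength ∧ q 6 ∈ Ioo (-(1 / 4)) (1 / 4) ∧ q 7 ∈ Ioo (-(1 / 4)) (1 / 4)}

lemma isOpen_chartDomain : IsOpen chartDomain :=
  (isOpen_Ioo.preimage (continuous_apply 0)).inter
    ((isOpen_Ioo.preimage (continuous_apply 6)).inter (isOpen_Ioo.preimage (continuous_apply 7)))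

lemma chartEntry_re (q : Fin 8 → ℝ) : (chartEntry q).re = scale (q 0) := by
  simp [chartEntry]

lemma chartEntry_im (q : Fin 8 → ℝ) : (chartEntry q).im = q 1 := by
  simp [chartEntry]

lemma chartEntry_ne_zero {q : Fin 8 → ℝ} (hq : q ∈ chartDomain) : chartEntry q ≠ 0 := fun h => by
  have := scale_pos hq.1
  rw [← chartEntry_re, h, Complex.zero_re] at this
  exact lt_irrefl _ this

lemma chartMatrix_val {q : Fin 8 → ℝ} (h : chartEntry q ≠ 0) : (chartMatrix q).1 =
    !![chartEntry q, q 2 + q 3 * Complex.I; q 4 + q 5 * Complex.I,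
      (1 + (q 2 + q 3 * Complex.I) * (q 4 + q 5 * Complex.I)) / chartEntry q] := by
  exact congrArg Subtype.val (dif_neg h)

lemma contDiffOn_chartEntry : ContDiffOn ℝ ∞ chartEntry chartDomain := by
  have h1 : ContDiffOn ℝ ∞ (fun q : Fin 8 → ℝ => scale (q 0)) chartDomain :=
    contDiffOn_scale.comp (contDiff_apply ℝ ℝ (0 : Fin 8)).contDiffOn fun q hq => hq.1
  have h2 : ContDiffOn ℝ ∞ (fun q : Fin 8 → ℝ => (scale (q 0) : ℂ)) chartDomain :=
    Complex.ofRealCLM.contDiff.comp_contDiffOn h1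
  have h3 : ∀ i : Fin 8, ContDiffOn ℝ ∞ (fun q : Fin 8 → ℝ => (q i : ℂ)) chartDomain := fun i =>
    Complex.ofRealCLM.contDiff.comp_contDiffOn (contDiff_apply ℝ ℝ i).contDiffOn
  exact h2.add ((h3 1).mul contDiffOn_const)

lemma contDiffOn_chart_lift :
    ContDiffOn ℝ ∞ (fun q => (entries chartMatrix q, chartShift q)) chartDomain := by
  have h3 : ∀ i : Fin 8, ContDiffOn ℝ ∞ (fun q : Fin 8 → ℝ => (q i : ℂ)) chartDomain := fun i =>
    Complex.ofRealCLM.contDiff.comp_contDiffOn (contDiff_apply ℝ ℝ i).contDiffOn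
  have h4 : ∀ i j : Fin 8, ContDiffOn ℝ ∞ (fun q : Fin 8 → ℝ => (q i : ℂ) + q j * Complex.I)
      chartDomain := fun i j => (h3 i).add ((h3 j).mul contDiffOn_const)
  refine ContDiffOn.prodMk ?_ (h4 6 7)
  have he : ∀ q ∈ chartDomain, ∀ i j, entries chartMatrix q i j =
      !![chartEntry q, q 2 + q 3 * Complex.I; q 4 + q 5 * Complex.I,
      (1 + (q 2 + q 3 * Complex.I) * (q 4 + q 5 * Complex.I)) / chartEntry q] i j :=
    fun q hq i j => by rw [entries, chartMatrix_val (chartEntry_ne_zero hq)]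
  refine contDiffOn_pi.2 fun i => contDiffOn_pi.2 fun j => ?_
  refine ContDiffOn.congr ?_ fun q hq => he q hq i j
  fin_cases i <;> fin_cases j
  · exact contDiffOn_chartEntry
  · exact h4 2 3
  · exact h4 4 5
  · exact (contDiffOn_const.add ((h4 2 3).mul (h4 4 5))).mul
      (contDiffOn_chartEntry.inv fun q hq => chartEntry_ne_zero hq)

/-- Linear functionals of the lift recover each coordinate, except that coordinate `0` appears
through `scale`, whose derivative is nonzero. A vector killed by the derivative therefore has zero
components. -/
lemma injective_fderiv_chart_lift {q : Fin 8 → ℝ} (hq : q ∈ chartDomain) :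
    Function.Injective (fderiv ℝ (fun q => (entries chartMatrix q, chartShift q)) q) := by
  have hd : DifferentiableAt ℝ (fun q => (entries chartMatrix q, chartShift q)) q :=
    (contDiffOn_chart_lift.contDiffAt (isOpen_chartDomain.mem_nhds hq)).differentiableAt (by simp)
  rw [injective_iff_map_eq_zero]
  intro v hv
  have key : ∀ (l : (Fin 2 → Fin 2 → ℂ) × ℂ →L[ℝ] ℝ) (g : (Fin 8 → ℝ) → ℝ)
      (g' : (Fin 8 → ℝ) →L[ℝ] ℝ), HasFDerivAt g g' q →
      (∀ p ∈ chartDomain, l (entries chartMatrix p, chartShift p) = g p) → g' v = 0 :=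
    fun l g g' hg h => by
      have h1 := l.hasFDerivAt.comp q hd.hasFDerivAt
      have h2 : HasFDerivAt (l ∘ fun q => (entries chartMatrix q, chartShift q)) g' q := by
        refine hg.congr_of_eventuallyEq ?_
        filter_upwards [isOpen_chartDomain.mem_nhds hq] with p hp
        exact h p hp
      rw [← h1.unique h2, ContinuousLinearMap.comp_apply, hv, map_zero]
  let E (i j : Fin 2) : (Fin 2 → Fin 2 → ℂ) × ℂ →L[ℝ] ℂ :=
    (ContinuousLinearMap.proj j).comp ((ContinuousLinearMap.proj (R := ℝ)
      (φ := fun _ : Fin 2 => Fin 2 → ℂ) i).comp (ContinuousLinearMap.fst ℝ _ _))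
  let T : (Fin 2 → Fin 2 → ℂ) × ℂ →L[ℝ] ℂ := ContinuousLinearMap.snd ℝ _ _
  have hE : ∀ i j, ∀ p ∈ chartDomain, E i j (entries chartMatrix p, chartShift p) =
      !![chartEntry p, p 2 + p 3 * Complex.I; p 4 + p 5 * Complex.I,
      (1 + (p 2 + p 3 * Complex.I) * (p 4 + p 5 * Complex.I)) / chartEntry p] i j :=
    fun i j p hp => by
      change (chartMatrix p).1 i j = _
      rw [chartMatrix_val (chartEntry_ne_zero hp)]
  have hproj : ∀ (l : (Fin 2 → Fin 2 → ℂ) × ℂ →L[ℝ] ℝ) (i : Fin 8),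
      (∀ p ∈ chartDomain, l (entries chartMatrix p, chartShift p) = p i) → v i = 0 :=
    fun l i h => key l (fun p => p i) (ContinuousLinearMap.proj i) (hasFDerivAt_apply i q) h
  ext i
  fin_cases i
  · obtain ⟨c, hc, hd⟩ := exists_hasDerivAt_scale hq.1
    have hg : HasFDerivAt (fun p : Fin 8 → ℝ => scale (p 0))
        (c • ContinuousLinearMap.proj (R := ℝ) (φ := fun _ : Fin 8 => ℝ) 0) q :=
      HasDerivAt.comp_hasFDerivAt (h₂ := scale) (f := fun p : Fin 8 → ℝ => p 0) q hd
        (hasFDerivAt_apply (0 : Fin 8) q)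
    have h := key (Complex.reCLM.comp (E 0 0)) (fun p => scale (p 0)) _ hg fun p hp => by
        rw [ContinuousLinearMap.comp_apply, hE 0 0 p hp]
        exact chartEntry_re p
    simpa [hc] using h
  · exact hproj (Complex.imCLM.comp (E 0 0)) 1 fun p hp => by
      rw [ContinuousLinearMap.comp_apply, hE 0 0 p hp]
      exact chartEntry_im p
  · exact hproj (Complex.reCLM.comp (E 0 1)) 2 fun p hp => by
      rw [ContinuousLinearMap.comp_apply, hE 0 1 p hp]
      simp
  · exact hproj (Complex.imCLM.comp (E 0 1)) 3 fun p hp => by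
      rw [ContinuousLinearMap.comp_apply, hE 0 1 p hp]
      simp
  · exact hproj (Complex.reCLM.comp (E 1 0)) 4 fun p hp => by
      rw [ContinuousLinearMap.comp_apply, hE 1 0 p hp]
      simp
  · exact hproj (Complex.imCLM.comp (E 1 0)) 5 fun p hp => by
      rw [ContinuousLinearMap.comp_apply, hE 1 0 p hp]
      simp
  · exact hproj (Complex.reCLM.comp T) 6 fun p hp => by simp [T, chartShift]
  · exact hproj (Complex.imCLM.comp T) 7 fun p hp => by simp [T, chartShift]

lemma injOn_chart : InjOn chart chartDomain := fun p hp q hq h => by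
  -- Shift coordinates of size below `1/4` keep the components of `2(s' - s)` below `1`, so this
  -- lattice vector is zero.
  have hs : chartShift p = chartShift q := by
    have h1 := two_mul_sub_mem_of_orbitMap_eq h
    have h2 := eq_zero_of_mem_Ω_of_abs_lt h1
      (by
        have e : (2 * (chartShift q - chartShift p)).re = 2 * (q 6 - p 6) := by
          simp [chartShift]
        rw [e, abs_lt]
        obtain ⟨h2, h3⟩ := hp.2.1
        obtain ⟨h4, h5⟩ := hq.2.1
        constructor <;> linarith)
      (by
        have e : (2 * (chartShift q - chartShift p)).im = 2 * (q 7 - p 7) := by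
          simp [chartShift]
        rw [e, abs_lt]
        obtain ⟨h2, h3⟩ := hp.2.2
        obtain ⟨h4, h5⟩ := hq.2.2
        constructor <;> linarith)
    have h3 : chartShift q - chartShift p = 0 := by simpa using h2
    exact (sub_eq_zero.1 h3).symm
  have hM : (chartMatrix q).1 = (chartMatrix p).1 := by
    have h1 : orbitMap (chartMatrix p : PSL2C) (chartShift p) =
      orbitMap (chartMatrix q : PSL2C) (chartShift p) := h.trans (by rw [hs]; rfl)
    rcases psl_eq_iff.1 (eq_of_orbitMap_eq h1) with h2 | h2
    · exact h2
    -- The other lift to `SL(2, ℂ)` is excluded by the positive real part of the upper left entry.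
    · exfalso
      rw [chartMatrix_val (chartEntry_ne_zero hp), chartMatrix_val (chartEntry_ne_zero hq)] at h2
      have h3 : chartEntry q = -chartEntry p := congrFun (congrFun h2 0) 0
      have h4 := congrArg Complex.re h3
      rw [Complex.neg_re, chartEntry_re, chartEntry_re] at h4
      linarith [scale_pos hp.1, scale_pos hq.1]
  rw [chartMatrix_val (chartEntry_ne_zero hp), chartMatrix_val (chartEntry_ne_zero hq)] at hM
  have e00 : chartEntry q = chartEntry p := congrFun (congrFun hM 0) 0
  have e01 : (q 2 : ℂ) + q 3 * Complex.I = p 2 + p 3 * Complex.I := congrFun (congrFun hM 0) 1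
  have e10 : (q 4 : ℂ) + q 5 * Complex.I = p 4 + p 5 * Complex.I := congrFun (congrFun hM 1) 0
  have es : (q 6 : ℂ) + q 7 * Complex.I = p 6 + p 7 * Complex.I := hs.symm
  have hre := congrArg Complex.re e00
  have him := congrArg Complex.im e00
  rw [chartEntry_re, chartEntry_re] at hre
  rw [chartEntry_im, chartEntry_im] at him
  ext i
  fin_cases i
  · exact (injOn_scale hq.1 hp.1 hre).symm
  · exact him.symm
  · simpa using (congrArg Complex.re e01).symm
  · simpa using (congrArg Complex.im e01).symm
  · simpa using (congrArg Complex.re e10).symm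
  · simpa using (congrArg Complex.im e10).symm
  · simpa using (congrArg Complex.re es).symm
  · simpa using (congrArg Complex.im es).symm

lemma isModuliCoords_chart : IsModuliCoords chartDomain chart where
  isOpen := isOpen_chartDomain
  mapsTo := fun _ _ => orbitMap_mem_M₂ _ _
  injOn := injOn_chart
  lift := fun _ hq => ⟨chartDomain, isOpen_chartDomain, hq, Subset.rfl, chartMatrix, chartShift,
    contDiffOn_chart_lift, fun _ hp => ⟨injective_fderiv_chart_lift hp, rfl⟩⟩

/-! ### The symmetries in the adapted coordinates -/

/-- The reflection in the coordinates which comes from complex conjugation. -/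
def reflConj : (Fin 8 → ℝ) →ₗ[ℝ] (Fin 8 → ℝ) :=
  LinearMap.pi ![.proj 0, -.proj 1, .proj 2, -.proj 3, .proj 4, -.proj 5, .proj 6, -.proj 7]

/-- The reflection in the coordinates which comes from `z ↦ -z`. -/
def reflNeg : (Fin 8 → ℝ) →ₗ[ℝ] (Fin 8 → ℝ) :=
  LinearMap.pi ![.proj 0, .proj 1, .proj 2, .proj 3, .proj 4, .proj 5, -.proj 6, -.proj 7]

/-- The isometry of the coordinates which comes from `W(z) ↦ -W(-iz)`. -/
def reflI : (Fin 8 → ℝ) →ₗ[ℝ] (Fin 8 → ℝ) :=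
  LinearMap.pi ![.proj 0, .proj 1, -.proj 2, -.proj 3, -.proj 4, -.proj 5, -.proj 7, .proj 6]

lemma chartMatrix_eq_one {q : Fin 8 → ℝ} (h : chartEntry q = 0) : chartMatrix q = 1 := by
  exact dif_pos h

lemma chartMatrix_reflConj (q : Fin 8 → ℝ) : chartMatrix (reflConj q) = conjSL (chartMatrix q) := by
  have he : chartEntry (reflConj q) = (starRingEnd ℂ) (chartEntry q) := by
    simp [chartEntry, reflConj]
  by_cases h : chartEntry q = 0
  · rw [chartMatrix_eq_one h, chartMatrix_eq_one (by rw [he, h, map_zero])]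
    exact (map_one _).symm
  · apply Subtype.ext
    rw [chartMatrix_val (by rw [he]; exact (map_ne_zero _).2 h), he]
    ext i j
    rw [conjSL_apply, chartMatrix_val h]
    fin_cases i <;> fin_cases j <;> simp [reflConj]

lemma chartMatrix_reflNeg (q : Fin 8 → ℝ) : chartMatrix (reflNeg q) = chartMatrix q := by
  have he : chartEntry (reflNeg q) = chartEntry q := by
    simp [chartEntry, reflNeg]
  by_cases h : chartEntry q = 0
  · rw [chartMatrix_eq_one h, chartMatrix_eq_one (by rw [he, h])]
  · apply Subtype.ext
    rw [chartMatrix_val (by rwa [he]), he, chartMatrix_val h]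
    simp [reflNeg]

lemma chartMatrix_reflI (q : Fin 8 → ℝ) : chartMatrix (reflI q) = tauConjSL (chartMatrix q) := by
  have he : chartEntry (reflI q) = chartEntry q := by
    simp [chartEntry, reflI]
  by_cases h : chartEntry q = 0
  · rw [chartMatrix_eq_one h, chartMatrix_eq_one (by rw [he, h])]
    apply Subtype.ext
    rw [tauConjSL_val]
    ext i j
    fin_cases i <;> fin_cases j <;> simp
  · apply Subtype.ext
    rw [tauConjSL_val, chartMatrix_val (by rwa [he]), he, chartMatrix_val h]
    ext i j
    fin_cases i <;> fin_cases j <;> simp [reflI] <;> ring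

lemma chart_reflConj (q : Fin 8 → ℝ) (z : ℂ) :
    chart (reflConj q) ((starRingEnd ℂ) z) = (chart q z).map (starRingEnd ℂ) := by
  have hs : chartShift (reflConj q) = (starRingEnd ℂ) (chartShift q) := by
    simp [chartShift, reflConj]
  rw [chart, chart, chartMatrix_reflConj, hs, orbitMap_conj]

lemma chart_reflNeg (q : Fin 8 → ℝ) (z : ℂ) : chart (reflNeg q) (-z) = chart q z := by
  have hs : chartShift (reflNeg q) = -chartShift q := by
    simp [chartShift, reflNeg]
    ring
  rw [chart, chart, chartMatrix_reflNeg, hs, orbitMap_neg]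

lemma chart_reflI (q : Fin 8 → ℝ) (z : ℂ) :
    chart (reflI q) (Complex.I * z) = (chart q z).map fun w => -w := by
  have hs : chartShift (reflI q) = Complex.I * chartShift q := by
    simp [chartShift, reflI]
    linear_combination -(q 7 : ℂ) * Complex.I_mul_I
  rw [chart, chart, chartMatrix_reflI, hs, orbitMap_I_mul]

lemma metricCoeff_reflConj {i j : Fin 8} {ε δ : ℝ} (hε : ε * ε = 1) (hδ : δ * δ = 1)
    (hi : reflConj (Pi.single i 1) = ε • Pi.single i 1)
    (hj : reflConj (Pi.single j 1) = δ • Pi.single j 1) (q : Fin 8 → ℝ) :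
    metricCoeff chart i j (reflConj q) = ε * δ * metricCoeff chart i j q :=
  metricCoeff_symm (fun l hl _ _ => orbitMap_add hl _ _ _) reflConj Complex.conjLIE
    (fun z => conj_mem_Ω) Complex.conjLIE Complex.conjLIE (fun x y => by simp) (fun x => by simp)
    (fun p z => by
      change toC (chart (reflConj p) ((starRingEnd ℂ) z)) = _
      rw [chart_reflConj, toC_map (map_zero _), Complex.conjLIE_apply])
    hε hδ hi hj q

lemma metricCoeff_reflNeg {i j : Fin 8} {ε δ : ℝ} (hε : ε * ε = 1) (hδ : δ * δ = 1)
    (hi : reflNeg (Pi.single i 1) = ε • Pi.single i 1)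
    (hj : reflNeg (Pi.single j 1) = δ • Pi.single j 1) (q : Fin 8 → ℝ) :
    metricCoeff chart i j (reflNeg q) = ε * δ * metricCoeff chart i j q :=
  metricCoeff_symm (fun l hl _ _ => orbitMap_add hl _ _ _) reflNeg (LinearIsometryEquiv.neg ℝ)
    (fun z => neg_mem_iff) (LinearIsometryEquiv.refl ℝ ℂ) (LinearIsometryEquiv.refl ℝ ℂ)
    (fun x y => by simp) (fun x => by simp)
    (fun p z => by
      rw [LinearIsometryEquiv.coe_neg]
      exact congrArg toC (chart_reflNeg p z))
    hε hδ hi hj q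

lemma metricCoeff_reflI {i j : Fin 8} {ε δ : ℝ} (hε : ε * ε = 1) (hδ : δ * δ = 1)
    (hi : reflI (Pi.single i 1) = ε • Pi.single i 1)
    (hj : reflI (Pi.single j 1) = δ • Pi.single j 1) (q : Fin 8 → ℝ) :
    metricCoeff chart i j (reflI q) = ε * δ * metricCoeff chart i j q :=
  metricCoeff_symm (fun l hl _ _ => orbitMap_add hl _ _ _) reflI mulI
    (fun z => I_mul_mem_Ω) (LinearIsometryEquiv.neg ℝ) (LinearIsometryEquiv.refl ℝ ℂ)
    (fun x y => by simp) (fun x => by simp)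
    (fun p z => by
      change toC (chart (reflI p) (Complex.I * z)) = _
      rw [chart_reflI, toC_map neg_zero]
      rfl)
    hε hδ hi hj q

/-- Every coordinate other than the arc length is reversed by one of the symmetries. -/
lemma exists_reflection {i : Fin 8} (hi : i ≠ 0) :
    ∃ σ : (Fin 8 → ℝ) →ₗ[ℝ] (Fin 8 → ℝ), σ (Pi.single 0 1) = Pi.single 0 1 ∧
      σ (Pi.single i 1) = -Pi.single i 1 ∧
      (∀ q, metricCoeff chart i 0 (σ q) = -metricCoeff chart i 0 q) ∧
      ∀ q, metricCoeff chart 0 0 (σ q) = metricCoeff chart 0 0 q := by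
  have hsum : ∀ σ : (Fin 8 → ℝ) →ₗ[ℝ] (Fin 8 → ℝ),
      (σ = reflConj ∨ σ = reflNeg ∨ σ = reflI) → σ (Pi.single 0 1) = Pi.single 0 1 →
      σ (Pi.single i 1) = -Pi.single i 1 → (∀ q, metricCoeff chart i 0 (σ q) =
        -metricCoeff chart i 0 q) ∧ ∀ q, metricCoeff chart 0 0 (σ q) = metricCoeff chart 0 0 q := by
    intro σ hσ h0 hi
    have h0' : σ (Pi.single 0 1) = (1 : ℝ) • Pi.single 0 1 := by rw [h0, one_smul]
    have hi' : σ (Pi.single i 1) = (-1 : ℝ) • Pi.single i 1 := by rw [hi, neg_one_smul]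
    rcases hσ with rfl | rfl | rfl
    · refine ⟨fun q => ?_, fun q => ?_⟩
      · simpa using metricCoeff_reflConj (by norm_num) (by norm_num) hi' h0' q
      · simpa using metricCoeff_reflConj (by norm_num) (by norm_num) h0' h0' q
    · refine ⟨fun q => ?_, fun q => ?_⟩
      · simpa using metricCoeff_reflNeg (by norm_num) (by norm_num) hi' h0' q
      · simpa using metricCoeff_reflNeg (by norm_num) (by norm_num) h0' h0' q
    · refine ⟨fun q => ?_, fun q => ?_⟩
      · simpa using metricCoeff_reflI (by norm_num) (by norm_num) hi' h0' q
      · simpa using metricCoeff_reflI (by norm_num) (by norm_num) h0' h0' q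
  obtain ⟨σ, hσ, h0, h1⟩ : ∃ σ : (Fin 8 → ℝ) →ₗ[ℝ] (Fin 8 → ℝ),
      (σ = reflConj ∨ σ = reflNeg ∨ σ = reflI) ∧ σ (Pi.single 0 1) = Pi.single 0 1 ∧
      σ (Pi.single i 1) = -Pi.single i 1 := by
    -- Conjugation reverses coordinate `1`, rotation by `i` reverses `2` to `5` (it mixes the two
    -- shifts), and `z ↦ -z` reverses `6` and `7`.
    fin_cases i
    · exact absurd rfl hi
    · refine ⟨reflConj, by simp, ?_, ?_⟩ <;> ext k <;> fin_cases k <;>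
        simp [reflConj]
    all_goals first
      | (refine ⟨reflI, by simp, ?_, ?_⟩ <;> ext k <;> fin_cases k <;>
          simp [reflI]; done)
      | (refine ⟨reflNeg, by simp, ?_, ?_⟩ <;> ext k <;> fin_cases k <;>
          simp [reflNeg])
  exact ⟨σ, h0, h1, hsum σ hσ h0 h1⟩

/-! ### `Σ_V` is a geodesic -/

lemma single_eq_smul (t : ℝ) :
    (Pi.single 0 t : Fin 8 → ℝ) = t • (Pi.single 0 1 : Fin 8 → ℝ) := by
  rw [← Pi.single_smul, smul_eq_mul, mul_one]

lemma single_mem_chartDomain {t : ℝ} (ht : t ∈ Ioo 0 totalLength) :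
    (Pi.single 0 t : Fin 8 → ℝ) ∈ chartDomain := by
  refine ⟨by simpa using ht, ?_, ?_⟩ <;> simp

lemma chart_single {t : ℝ} (ht : t ∈ Ioo 0 totalLength) :
    chart (Pi.single 0 t) = scaledWp (arcParam t) := by
  have hs : chartShift (Pi.single 0 t) = 0 := by simp [chartShift]
  have hM : (chartMatrix (Pi.single 0 t)).1 = !![((√(arcParam t * e₁) : ℝ) : ℂ), 0;
      0, ((1 / √(arcParam t * e₁) : ℝ) : ℂ)] := by
    rw [chartMatrix_val (chartEntry_ne_zero (single_mem_chartDomain ht))]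
    simp [chartEntry, scale]
  rw [chart, hs, orbitMap_diag (arcParam_spec ht).1 hM]

lemma metricCoeff_chart_single {t : ℝ} (ht : t ∈ Ioo 0 totalLength) :
    metricCoeff chart 0 0 (Pi.single 0 t) = 1 := by
  have hd : ∀ z, pderiv 0 (fun p => toC (chart p z)) (Pi.single 0 t) =
      deriv (fun τ => toC (scaledWp (arcParam τ : ℂ) z)) t := fun z => by
    rw [pderiv, lineDeriv]
    have h1 : (fun s : ℝ => toC (chart (Pi.single 0 t + s • Pi.single 0 1) z)) =ᶠ[𝓝 0]
        fun s => toC (scaledWp (arcParam (t + s) : ℂ) z) := by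
      have hc : ContinuousAt (fun s : ℝ => t + s) 0 := by fun_prop
      filter_upwards [hc.eventually_mem (isOpen_Ioo.mem_nhds (by simpa using ht))] with s hs
      rw [← single_eq_smul, ← Pi.single_add, chart_single hs]
    rw [h1.deriv_eq, deriv_comp_const_add (f := fun τ => toC (scaledWp (arcParam τ : ℂ) z)),
      add_zero]
  have hk := kineticEnergy_arcParam ht
  rw [← hk, kineticEnergy, metricCoeff, ← Complex.ofReal_re (∫ z in unitSquare, _),
    ← integral_complex_ofReal]
  congr 2
  ext z
  rw [hd, Complex.mul_conj, Complex.normSq_eq_norm_sq, chart_single ht]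
  push_cast
  rfl

/-- The reflection fixes the point of the curve but changes the sign of this component. -/
lemma metricCoeff_chart_offDiag {i : Fin 8} (hi : i ≠ 0) (t : ℝ) :
    metricCoeff chart i 0 (Pi.single 0 t) = 0 := by
  obtain ⟨σ, h0, -, h, -⟩ := exists_reflection hi
  have h1 := h (Pi.single 0 t)
  rw [single_eq_smul, map_smul, h0] at h1
  rw [single_eq_smul]
  linarith

/-- `g_00` is even in `qⁱ` about the curve, and `deriv` of an even function at `0` vanishes even
without differentiability. -/
lemma pderiv_metricCoeff_eq_zero {i : Fin 8} (hi : i ≠ 0) (t : ℝ) :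
    pderiv i (metricCoeff chart 0 0) (Pi.single 0 t) = 0 := by
  obtain ⟨σ, h0, hσ, -, h⟩ := exists_reflection hi
  have heven : ∀ s : ℝ, metricCoeff chart 0 0 (Pi.single 0 t + -s • Pi.single i 1) =
      metricCoeff chart 0 0 (Pi.single 0 t + s • Pi.single i 1) := fun s => by
    rw [← h, map_add, map_smul, hσ, single_eq_smul, map_smul, h0, smul_neg, neg_smul, neg_neg]
  rw [pderiv, lineDeriv]
  have h1 := deriv_comp_neg
    (fun s : ℝ => metricCoeff chart 0 0 (Pi.single 0 t + s • Pi.single i 1)) 0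
  simp only [heven, neg_zero] at h1
  linarith

lemma pderiv_zero_eq_zero {F : (Fin 8 → ℝ) → ℝ} {t c : ℝ}
    (h : ∀ᶠ s in 𝓝 t, F (Pi.single 0 s) = c) : pderiv 0 F (Pi.single 0 t) = 0 := by
  rw [pderiv, lineDeriv]
  have hc : ContinuousAt (fun s : ℝ => t + s) 0 := by fun_prop
  have h1 : (fun s : ℝ => F (Pi.single 0 t + s • Pi.single 0 1)) =ᶠ[𝓝 0] fun _ => c := by
    filter_upwards [hc.tendsto.eventually (by simpa using h)] with s hs
    rw [← single_eq_smul, ← Pi.single_add, hs]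
  rw [h1.deriv_eq, deriv_const]

lemma geodesicEquation_chart {t : ℝ} (ht : t ∈ Ioo 0 totalLength) :
    GeodesicEquation chart (fun s => Pi.single 0 s) t := fun i => by
  have hd : deriv (fun s : ℝ => (Pi.single 0 s : Fin 8 → ℝ)) = fun _ => Pi.single 0 1 := by
    ext1 s
    have : (fun s : ℝ => (Pi.single 0 s : Fin 8 → ℝ)) = fun s => s • Pi.single 0 1 :=
      funext single_eq_smul
    rw [this]
    simpa using ((hasDerivAt_id s).smul_const (Pi.single 0 1 : Fin 8 → ℝ)).deriv
  have hdd : deriv (deriv (fun s : ℝ => (Pi.single 0 s : Fin 8 → ℝ))) t = 0 := by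
    rw [hd, deriv_const]
  have hdi : ∀ j : Fin 8, j ≠ 0 → (Pi.single 0 1 : Fin 8 → ℝ) j = 0 := fun j hj =>
    Pi.single_eq_of_ne hj 1
  rw [hdd, hd]
  simp only [Pi.zero_apply, mul_zero, Finset.sum_const_zero, zero_add]
  -- The acceleration is zero and the velocity is the basis vector `e₀`, so only `∂₀ g_i0 - ½ ∂_i
  -- g_00` survives.
  rw [Finset.sum_eq_single 0 (fun j _ hj => by simp [hdi j hj]) (by simp),
    Finset.sum_eq_single 0 (fun j _ hj => by simp [hdi j hj]) (by simp)]
  have h0 : pderiv 0 (metricCoeff chart i 0) (Pi.single 0 t) = 0 := by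
    by_cases hi : i = 0
    · subst hi
      refine pderiv_zero_eq_zero (c := 1) ?_
      filter_upwards [isOpen_Ioo.mem_nhds ht] with s hs
      exact metricCoeff_chart_single hs
    · exact pderiv_zero_eq_zero (c := 0)
        (Eventually.of_forall fun s => metricCoeff_chart_offDiag hi s)
  have h1 : pderiv i (metricCoeff chart 0 0) (Pi.single 0 t) = 0 := by
    by_cases hi : i = 0
    · subst hi
      exact h0
    · exact pderiv_metricCoeff_eq_zero hi t
  rw [h0, h1]
  simp

lemma isGeodesicOn_sigmaV :
    IsGeodesicOn (fun t => scaledWp (arcParam t : ℂ)) (Ioo 0 totalLength) := fun t₀ ht₀ => by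
  refine ⟨chartDomain, chart, isModuliCoords_chart, Ioo 0 totalLength, fun s => Pi.single 0 s,
    isOpen_Ioo, ht₀, Subset.rfl, ?_, fun t ht => ⟨single_mem_chartDomain ht, (chart_single ht).symm,
      geodesicEquation_chart ht⟩⟩
  have : (fun s : ℝ => (Pi.single 0 s : Fin 8 → ℝ)) = fun s => s • Pi.single 0 1 :=
    funext single_eq_smul
  rw [this]
  exact (contDiff_id.smul contDiff_const).contDiffOn

/-! ### Maximality -/

lemma countable_linear_wp {c d : ℂ} (h : c ≠ 0 ∨ d ≠ 0) :
    {z | z ∉ Ω ∧ c * (1 / (e₁ : ℂ) * wp z) + d = 0}.Countable := by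
  have he : (e₁ : ℂ) ≠ 0 := by exact_mod_cast e₁_ne_zero
  by_cases hc : c = 0
  · convert countable_empty
    ext z
    simpa [hc] using fun _ => h.resolve_left (not_not.2 hc)
  · refine (countable_wp_fibre (-d * e₁ / c)).mono ?_
    rintro z ⟨hz, h0⟩
    refine ⟨hz, ?_⟩
    field_simp at h0 ⊢
    linear_combination h0

/-- A geodesic has finite nonzero limits at generic points of the torus. -/
lemma IsGeodesicOn.exists_tendsto {γ : ℝ → ℂ → OnePoint ℂ} {J : Set ℝ} (h : IsGeodesicOn γ J)
    {t₀ : ℝ} (ht₀ : t₀ ∈ J) : ∃ z w : ℂ, wp z ≠ 0 ∧ w ≠ 0 ∧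
      Tendsto (fun t => toC (γ t z)) (𝓝 t₀) (𝓝 w) := by
  obtain ⟨U, ψ, hψ, K, q, hK, htK, -, hq, hγ⟩ := h t₀ ht₀
  obtain ⟨V, hV, hqV, -, A, s, hAs, hψV⟩ := hψ.lift (q t₀) (hγ t₀ htK).1
  have hqc : ContinuousAt q t₀ := (hq.continuousOn).continuousAt (hK.mem_nhds htK)
  have hASc : ContinuousAt (fun p => (entries A p, s p)) (q t₀) :=
    hAs.continuousOn.continuousAt (hV.mem_nhds hqV)
  have hA : ∀ i j, ContinuousAt (fun t => (A (q t)).1 i j) t₀ := fun i j => by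
    have h1 : ContinuousAt (fun p => entries A p i j) (q t₀) :=
      (continuousAt_pi.1 (continuousAt_pi.1 hASc.fst i) j)
    exact h1.comp hqc
  have hs : ContinuousAt (fun t => s (q t)) t₀ := hASc.snd.comp hqc
  set M := (A (q t₀)).1 with hM
  have hdet := det_SL (A (q t₀))
  rw [← hM] at hdet
  have hc1 : M 0 0 ≠ 0 ∨ M 0 1 ≠ 0 := by
    by_contra! hcon
    simp [hcon.1, hcon.2] at hdet
  have hc2 : M 1 0 ≠ 0 ∨ M 1 1 ≠ 0 := by
    by_contra! hcon
    simp [hcon.1, hcon.2] at hdet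
  set s₀ := s (q t₀) with hs₀
  -- Points to avoid: poles and zeros of `℘`, poles of the translate by `s₀`, and zeros of the
  -- numerator and denominator of the limiting Möbius transform. Both linear forms are nontrivial
  -- since the determinant is `1`, so the set is countable.
  let T : Set ℂ := ((Ω : Set ℂ) ∪ (fun z => z + ζ) ⁻¹' Ω) ∪ (fun z => z - s₀) ⁻¹' ((Ω : Set ℂ) ∪
    ({z | z ∉ Ω ∧ M 0 0 * (1 / (e₁ : ℂ) * wp z) + M 0 1 = 0} ∪
      {z | z ∉ Ω ∧ M 1 0 * (1 / (e₁ : ℂ) * wp z) + M 1 1 = 0}))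
  have hT : T.Countable :=
    (countable_Ω.union (countable_Ω.preimage_of_injOn (add_left_injective _).injOn)).union
      ((countable_Ω.union ((countable_linear_wp hc1).union
        (countable_linear_wp hc2))).preimage_of_injOn (sub_left_injective).injOn)
  obtain ⟨z, hz⟩ := (hT.dense_compl ℝ).nonempty
  simp only [T, mem_compl_iff, mem_union, mem_preimage, not_or, mem_ofPred_eq, not_and,
    SetLike.mem_coe] at hz
  obtain ⟨⟨hz1, hz2⟩, hz3, hz4, hz5⟩ := hz
  have hz4 := hz4 hz3
  have hz5 := hz5 hz3
  have hsub : ContinuousAt (fun t => z - s (q t)) t₀ := continuousAt_const.sub hs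
  have hφ : ContinuousAt (fun t => 1 / (e₁ : ℂ) * wp (z - s (q t))) t₀ :=
    continuousAt_const.mul
      (ContinuousAt.comp (f := fun t => z - s (q t)) (analyticAt_wp hz3).continuousAt hsub)
  have hnum := ((hA 0 0).mul hφ).add (hA 0 1)
  have hden := ((hA 1 0).mul hφ).add (hA 1 1)
  refine ⟨z, _, wp_ne_zero hz1 hz2, div_ne_zero hz4 hz5, ((hnum.div hden hz5).tendsto).congr' ?_⟩
  filter_upwards [hK.mem_nhds htK, hqc.eventually_mem (hV.mem_nhds hqV),
    hsub.eventually_mem (isClosed_Ω.isOpen_compl.mem_nhds hz3), hden.eventually_ne hz5]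
    with t h1 h2 h3 h4
  have h3 : z - s (q t) ∉ Ω := h3
  have h4 : (A (q t)).1 1 0 * (1 / (e₁ : ℂ) * wp (z - s (q t))) + (A (q t)).1 1 1 ≠ 0 := h4
  rw [(hγ t h1).2.1, (hψV (q t) h2).2, orbitMap, scaledWp, if_neg h3, mobius_coe, homog,
    if_neg h4]
  rfl

/-- An order-connected extension beyond the interval must contain an endpoint. There the value at a
generic point would have a finite nonzero limit, while `α ℘(z)` tends to `0` at the left end and is
unbounded at the right end. -/
lemma isMaximalGeodesicOn_sigmaV :
    IsMaximalGeodesicOn (fun t => scaledWp (arcParam t : ℂ)) (Ioo 0 totalLength) := by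
  refine ⟨isGeodesicOn_sigmaV, fun γ J _ hJ hIJ hγ heq => ?_⟩
  have hpos := totalLength_pos
  have hval : ∀ t ∈ Ioo 0 totalLength, ∀ z, toC (γ t z) = arcParam t * wp z := fun t ht z => by
    rw [← toC_scaledWp]
    exact congrArg (fun W => toC (W z)) (heq ht).symm
  have hmid : totalLength / 2 ∈ J := hIJ ⟨by linarith, by linarith⟩
  have h0 : (0 : ℝ) ∉ J := fun hmem => by
    obtain ⟨z, w, -, hw, hlim⟩ := hγ.exists_tendsto hmem
    have h1 : Tendsto (fun t => (arcParam t : ℂ) * wp z) (𝓝[>] 0) (𝓝 0) := by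
      have := ((Complex.continuous_ofReal.tendsto 0).comp tendsto_arcParam_zero).mul_const (wp z)
      simpa using this
    refine hw (tendsto_nhds_unique (hlim.mono_left nhdsWithin_le_nhds) (h1.congr' ?_))
    filter_upwards [Ioo_mem_nhdsGT hpos] with t ht
    exact (hval t ht z).symm
  have hl : totalLength ∉ J := fun hmem => by
    obtain ⟨z, w, hz, -, hlim⟩ := hγ.exists_tendsto hmem
    have h1 : Tendsto (fun t => arcParam t * ‖wp z‖) (𝓝[<] totalLength) atTop :=
      tendsto_arcParam_totalLength.atTop_mul_const (norm_pos_iff.2 hz)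
    refine not_tendsto_nhds_of_tendsto_atTop h1 ‖w‖
      ((hlim.mono_left nhdsWithin_le_nhds).norm.congr' ?_)
    filter_upwards [Ioo_mem_nhdsLT hpos] with t ht
    rw [hval t ht z, norm_mul, Complex.norm_real, Real.norm_of_nonneg (arcParam_spec ht).1.le]
  refine Subset.antisymm (fun x hx => ⟨?_, ?_⟩) hIJ
  · by_contra hcon
    exact h0 (hJ.out hx hmid ⟨not_lt.1 hcon, by linarith⟩)
  · by_contra hcon
    exact hl (hJ.out hmid hx ⟨by linarith, not_lt.1 hcon⟩)

lemma not_geodesicallyComplete : ¬ GeodesicallyComplete := fun h => by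
  have hpos := totalLength_pos
  obtain ⟨γ, hγ, heq⟩ := h _ _ isOpen_Ioo ordConnected_Ioo (nonempty_Ioo.2 hpos)
    isGeodesicOn_sigmaV
  have := isMaximalGeodesicOn_sigmaV.2 γ univ isOpen_univ ordConnected_univ (subset_univ _) hγ heq
  have h0 : (0 : ℝ) ∈ Ioo 0 totalLength := this ▸ mem_univ _
  exact lt_irrefl _ h0.1

end LumpTorus

end

theorem theorem2 :
    -- the moduli space is geodesically incomplete
    ¬ LumpTorus.GeodesicallyComplete ∧
    -- the constant `e₁ = ℘(1/2)` is real and positive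
    LumpTorus.wp (1 / 2) = (LumpTorus.e₁ : ℂ) ∧ 0 < LumpTorus.e₁ ∧
    -- the lift of `Σ_V` is the identity component of the fixed point set of a Klein four-group
    -- `{1, P, R, P R}` of isometries
    (∃ P R : Equiv.Perm LumpTorus.PSL2C,
      (∀ M : LumpTorus.SL2C, P (M : LumpTorus.PSL2C) = (LumpTorus.conjSL M : LumpTorus.PSL2C)) ∧
      (∀ M : LumpTorus.SL2C, R (M : LumpTorus.PSL2C) = (LumpTorus.tauConjSL M : LumpTorus.PSL2C)) ∧
      ∃ V : Subgroup (Equiv.Perm LumpTorus.PSL2C),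
        (V : Set (Equiv.Perm LumpTorus.PSL2C)) = {1, P, R, P * R} ∧ IsKleinFour V ∧
        (∀ F ∈ V, LumpTorus.IsGroupIsometry F) ∧
        connectedComponentIn {g : LumpTorus.PSL2C | ∀ F ∈ V, F g = g} 1 = LumpTorus.sigmaHatV) ∧
    (fun g => LumpTorus.orbitMap g 0) '' LumpTorus.sigmaHatV = LumpTorus.sigmaV ∧
    -- `Σ_V`, parametrized by arc length over a bounded interval, is a maximal geodesic
    (∃ a : ℝ → ℝ, StrictMonoOn a (Set.Ioo 0 LumpTorus.totalLength) ∧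
      a '' Set.Ioo 0 LumpTorus.totalLength = Set.Ioi 0 ∧
      LumpTorus.IsMaximalGeodesicOn (fun t => LumpTorus.scaledWp (a t : ℂ))
        (Set.Ioo 0 LumpTorus.totalLength) ∧
      ∀ t ∈ Set.Ioo 0 LumpTorus.totalLength,
        LumpTorus.kineticEnergy (fun t => LumpTorus.scaledWp (a t : ℂ)) t = 1) ∧
    -- the induced metric on `Σ_V` is `f(α) dα²`, and the length of `Σ_V` is finite
    (∀ α : ℝ, 0 < α →
      MeasureTheory.IntegrableOn
        (fun z => ‖LumpTorus.wp z‖ ^ 2 / (1 + α ^ 2 * ‖LumpTorus.wp z‖ ^ 2) ^ 2)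
        LumpTorus.unitSquare ∧
      LumpTorus.kineticEnergy (fun β => LumpTorus.scaledWp (β : ℂ)) α = LumpTorus.f α) ∧
    MeasureTheory.IntegrableOn (fun α => √(LumpTorus.f α)) (Set.Ioi 0) ∧
    LumpTorus.curveLength (fun α => LumpTorus.scaledWp (α : ℂ)) (Set.Ioi 0) =
      ENNReal.ofReal LumpTorus.totalLength ∧
    -- the asymptotics of `f`
    Asymptotics.IsEquivalent (nhdsWithin 0 (Set.Ioi 0)) LumpTorus.f
      (fun α => Real.pi ^ 2 / (4 * α)) ∧
    Asymptotics.IsEquivalent Filter.atTop LumpTorus.f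
      (fun α => Real.pi ^ 2 / (4 * LumpTorus.e₁ ^ 2 * α ^ 3)) := by
  exact ⟨LumpTorus.not_geodesicallyComplete, LumpTorus.wp_half, LumpTorus.e₁_pos,
    ⟨LumpTorus.conjPerm, LumpTorus.tauPerm, LumpTorus.conjPerm_mk, LumpTorus.tauPerm_mk,
      LumpTorus.kleinGroup, LumpTorus.coe_kleinGroup, LumpTorus.isKleinFour_kleinGroup,
      fun _ => LumpTorus.isGroupIsometry_of_mem_kleinGroup,
      LumpTorus.connectedComponentIn_fixed⟩,
    LumpTorus.image_sigmaHatV,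
    ⟨LumpTorus.arcParam, LumpTorus.strictMonoOn_arcParam, LumpTorus.image_arcParam,
      LumpTorus.isMaximalGeodesicOn_sigmaV, fun _ => LumpTorus.kineticEnergy_arcParam⟩,
    fun α hα => ⟨LumpTorus.integrableOn_f hα, LumpTorus.kineticEnergy_scaledWp_id α⟩,
    LumpTorus.integrableOn_sqrt_f, LumpTorus.curveLength_sigmaV,
    LumpTorus.f_isEquivalent_zero, LumpTorus.f_isEquivalent_atTop⟩
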